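/- **Definitions.** A group action on a metric space is *geometric* if it is isometric, properly discontinuous and cocompact. A *flat* in a $\mathrm{CAT}(0)$ space $X$ is (the image of) an isometric embedding of a Euclidean space $\mathbb{E}^k$, $k\ge 2$. The space $X$ has *isolated flats* if there is a family $\mathcal F$ of flats, invariant under $\mathrm{Isom}(X)$, such that (i) for some constant $B$ every flat of $X$ lies in the $B$-neighbourhood of some $F\in\mathcal F$, and (ii) for some function $\psi:\mathbb{R}_+\to\mathbb{R}_+$, any two distinct $F_1,F_2\in\mathcal F$ and any $k\ge 0$, the intersection of the $k$-neighbourhoods of $F_1$ and $F_2$ has diameter at most $\psi(k)$. Paths $\alpha:[0,a]\to X$ and $\alpha':[0,a']\to X$ *$L$-fellow travel relative to flats* if there are $n\ge 0$, flats $F_1,\dots,F_n$ and partitions $0=t_0\le s_0\le t_1\le\dots\le t_n\le s_n=a$ and $0=t_0'\le s_0'\le t_1'\le\dots\le t_n'\le s_n'=a'$ such that for $0\le i\le n$ the sets $\alpha([t_i,s_i])$ and $\alpha'([t_i',s_i'])$ have Hausdorff distance at most $L$, and for $1\le i\le n$ the sets $\alpha([s_{i-1},t_i])$ and $\alpha'([s_{i-1}',t_i'])$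 lie in the $L$-neighbourhood of $F_i$. The space $X$ has the *Relative Fellow Traveller Property* (RFTP) if for all $\lambda\ge 1$, $\epsilon\ge 0$ there is $L=L(\lambda,\epsilon,X)$ such that any two (continuous) $(\lambda,\epsilon)$-quasigeodesics in $X$ with common endpoints $L$-fellow travel relative to flats. Given a geometric action of $G$ on $X$, a subgroup $H\le G$ is *quasiconvex* if for some $x_0\in X$ and $\nu\ge 0$ every geodesic of $X$ joining two points of $Hx_0$ lies in the $\nu$-neighbourhood of $Hx_0$. The *visual boundary* $\partial X$ is the set of asymptoty classes of geodesic rays, with the compact-open topology on the rays issuing from any fixed basepoint, and the *limit set* $\Lambda H\subseteq\partial X$ is the set of accumulation points in $\partial X$ of an orbit $Hx$ in the cone topology on $X\cup\partial X$, with the subspace topology. **Theorem.** For $i=1,2$ let the group $G_i$ act geometrically on a non-empty $\mathrm{CAT}(0)$ space $X_i$ which has isolated flats and the Relative Fellow Traveller Property. (1) Let $H_i\le G_i$ be a quasiconvex subgroup with respect to the given action, $i=1,2$. Then any isomorphism $\eta:H_1\to H_2$ induces an $\eta$-equivariant homeomorphism $f:\Lambda H_1\to\Lambda H_2$. That is,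 there is a homeomorphism $f$ with $f(h\xi)=\eta(h)f(\xi)$ for all $h\in H_1$, $\xi\in\Lambda H_1$, and such that, for all $x_1\in X_1$, $x_2\in X_2$, every sequence $(h_n)$ in $H_1$ and every $\xi\in\Lambda H_1$, if $h_nx_1\to\xi$ then $\eta(h_n)x_2\to f(\xi)$. (2) In particular the visual boundary is a group invariant for such groups: for any isomorphism $\eta:G_1\to G_2$ there is an $\eta$-equivariant homeomorphism $\partial X_1\to\partial X_2$. -/

import Mathlib

open Set Filter Topology
open scoped NNReal

namespace CAT0Boundary

section MetricNotions

variable {X : Type*} [MetricSpace X]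

/-- `γ`, restricted to `[0, d(x, y)]`, is a geodesic from `x` to `y`, parametrized by arclength. -/
structure IsGeodesic (γ : ℝ → X) (x y : X) : Prop where
  source : γ 0 = x
  target : γ (dist x y) = y
  isom : ∀ s ∈ Icc (0 : ℝ) (dist x y), ∀ t ∈ Icc (0 : ℝ) (dist x y), dist (γ s) (γ t) = |s - t|

variable (X) in
/-- A `CAT(0)` space: a geodesic space whose geodesic triangles are not thicker than their
comparison triangles in the Euclidean plane.  Two points on the sides of a triangle that issue
from the vertex `p` are compared; as `p` may be any vertex, this treats every pair of sides. -/
structure IsCAT0 : Prop where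
  geodesic : ∀ x y : X, ∃ γ : ℝ → X, IsGeodesic γ x y
  comparison : ∀ (p q r : X) (α β γ : ℝ → X),
    IsGeodesic α p q → IsGeodesic β p r → IsGeodesic γ q r →
    ∀ p' q' r' : EuclideanSpace ℝ (Fin 2),
      dist p' q' = dist p q → dist p' r' = dist p r → dist q' r' = dist q r →
      ∀ u ∈ Icc (0 : ℝ) 1, ∀ v ∈ Icc (0 : ℝ) 1,
        dist (α (u * dist p q)) (β (v * dist p r)) ≤
          dist (AffineMap.lineMap p' q' u) (AffineMap.lineMap p' r' v)

/-- A flat: an isometrically embedded Euclidean space of dimension at least two. -/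
def IsFlat (F : Set X) : Prop :=
  ∃ k : ℕ, 2 ≤ k ∧ ∃ f : EuclideanSpace ℝ (Fin k) → X, Isometry f ∧ F = range f

variable (X) in
/-- Isolated flats: there is a family of flats which is maximal, isolated and equivariant. -/
def HasIsolatedFlats : Prop :=
  ∃ 𝓕 : Set (Set X), (∀ F ∈ 𝓕, IsFlat F) ∧
    (∃ B : ℝ, ∀ F : Set X, IsFlat F → ∃ F' ∈ 𝓕, F ⊆ Metric.cthickening B F') ∧
    (∃ ψ : ℝ≥0 → ℝ≥0, ∀ F₁ ∈ 𝓕, ∀ F₂ ∈ 𝓕, F₁ ≠ F₂ → ∀ k : ℝ≥0,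
      ∀ x ∈ Metric.cthickening k F₁ ∩ Metric.cthickening k F₂,
      ∀ y ∈ Metric.cthickening k F₁ ∩ Metric.cthickening k F₂, dist x y ≤ ψ k) ∧
    (∀ g : X ≃ᵢ X, ∀ F ∈ 𝓕, g '' F ∈ 𝓕)

/-- `α` restricted to `[0, a]` is a (continuous) `(lam, ε)`-quasigeodesic path. -/
structure IsQuasigeodesic (lam ε a : ℝ) (α : ℝ → X) : Prop where
  nonneg : 0 ≤ a
  cont : ContinuousOn α (Icc 0 a)
  lower : ∀ s ∈ Icc 0 a, ∀ t ∈ Icc 0 a, 1 / lam * |s - t| - ε ≤ dist (α s) (α t)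
  upper : ∀ s ∈ Icc 0 a, ∀ t ∈ Icc 0 a, dist (α s) (α t) ≤ lam * |s - t| + ε

/-- The paths `α : [0, a] → X` and `α' : [0, a'] → X` `L`-fellow travel relative to the sequence
of flats `F 0, …, F (n - 1)`. -/
def FellowTravelAlong (L : ℝ) (n : ℕ) (F : ℕ → Set X) (a : ℝ) (α : ℝ → X) (a' : ℝ)
    (α' : ℝ → X) : Prop :=
  ∃ t s t' s' : ℕ → ℝ,
    (t 0 = 0 ∧ s n = a ∧ (∀ i ≤ n, t i ≤ s i) ∧ ∀ i < n, s i ≤ t (i + 1)) ∧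
    (t' 0 = 0 ∧ s' n = a' ∧ (∀ i ≤ n, t' i ≤ s' i) ∧ ∀ i < n, s' i ≤ t' (i + 1)) ∧
    (∀ i ≤ n, Metric.hausdorffEDist (α '' Icc (t i) (s i)) (α' '' Icc (t' i) (s' i)) ≤
      ENNReal.ofReal L) ∧
    (∀ i < n, α '' Icc (s i) (t (i + 1)) ⊆ Metric.cthickening L (F i) ∧
      α' '' Icc (s' i) (t' (i + 1)) ⊆ Metric.cthickening L (F i))

variable (X) in
/-- The Relative Fellow Traveller Property: quasigeodesics with common endpoints fellow travel
relative to flats, with a constant depending only on the quasigeodesic constants. -/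
def HasRFTP : Prop :=
  ∀ lam ε : ℝ, 1 ≤ lam → 0 ≤ ε → ∃ L : ℝ, 0 ≤ L ∧
    ∀ (a : ℝ) (α : ℝ → X) (a' : ℝ) (α' : ℝ → X),
      IsQuasigeodesic lam ε a α → IsQuasigeodesic lam ε a' α' →
      α 0 = α' 0 → α a = α' a' →
      ∃ (n : ℕ) (F : ℕ → Set X), (∀ i < n, IsFlat (F i)) ∧ FellowTravelAlong L n F a α a' α'

/-- A quasiconvex subspace: geodesics with endpoints in `Y` stay uniformly close to `Y`. -/
def IsQuasiconvex (Y : Set X) : Prop :=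
  ∃ ν : ℝ, 0 ≤ ν ∧ ∀ x ∈ Y, ∀ y ∈ Y, ∀ γ : ℝ → X, IsGeodesic γ x y →
    γ '' Icc 0 (dist x y) ⊆ Metric.cthickening ν Y

end MetricNotions

section Actions

variable (G X : Type*) [Group G] [MetricSpace X] [MulAction G X]

/-- A geometric action: isometric, properly discontinuous and cocompact. -/
structure IsGeometricAction : Prop where
  isometric : IsIsometricSMul G X
  properlyDiscontinuous : ProperlyDiscontinuousSMul G X
  cocompact : ∃ K : Set X, IsCompact K ∧ ⋃ g : G, (fun x => g • x) '' K = univ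

variable {G} in
/-- The subgroup `H` is quasiconvex with respect to the given action of `G` on `X`. -/
def IsQuasiconvexSubgroup (H : Subgroup G) : Prop :=
  ∃ x₀ : X, IsQuasiconvex (MulAction.orbit H x₀)

end Actions

section Boundary

variable (X : Type*) [MetricSpace X]

/-- Geodesic rays `[0, ∞) → X`, with the compact-open topology. -/
abbrev Ray : Type _ := {c : C(ℝ≥0, X) // Isometry c}

/-- Two rays are asymptotic if they stay at bounded distance from each other. -/
def asymptoticSetoid : Setoid (Ray X) where
  r c c' := ∃ K : ℝ, ∀ t : ℝ≥0, dist (c.1 t) (c'.1 t) ≤ K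
  iseqv :=
    { refl := fun c => ⟨0, fun t => by simp⟩
      symm := fun ⟨K, h⟩ => ⟨K, fun t => by rw [dist_comm]; exact h t⟩
      trans := fun ⟨K, h⟩ ⟨K', h'⟩ =>
        ⟨K + K', fun t => (dist_triangle _ _ _).trans (add_le_add (h t) (h' t))⟩ }

/-- The set underlying the visual boundary `∂X`: asymptoty classes of geodesic rays. -/
def VisualBoundary : Type _ := Quotient (asymptoticSetoid X)

variable {X}

/-- The boundary point `c(∞)` represented by the ray `c`. -/
def Ray.endpoint (c : Ray X) : VisualBoundary X := Quotient.mk (asymptoticSetoid X) c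

/-- The topology of `∂X` seen from the basepoint `p`: the compact-open topology on the rays
issuing from `p`, transported along `c ↦ c(∞)` (a bijection onto `∂X` if `X` is a complete
`CAT(0)` space). -/
@[reducible] def coneTopology (p : X) : TopologicalSpace (VisualBoundary X) :=
  TopologicalSpace.coinduced (fun c : {c : Ray X // c.1 0 = p} => c.1.endpoint) inferInstance

/-- The subspace topology on a subset of the boundary, seen from the basepoint `p`. -/
@[reducible] def coneTopologyOn (p : X) (S : Set (VisualBoundary X)) : TopologicalSpace S :=
  (coneTopology p).induced Subtype.val

/-- The points `x n` of `X` converge to the boundary point `ξ` in the cone topology on `X ∪ ∂X`: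
for a ray `c` representing `ξ`, the distances `d(c(0), x n)` tend to infinity and the geodesics
from `c(0)` to `x n` converge pointwise to `c`. -/
def ConvergesToBoundary (x : ℕ → X) (ξ : VisualBoundary X) : Prop :=
  ∃ c : Ray X, c.endpoint = ξ ∧ ∀ (r : ℝ≥0) (ε : ℝ), 0 < ε → ∀ᶠ n in atTop,
    (r : ℝ) < dist (c.1 0) (x n) ∧
      ∃ γ : ℝ → X, IsGeodesic γ (c.1 0) (x n) ∧ dist (γ r) (c.1 r) < ε

variable {G : Type*} [Group G] [MulAction G X]

variable (X) in
/-- The limit set of `H`: the accumulation points in `∂X` of an orbit of `H`. -/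
def limitSet (H : Subgroup G) : Set (VisualBoundary X) :=
  {ξ | ∃ (x : X) (h : ℕ → H), ConvergesToBoundary (fun n => h n • x) ξ}

variable [IsIsometricSMul G X]

/-- The translate of a ray by an isometry. -/
def Ray.translate (g : G) (c : Ray X) : Ray X :=
  ⟨⟨fun t => g • c.1 t, (c.1.continuous).const_smul g⟩, (isometry_smul X g).comp c.2⟩

/-- The action of a group of isometries of `X` on `∂X`, given by `g • c(∞) = (g • c)(∞)`. -/
instance : MulAction G (VisualBoundary X) where
  smul g := Quotient.map (Ray.translate g) (by
    rintro c c' ⟨K, h⟩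
    exact ⟨K, fun t => by simpa [Ray.translate, dist_smul] using h t⟩)
  one_smul := by
    rintro ⟨c⟩
    refine congrArg (Quotient.mk _) ?_
    ext t
    exact one_smul G (c.1 t)
  mul_smul := by
    rintro g g' ⟨c⟩
    refine congrArg (Quotient.mk _) ?_
    ext t
    exact mul_smul g g' (c.1 t)

theorem smul_endpoint (g : G) (c : Ray X) : g • c.endpoint = (c.translate g).endpoint := rfl

theorem IsGeodesic.smul {γ : ℝ → X} {x y : X} (hγ : IsGeodesic γ x y) (g : G) :
    IsGeodesic (fun t => g • γ t) (g • x) (g • y) where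
  source := by rw [hγ.source]
  target := by rw [dist_smul, hγ.target]
  isom := by
    intro s hs t ht
    rw [dist_smul] at hs ht ⊢
    exact hγ.isom s hs t ht

theorem ConvergesToBoundary.smul {x : ℕ → X} {ξ : VisualBoundary X}
    (hx : ConvergesToBoundary x ξ) (g : G) :
    ConvergesToBoundary (fun n => g • x n) (g • ξ) := by
  obtain ⟨c, rfl, hc⟩ := hx
  refine ⟨c.translate g, rfl, fun r ε hε => (hc r ε hε).mono ?_⟩
  rintro n ⟨h1, γ, hγ, h2⟩
  refine ⟨?_, fun t => g • γ t, hγ.smul g, ?_⟩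
  · simpa [Ray.translate, dist_smul] using h1
  · simpa [Ray.translate, dist_smul] using h2

theorem smul_mem_limitSet {H : Subgroup G} (h : H) {ξ : VisualBoundary X}
    (hξ : ξ ∈ limitSet X H) : (h : G) • ξ ∈ limitSet X H := by
  obtain ⟨x, k, hk⟩ := hξ
  refine ⟨x, fun n => h * k n, ?_⟩
  have := hk.smul (h : G)
  simpa [Subgroup.smul_def, mul_smul] using this

/-- The action of `H` on its limit set, restricted from the action on `∂X`. -/
instance (H : Subgroup G) : MulAction H (limitSet X H) where
  smul h ξ := ⟨(h : G) • ξ.1, smul_mem_limitSet h ξ.2⟩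
  one_smul ξ := Subtype.ext (one_smul G ξ.1)
  mul_smul h k ξ := Subtype.ext (mul_smul (h : G) (k : G) ξ.1)

end Boundary

end CAT0Boundary

open CAT0Boundary

/-! Quasiconvexity makes the orbit maps `h ↦ h • x₁` and `h ↦ η h • x₂` coarsely Lipschitz functions
of each other. In a hyperbolic space this would suffice: quasigeodesics stay near geodesics, so
geodesics that agree for a long time in `X₁` correspond to geodesics that agree for a long time in
`X₂`, and the orbit map extends to the boundary. With flats present, the relative fellow traveller
property controls the image of a geodesic only outside flats; inside a flat a quasigeodesic may
wander off.

The missing control is algebraic. The stabilizer of an isolated flat acts coarsely transitively on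
it and, by Bieberbach's argument, contains a finitely generated abelian group that still does.
Pulled back to `H₁`, this group acts on both spaces. An abelian orbit is coarsely affine
(`exists_dist_floor_smul_pt_le`): the point at parameter `t` of the geodesic from `x` to `(∑ nᵢ eᵢ)
x` is near `(∑ ⌊t nᵢ⌋ eᵢ) x`. The same group element marks this point in both spaces, so positions
along geodesics agree coarsely near flats (`exists_dist_pt_le_of_near_flats`). Local finiteness of
the flats makes the constants uniform.

Coarse affineness comes from the squared displacement: at a point of minimal displacement it
satisfies the parallelogram law, hence is a quadratic form, and the `CAT(0)` inequality at parameter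
`t` bounds the squared error by that form at a vector with bounded coefficients.

Both controls together show that orbit points near a geodesic in `X₁` are mapped near the
corresponding geodesic in `X₂` (`exists_dist_map_smul_pt_le`), hence `ArcControl`. Convexity of the
metric turns bounded closeness at late times into arbitrary closeness at earlier times, which gives
existence, well-definedness and continuity of the boundary map. The inverse comes from `η.symm`, and
the second statement is the first one for the full groups. -/

namespace CAT0Boundary

/-! ### Euclidean comparison triangles. -/

section Comparison

theorem norm_sq_convex_combination {E : Type*} [NormedAddCommGroup E] [InnerProductSpace ℝ E]
    (a b : E) (u : ℝ) :
    ‖(1 - u) • a + u • b‖ ^ 2 =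
      (1 - u) * ‖a‖ ^ 2 + u * ‖b‖ ^ 2 - u * (1 - u) * ‖a - b‖ ^ 2 := by
  rw [norm_add_sq_real, norm_sub_sq_real, norm_smul, norm_smul, inner_smul_left, inner_smul_right,
    mul_pow, mul_pow, Real.norm_eq_abs, Real.norm_eq_abs, sq_abs, sq_abs]
  simp only [conj_trivial]
  ring

/-- Stewart's identity, the Euclidean side of the comparison between a vertex and a point of the
opposite side. -/
theorem dist_sq_lineMap {E : Type*} [NormedAddCommGroup E] [InnerProductSpace ℝ E]
    (p q z : E) (u : ℝ) :
    dist (AffineMap.lineMap p q u) z ^ 2 =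
      (1 - u) * dist p z ^ 2 + u * dist q z ^ 2 - u * (1 - u) * dist p q ^ 2 := by
  have h : AffineMap.lineMap p q u - z = (1 - u) • (p - z) + u • (q - z) := by
    rw [AffineMap.lineMap_apply_module]
    module
  rw [dist_eq_norm, h, norm_sq_convex_combination, dist_eq_norm, dist_eq_norm, dist_eq_norm]
  simp

theorem exists_comparison_triangle {a b c : ℝ} (ha : 0 ≤ a) (hb : 0 ≤ b) (hc : 0 ≤ c)
    (h1 : a ≤ b + c) (h2 : b ≤ a + c) (h3 : c ≤ a + b) :
    ∃ p q r : EuclideanSpace ℝ (Fin 2), dist p q = a ∧ dist p r = b ∧ dist q r = c := by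
  rcases ha.eq_or_lt with rfl | ha
  · obtain rfl : b = c := by linarith
    refine ⟨!₂[0, 0], !₂[0, 0], !₂[b, 0], ?_, ?_, ?_⟩ <;>
      simp [EuclideanSpace.dist_eq, Real.sqrt_sq_eq_abs, abs_of_nonneg hb, Real.dist_eq]
  -- The third vertex has first coordinate given by the law of cosines; the case `a = 0` was split
  -- off because of this division.
  · set x := (a ^ 2 + b ^ 2 - c ^ 2) / (2 * a) with hx
    have hxa : 2 * a * x = a ^ 2 + b ^ 2 - c ^ 2 := by rw [hx]; field_simp
    have hy : 0 ≤ b ^ 2 - x ^ 2 := by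
      have e1 : 0 ≤ 2 * a * (b - x) := by nlinarith
      have e2 : 0 ≤ 2 * a * (b + x) := by nlinarith
      have e3 : 0 ≤ b - x := by
        by_contra h
        nlinarith
      have e4 : 0 ≤ b + x := by
        by_contra h
        nlinarith
      nlinarith
    refine ⟨!₂[0, 0], !₂[a, 0], !₂[x, √(b ^ 2 - x ^ 2)], ?_, ?_, ?_⟩
    · simp [EuclideanSpace.dist_eq, Real.dist_eq, Real.sqrt_sq_eq_abs, abs_of_pos ha]
    · simp [EuclideanSpace.dist_eq, Real.dist_eq, Real.sq_sqrt hy, Real.sqrt_sq_eq_abs,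
        abs_of_nonneg hb]
    · have : (a - x) ^ 2 + (b ^ 2 - x ^ 2) = c ^ 2 := by nlinarith
      simp [EuclideanSpace.dist_eq, Real.dist_eq, Real.sq_sqrt hy, this, Real.sqrt_sq_eq_abs,
        abs_of_nonneg hc]

end Comparison

/-! ### Convexity of the metric and uniqueness of geodesics. -/

section Geodesics

variable {X : Type*} [MetricSpace X]

theorem IsGeodesic.dist_source {γ : ℝ → X} {x y : X} (h : IsGeodesic γ x y) {t : ℝ}
    (ht : t ∈ Icc 0 (dist x y)) : dist x (γ t) = t := by
  have := h.isom 0 ⟨le_rfl, dist_nonneg⟩ t ht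
  rwa [h.source, zero_sub, abs_neg, abs_of_nonneg ht.1] at this

theorem IsGeodesic.dist_target {γ : ℝ → X} {x y : X} (h : IsGeodesic γ x y) {t : ℝ}
    (ht : t ∈ Icc 0 (dist x y)) : dist (γ t) y = dist x y - t := by
  have := h.isom t ht _ ⟨dist_nonneg, le_rfl⟩
  rwa [h.target, abs_sub_comm, abs_of_nonneg (sub_nonneg.2 ht.2)] at this

theorem mul_dist_mem_Icc {t : ℝ} (ht : t ∈ Icc (0 : ℝ) 1) (x y : X) :
    t * dist x y ∈ Icc 0 (dist x y) :=
  ⟨mul_nonneg ht.1 dist_nonneg, mul_le_of_le_one_left dist_nonneg ht.2⟩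

namespace IsCAT0

theorem exists_comparison (p q r : X) :
    ∃ p' q' r' : EuclideanSpace ℝ (Fin 2),
      dist p' q' = dist p q ∧ dist p' r' = dist p r ∧ dist q' r' = dist q r :=
  exists_comparison_triangle dist_nonneg dist_nonneg dist_nonneg
    (by linarith [dist_triangle p r q, dist_comm r q]) (dist_triangle p q r)
    (by linarith [dist_triangle q p r, dist_comm q p])

variable (hX : IsCAT0 X)
include hX

/-- The point at affine parameter `t` on a chosen geodesic from `x` to `y`. -/
noncomputable def pt (x y : X) (t : ℝ) : X := (hX.geodesic x y).choose (t * dist x y)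

theorem pt_zero (x y : X) : hX.pt x y 0 = x := by
  simpa [pt] using (hX.geodesic x y).choose_spec.source

theorem pt_one (x y : X) : hX.pt x y 1 = y := by
  simpa [pt] using (hX.geodesic x y).choose_spec.target

theorem dist_left_pt (x y : X) {t : ℝ} (ht : t ∈ Icc (0 : ℝ) 1) :
    dist x (hX.pt x y t) = t * dist x y :=
  (hX.geodesic x y).choose_spec.dist_source (mul_dist_mem_Icc ht x y)

theorem dist_pt_right (x y : X) {t : ℝ} (ht : t ∈ Icc (0 : ℝ) 1) :
    dist (hX.pt x y t) y = (1 - t) * dist x y := by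
  rw [pt, (hX.geodesic x y).choose_spec.dist_target (mul_dist_mem_Icc ht x y)]
  ring

theorem dist_pt_pt (x y : X) {s t : ℝ} (hs : s ∈ Icc (0 : ℝ) 1) (ht : t ∈ Icc (0 : ℝ) 1) :
    dist (hX.pt x y s) (hX.pt x y t) = |s - t| * dist x y := by
  rw [pt, pt, (hX.geodesic x y).choose_spec.isom _ (mul_dist_mem_Icc hs x y) _
    (mul_dist_mem_Icc ht x y), ← sub_mul, abs_mul, abs_of_nonneg (dist_nonneg (x := x))]

/-- The comparison inequality at `v = 1`, where the second point is the vertex `z`, evaluated by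
Stewart's identity. -/
theorem dist_sq_geodesic_le {γ : ℝ → X} {x y : X} (h : IsGeodesic γ x y) (z : X) {t : ℝ}
    (ht : t ∈ Icc (0 : ℝ) 1) :
    dist (γ (t * dist x y)) z ^ 2 ≤
      (1 - t) * dist x z ^ 2 + t * dist y z ^ 2 - t * (1 - t) * dist x y ^ 2 := by
  obtain ⟨p', q', r', h1, h2, h3⟩ := exists_comparison x y z
  obtain ⟨β, hβ⟩ := hX.geodesic x z
  obtain ⟨δ, hδ⟩ := hX.geodesic y z
  have := hX.comparison x y z γ β δ h hβ hδ p' q' r' h1 h2 h3 t ht 1 ⟨zero_le_one, le_rfl⟩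
  rw [one_mul, hβ.target, AffineMap.lineMap_apply_one] at this
  refine (pow_le_pow_left₀ dist_nonneg this 2).trans (le_of_eq ?_)
  rw [dist_sq_lineMap, h1, h2, h3]

theorem dist_sq_pt_le (x y z : X) {t : ℝ} (ht : t ∈ Icc (0 : ℝ) 1) :
    dist (hX.pt x y t) z ^ 2 ≤
      (1 - t) * dist x z ^ 2 + t * dist y z ^ 2 - t * (1 - t) * dist x y ^ 2 :=
  hX.dist_sq_geodesic_le (hX.geodesic x y).choose_spec z ht

/-- For these two distances the Stewart bound collapses to zero. This is uniqueness of geodesics: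
every geodesic agrees with the chosen `pt`. -/
theorem eq_pt_of_dist {x y z : X} {t : ℝ} (ht : t ∈ Icc (0 : ℝ) 1)
    (h1 : dist x z = t * dist x y) (h2 : dist y z = (1 - t) * dist x y) : z = hX.pt x y t := by
  have := hX.dist_sq_pt_le x y z ht
  rw [h1, h2] at this
  have h0 : dist (hX.pt x y t) z ^ 2 ≤ 0 := by
    refine this.trans (le_of_eq ?_)
    ring
  have h3 : dist (hX.pt x y t) z = 0 := by
    have := sq_nonneg (dist (hX.pt x y t) z)
    exact pow_eq_zero_iff (two_ne_zero) |>.1 (le_antisymm h0 this)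
  exact (dist_eq_zero.1 h3).symm

theorem geodesic_eq_pt {γ : ℝ → X} {x y : X} (h : IsGeodesic γ x y) {t : ℝ}
    (ht : t ∈ Icc (0 : ℝ) 1) : γ (t * dist x y) = hX.pt x y t := by
  refine hX.eq_pt_of_dist ht (h.dist_source (mul_dist_mem_Icc ht x y)) ?_
  rw [dist_comm, h.dist_target (mul_dist_mem_Icc ht x y)]
  ring

theorem geodesic_eq_pt_div {γ : ℝ → X} {x y : X} (h : IsGeodesic γ x y) {s : ℝ}
    (hs : s ∈ Icc 0 (dist x y)) : γ s = hX.pt x y (s / dist x y) := by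
  rcases (dist_nonneg (x := x) (y := y)).eq_or_lt with h0 | h0
  · have : s = 0 := le_antisymm (hs.2.trans h0.symm.le) hs.1
    rw [this, zero_div, hX.pt_zero, h.source]
  · rw [← hX.geodesic_eq_pt h ⟨div_nonneg hs.1 h0.le, (div_le_one h0).2 hs.2⟩,
      div_mul_cancel₀ _ h0.ne']

theorem pt_symm (x y : X) {t : ℝ} (ht : t ∈ Icc (0 : ℝ) 1) :
    hX.pt x y t = hX.pt y x (1 - t) := by
  refine hX.eq_pt_of_dist ⟨by linarith [ht.2], by linarith [ht.1]⟩ ?_ ?_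
  · rw [dist_comm, hX.dist_pt_right x y ht, dist_comm x y]
  · rw [hX.dist_left_pt x y ht, dist_comm x y]
    ring

theorem pt_self (x : X) {t : ℝ} (ht : t ∈ Icc (0 : ℝ) 1) : hX.pt x x t = x := by
  have := hX.dist_left_pt x x ht
  rw [dist_self, mul_zero] at this
  exact (dist_eq_zero.1 this).symm

theorem pt_pt (x y : X) {u v t : ℝ} (hu : u ∈ Icc (0 : ℝ) 1) (hv : v ∈ Icc (0 : ℝ) 1)
    (ht : t ∈ Icc (0 : ℝ) 1) :
    hX.pt (hX.pt x y u) (hX.pt x y v) t = hX.pt x y ((1 - t) * u + t * v) := by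
  have hw : (1 - t) * u + t * v ∈ Icc (0 : ℝ) 1 := by
    obtain ⟨a, b⟩ := hu
    obtain ⟨c, d⟩ := hv
    obtain ⟨e, f⟩ := ht
    constructor <;> nlinarith
  symm
  apply hX.eq_pt_of_dist ht
  · rw [hX.dist_pt_pt x y hu hw, hX.dist_pt_pt x y hu hv, ← mul_assoc]
    congr 1
    rw [← abs_of_nonneg ht.1, ← abs_mul, abs_of_nonneg ht.1]
    congr 1
    ring
  · rw [hX.dist_pt_pt x y hv hw, hX.dist_pt_pt x y hu hv, ← mul_assoc]
    congr 1
    have h1 : 0 ≤ 1 - t := by linarith [ht.2]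
    rw [← abs_of_nonneg h1, ← abs_mul, abs_of_nonneg h1, ← abs_neg]
    congr 1
    ring

theorem dist_pt_pt_le (p q r : X) {t : ℝ} (ht : t ∈ Icc (0 : ℝ) 1) :
    dist (hX.pt p q t) (hX.pt p r t) ≤ t * dist q r := by
  obtain ⟨p', q', r', h1, h2, h3⟩ := exists_comparison p q r
  have := hX.comparison p q r _ _ _ (hX.geodesic p q).choose_spec (hX.geodesic p r).choose_spec
    (hX.geodesic q r).choose_spec p' q' r' h1 h2 h3 t ht t ht
  refine this.trans (le_of_eq ?_)
  rw [← h3, dist_eq_norm, dist_eq_norm, AffineMap.lineMap_apply_module,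
    AffineMap.lineMap_apply_module]
  have : (1 - t) • p' + t • q' - ((1 - t) • p' + t • r') = t • (q' - r') := by module
  rw [this, norm_smul, Real.norm_eq_abs, abs_of_nonneg ht.1]

/-- The quadrilateral is cut along the geodesic from `x` to `y'`, and each triangle is compared at
its own vertex. -/
theorem dist_pt_pt_le_add (x y x' y' : X) {t : ℝ} (ht : t ∈ Icc (0 : ℝ) 1) :
    dist (hX.pt x y t) (hX.pt x' y' t) ≤ (1 - t) * dist x x' + t * dist y y' := by
  have ht' : 1 - t ∈ Icc (0 : ℝ) 1 := ⟨by linarith [ht.2], by linarith [ht.1]⟩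
  have h1 := hX.dist_pt_pt_le x y y' ht
  have h2 := hX.dist_pt_pt_le y' x x' ht'
  rw [hX.pt_symm y' x ht', hX.pt_symm y' x' ht', sub_sub_cancel] at h2
  linarith [dist_triangle (hX.pt x y t) (hX.pt x y' t) (hX.pt x' y' t)]

theorem dist_pt_pt_le_max {x y x' y' : X} {t C : ℝ} (ht : t ∈ Icc (0 : ℝ) 1)
    (h1 : dist x x' ≤ C) (h2 : dist y y' ≤ C) : dist (hX.pt x y t) (hX.pt x' y' t) ≤ C := by
  have := hX.dist_pt_pt_le_add x y x' y' ht
  obtain ⟨a, b⟩ := ht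
  nlinarith

/-- Apply the Stewart bound to `y` and to `w` at the midpoint of `x` and `z`, then use `(a + b) ^ 2
≤ 2 * a ^ 2 + 2 * b ^ 2`. On orbits of abelian groups this becomes half of the parallelogram law. -/
theorem dist_sq_add_dist_sq_le (x y z w : X) :
    dist x z ^ 2 + dist y w ^ 2 ≤
      dist x y ^ 2 + dist y z ^ 2 + dist z w ^ 2 + dist w x ^ 2 := by
  have ht : (1 / 2 : ℝ) ∈ Icc (0 : ℝ) 1 := by constructor <;> norm_num
  have h1 := hX.dist_sq_pt_le x z y ht
  have h2 := hX.dist_sq_pt_le x z w ht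
  have h3 := dist_triangle_left y w (hX.pt x z (1 / 2))
  have h4 : dist y w ^ 2 ≤ (dist (hX.pt x z (1 / 2)) y + dist (hX.pt x z (1 / 2)) w) ^ 2 :=
    pow_le_pow_left₀ dist_nonneg h3 2
  rw [dist_comm z y] at h1
  rw [dist_comm x w] at h2
  nlinarith [sq_nonneg (dist (hX.pt x z (1 / 2)) y - dist (hX.pt x z (1 / 2)) w)]

theorem smul_pt {G : Type*} [Group G] [MulAction G X] [IsIsometricSMul G X] (g : G) (x y : X)
    {t : ℝ} (ht : t ∈ Icc (0 : ℝ) 1) : g • hX.pt x y t = hX.pt (g • x) (g • y) t := by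
  refine hX.eq_pt_of_dist ht ?_ ?_
  · rw [dist_smul, dist_smul, hX.dist_left_pt x y ht]
  · rw [dist_smul, dist_smul, dist_comm, hX.dist_pt_right x y ht]

end IsCAT0

end Geodesics

end CAT0Boundary

namespace CAT0Boundary

/-! ### Properness and attained displacements for geometric actions. -/

section Geometric

variable {G X : Type*} [Group G] [MetricSpace X] [MulAction G X] [IsIsometricSMul G X]

omit [IsIsometricSMul G X] in
-- Otherwise there are points `yₙ → x` with `yₙ ∈ gₙ K` outside all earlier `gₘ K`. The `gₙ` are
-- then distinct, yet all move `K` onto points of the compact set `{x} ∪ {yₙ}`, against proper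
-- discontinuity.
theorem IsGeometricAction.exists_finite_translates_mem_nhds (h : IsGeometricAction G X)
    {K : Set X} (hK : IsCompact K) (hcov : ⋃ g : G, (fun x => g • x) '' K = univ) (x : X) :
    ∃ S : Finset G, (⋃ g ∈ S, (fun x => g • x) '' K) ∈ 𝓝 x := by
  by_contra! hS
  -- The third component is a strictly increasing counter that forces the chosen points to converge
  -- to `x`.
  obtain ⟨f, hf1, hf2⟩ := exists_seq_of_forall_finset_exists
    (fun a : G × X × ℕ => a.2.1 ∈ (fun x => a.1 • x) '' K ∧ dist a.2.1 x < 1 / (a.2.2 + 1))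
    (fun a b => b.2.1 ∉ (fun x => a.1 • x) '' K ∧ a.2.2 < b.2.2) (by
      intro s _
      classical
      obtain ⟨N, hN⟩ : ∃ N : ℕ, ∀ a ∈ s, a.2.2 < N :=
        ⟨s.sup (fun a => a.2.2) + 1, fun a ha =>
          Nat.lt_succ_of_le (Finset.le_sup (f := fun a : G × X × ℕ => a.2.2) ha)⟩
      have h1 := hS (s.image Prod.fst)
      obtain ⟨y, hy1, hy2⟩ : ∃ y ∈ Metric.ball x (1 / ((N : ℝ) + 1)),
          y ∉ ⋃ g ∈ s.image Prod.fst, (fun x => g • x) '' K := by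
        by_contra! hc
        exact h1 (Filter.mem_of_superset (Metric.ball_mem_nhds x (by positivity)) hc)
      obtain ⟨g, hg⟩ := mem_iUnion.1 (hcov.symm ▸ mem_univ y : y ∈ ⋃ g : G, (fun x => g • x) '' K)
      refine ⟨(g, y, N), ⟨hg, hy1⟩, fun a ha => ⟨fun hya => hy2 ?_, hN a ha⟩⟩
      exact mem_biUnion (Finset.mem_coe.2 (Finset.mem_image_of_mem _ ha)) hya)
  have hmono : ∀ n, n ≤ (f n).2.2 := by
    intro n
    induction n with
    | zero => exact Nat.zero_le _
    | succ n ih => exact Nat.succ_le_of_lt (ih.trans_lt (hf2 n (n + 1) n.lt_succ_self).2)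
  have htend : Tendsto (fun n => (f n).2.1) atTop (𝓝 x) := by
    rw [tendsto_iff_dist_tendsto_zero]
    refine squeeze_zero (fun _ => dist_nonneg) (fun n => ?_) tendsto_one_div_add_atTop_nhds_zero_nat
    refine (hf1 n).2.le.trans ?_
    gcongr
    exact hmono n
  have hfin := h.properlyDiscontinuous.finite_disjoint_inter_image hK htend.isCompact_insert_range
  have hinj : Function.Injective fun n => (f n).1 := by
    have hne : ∀ m n, m < n → (f m).1 ≠ (f n).1 := by
      intro m n hmn heq
      have := (hf1 n).1
      rw [← heq] at this
      exact (hf2 m n hmn).1 this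
    intro m n hmn
    rcases lt_trichotomy m n with hlt | heq | hlt
    · exact absurd hmn (hne m n hlt)
    · exact heq
    · exact absurd hmn.symm (hne n m hlt)
  refine Set.infinite_range_of_injective hinj (hfin.subset ?_)
  rintro _ ⟨n, rfl⟩
  exact ⟨(f n).2.1, (hf1 n).1, Or.inr ⟨n, rfl⟩⟩

/-- Finitely many translates of `K` give compact neighbourhoods; one radius works around the compact
`K`, and translation carries it everywhere. -/
theorem IsGeometricAction.exists_pos_isCompact_closedBall (h : IsGeometricAction G X) :
    ∃ δ > 0, ∀ x : X, IsCompact (Metric.closedBall x δ) := by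
  obtain ⟨K, hK, hcov⟩ := h.cocompact
  have : WeaklyLocallyCompactSpace X := by
    refine ⟨fun x => ?_⟩
    obtain ⟨S, hS⟩ := h.exists_finite_translates_mem_nhds hK hcov x
    exact ⟨_, S.isCompact_biUnion fun g _ => hK.image (continuous_const_smul g), hS⟩
  obtain ⟨K', hK', hKK'⟩ := exists_compact_superset hK
  obtain ⟨δ, hδ, hsub⟩ := hK.exists_cthickening_subset_open isOpen_interior hKK'
  refine ⟨δ, hδ, fun y => ?_⟩
  obtain ⟨g, k, hk, rfl⟩ :=
    mem_iUnion.1 (hcov.symm ▸ mem_univ y : y ∈ ⋃ g : G, (fun x => g • x) '' K)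
  refine (hK'.image (continuous_const_smul g)).of_isClosed_subset Metric.isClosed_closedBall ?_
  intro z hz
  refine ⟨g⁻¹ • z, interior_subset (hsub ?_), smul_inv_smul g z⟩
  refine Metric.mem_cthickening_of_dist_le _ k _ _ hk ?_
  rwa [← dist_smul g, smul_inv_smul]

/-- As for Hopf–Rinow, compactness spreads outwards in steps of `δ / 2`: a point of the next ball is
within `δ / 2` of the previous ball along a geodesic, hence within `δ` of one of finitely many
centres. -/
theorem IsCAT0.properSpace (hX : IsCAT0 X) {δ : ℝ} (hδ : 0 < δ)
    (hc : ∀ x : X, IsCompact (Metric.closedBall x δ)) : ProperSpace X := by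
  have key : ∀ (x : X) (n : ℕ), IsCompact (Metric.closedBall x (n * (δ / 2))) := by
    intro x n
    induction n with
    | zero => simp
    | succ n ih =>
      obtain ⟨t, _, htf, hcov⟩ := ih.finite_cover_balls (half_pos hδ)
      refine (htf.isCompact_biUnion fun y _ => hc y).of_isClosed_subset
        Metric.isClosed_closedBall ?_
      intro z hz
      rw [Metric.mem_closedBall, dist_comm] at hz
      push_cast at hz
      obtain ⟨w, hw1, hw2⟩ : ∃ w, dist x w ≤ n * (δ / 2) ∧ dist w z ≤ δ / 2 := by
        rcases le_or_gt (dist x z) (n * (δ / 2)) with hle | hlt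
        · exact ⟨z, hle, by simpa using (half_pos hδ).le⟩
        · have hn : 0 ≤ n * (δ / 2) := by positivity
          have hpos : 0 < dist x z := hn.trans_lt hlt
          have ht : n * (δ / 2) / dist x z ∈ Icc (0 : ℝ) 1 :=
            ⟨div_nonneg hn hpos.le, (div_le_one hpos).2 hlt.le⟩
          refine ⟨hX.pt x z (n * (δ / 2) / dist x z), ?_, ?_⟩
          · rw [hX.dist_left_pt x z ht, div_mul_cancel₀ _ hpos.ne']
          · rw [hX.dist_pt_right x z ht, sub_mul, div_mul_cancel₀ _ hpos.ne']
            linarith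
      obtain ⟨y, hy, hwy⟩ := mem_iUnion₂.1 (hcov (show w ∈ _ by rwa [Metric.mem_closedBall, dist_comm]))
      refine mem_biUnion hy ?_
      rw [Metric.mem_ball] at hwy
      rw [Metric.mem_closedBall]
      linarith [dist_triangle z w y, dist_comm z w]
  refine ⟨fun x r => ?_⟩
  obtain ⟨n, hn⟩ := exists_nat_ge (r / (δ / 2))
  exact (key x n).of_isClosed_subset Metric.isClosed_closedBall
    (Metric.closedBall_subset_closedBall ((div_le_iff₀ (half_pos hδ)).1 hn))

theorem IsGeometricAction.properSpace (h : IsGeometricAction G X) (hX : IsCAT0 X) :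
    ProperSpace X := by
  obtain ⟨δ, hδ, hc⟩ := h.exists_pos_isCompact_closedBall
  exact hX.properSpace hδ hc

omit [IsIsometricSMul G X] in
theorem IsGeometricAction.finite_setOf_dist_le (h : IsGeometricAction G X) [ProperSpace X]
    (x y : X) (r : ℝ) : {g : G | dist (g • x) y ≤ r}.Finite := by
  refine (h.properlyDiscontinuous.finite_disjoint_inter_image (isCompact_singleton (x := x))
    (isCompact_closedBall y r)).subset fun g hg => ?_
  exact ⟨g • x, ⟨x, rfl, rfl⟩, hg⟩

omit [IsIsometricSMul G X] in
theorem IsGeometricAction.exists_smul_dist_le (h : IsGeometricAction G X) (x₀ : X) :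
    ∃ R : ℝ, ∀ x : X, ∃ g : G, dist (g • x) x₀ ≤ R := by
  obtain ⟨K, hK, hcov⟩ := h.cocompact
  obtain ⟨R, hR⟩ := hK.isBounded.subset_closedBall x₀
  refine ⟨R, fun x => ?_⟩
  obtain ⟨g, k, hk, rfl⟩ :=
    mem_iUnion.1 (hcov.symm ▸ mem_univ x : x ∈ ⋃ g : G, (fun x => g • x) '' K)
  exact ⟨g⁻¹, by simpa using hR hk⟩

/-- Displacement bounds for finitely many elements that can be met up to an arbitrarily small
error can be met exactly. -/
theorem IsGeometricAction.exists_forall_displacement_le (h : IsGeometricAction G X)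
    [ProperSpace X] [Nonempty X] {ι : Type*} (S : Finset ι) (a : ι → G) (τ : ι → ℝ)
    (hS : ∀ δ > 0, ∃ y : X, ∀ s ∈ S, dist y (a s • y) ≤ τ s + δ) :
    ∃ x : X, ∀ s ∈ S, dist x (a s • x) ≤ τ s := by
  obtain ⟨x₀⟩ := ‹Nonempty X›
  obtain ⟨R, hR⟩ := h.exists_smul_dist_le x₀
  choose y hy using fun n : ℕ => hS (1 / (n + 1)) (by positivity)
  choose g hg using fun n => hR (y n)
  let U : Ultrafilter ℕ := hyperfilter ℕ
  have hU : (U : Filter ℕ) ≤ atTop := Nat.hyperfilter_le_atTop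
  obtain ⟨z, -, hz⟩ := (isCompact_closedBall x₀ R).ultrafilter_le_nhds
    (U.map fun n => g n • y n) (by
      rw [Ultrafilter.coe_map]
      exact tendsto_principal.2 (Eventually.of_forall hg))
  replace hz : Tendsto (fun n => g n • y n) U (𝓝 z) := hz
  -- After `y n` is moved into a fixed ball by `g n`, the conjugates of `a s` displace `x₀` by a
  -- bounded amount, so only finitely many occur and the ultrafilter selects one for every `s`.
  have hconj : ∀ s ∈ S, ∃ c : G, ∀ᶠ n in (U : Filter ℕ), g n * a s * (g n)⁻¹ = c := by
    intro s hs
    have hfin := h.finite_setOf_dist_le x₀ x₀ (2 * R + τ s + 1)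
    have hev : ∀ n, g n * a s * (g n)⁻¹ ∈ {g : G | dist (g • x₀) x₀ ≤ 2 * R + τ s + 1} := by
      intro n
      have h1 : dist ((g n * a s * (g n)⁻¹) • x₀) ((g n * a s * (g n)⁻¹) • (g n • y n)) ≤ R := by
        rw [dist_smul, dist_comm]
        exact hg n
      have h2 : dist ((g n * a s * (g n)⁻¹) • (g n • y n)) (g n • y n) ≤ τ s + 1 := by
        rw [smul_smul, inv_mul_cancel_right, mul_smul, dist_smul, dist_comm]
        refine (hy n s hs).trans ?_
        have : 1 / ((n : ℝ) + 1) ≤ 1 := by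
          rw [div_le_one (by positivity)]
          linarith [n.cast_nonneg (α := ℝ)]
        linarith
      have h3 := dist_triangle4 ((g n * a s * (g n)⁻¹) • x₀)
        ((g n * a s * (g n)⁻¹) • (g n • y n)) (g n • y n) x₀
      rw [Set.mem_ofPred_eq]
      linarith [hg n]
    have h4 : (⋃ c ∈ {g : G | dist (g • x₀) x₀ ≤ 2 * R + τ s + 1},
        {n | g n * a s * (g n)⁻¹ = c}) ∈ U := by
      refine Filter.mem_of_superset univ_mem fun n _ => mem_biUnion (hev n) rfl
    obtain ⟨c, -, hc⟩ := (Ultrafilter.finite_biUnion_mem_iff hfin).1 h4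
    exact ⟨c, hc⟩
  choose! c hc using hconj
  obtain ⟨m, hm⟩ := ((Filter.eventually_all_finset S).2 hc).exists
  refine ⟨(g m)⁻¹ • z, fun s hs => ?_⟩
  have h1 : dist ((g m)⁻¹ • z) (a s • (g m)⁻¹ • z) = dist z (c s • z) := by
    rw [← dist_smul (g m), smul_inv_smul, smul_smul, smul_smul, hm s hs]
  rw [h1]
  have h2 : Tendsto (fun n => dist (g n • y n) (c s • g n • y n)) U (𝓝 (dist z (c s • z))) :=
    hz.dist ((continuous_const_smul (c s)).continuousAt.tendsto.comp hz)
  have h3 : Tendsto (fun n : ℕ => τ s + 1 / ((n : ℝ) + 1)) U (𝓝 (τ s + 0)) :=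
    (tendsto_const_nhds.add tendsto_one_div_add_atTop_nhds_zero_nat).mono_left hU
  rw [add_zero] at h3
  refine le_of_tendsto_of_tendsto h2 h3 ?_
  filter_upwards [hc s hs] with n hn
  rw [← hn, smul_smul, inv_mul_cancel_right, mul_smul, dist_smul]
  exact hy n s hs

end Geometric

end CAT0Boundary

namespace CAT0Boundary

/-! ### The Jordan–von Neumann argument for functions on abelian groups. -/

section QuadraticForm

/-- A function satisfying the parallelogram law on an abelian group is a quadratic form. -/
theorem exists_bilinear_of_parallelogram {A : Type*} [AddCommGroup A] (q : A → ℝ)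
    (hq : ∀ a b, q (a + b) + q (a - b) = 2 * q a + 2 * q b) :
    ∃ B : A →+ A →+ ℝ, ∀ a, q a = B a a := by
  have h0 : q 0 = 0 := by
    have := hq 0 0
    simp only [add_zero, sub_zero] at this
    linarith
  have h2 : ∀ a, q (a + a) = 4 * q a := by
    intro a
    have := hq a a
    rw [sub_self, h0] at this
    linarith
  -- This identity is exactly additivity of the polar form in each variable.
  have h3 : ∀ x y z, q (x + y + z) = q (x + y) + q (y + z) + q (x + z) - q x - q y - q z := by
    intro x y z
    have e1 := hq (x + z) y
    have e2 := hq (x - y) z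
    have e3 := hq x (y + z)
    have e4 := hq x y
    rw [show x + z + y = x + y + z by abel, show x + z - y = x - y + z by abel] at e1
    rw [show x - y - z = x - (y + z) by abel] at e2
    rw [show x + (y + z) = x + y + z by abel] at e3
    linarith
  refine ⟨AddMonoidHom.mk' (fun a => AddMonoidHom.mk' (fun b => (q (a + b) - q a - q b) / 2) ?_)
    ?_, ?_⟩
  · intro b c
    have := h3 a b c
    rw [← add_assoc, this]
    ring
  · intro a b
    ext c
    have := h3 a b c
    simp only [AddMonoidHom.mk'_apply, AddMonoidHom.add_apply]
    rw [this]
    ring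
  · intro a
    simp only [AddMonoidHom.mk'_apply]
    rw [h2]
    ring

end QuadraticForm

/-! ### Displacement functions of abelian groups and coarsely affine orbits. -/

section Displacement

variable {A G X : Type*} [AddCommGroup A] [Group G] [MetricSpace X] [MulAction G X]
  [IsIsometricSMul G X] (φ : Multiplicative A →* G)

open Multiplicative (ofAdd)

/-- The displacement of `x` under `a`, for an abelian group acting through `φ`. -/
def disp (x : X) (a : A) : ℝ := dist x (φ (ofAdd a) • x)

omit [IsIsometricSMul G X] in
theorem disp_nonneg (x : X) (a : A) : 0 ≤ disp φ x a := dist_nonneg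

theorem dist_smul_smul_eq_disp (x : X) (a b : A) :
    dist (φ (ofAdd a) • x) (φ (ofAdd b) • x) = disp φ x (b - a) := by
  rw [disp, ← dist_smul (φ (ofAdd a)) x, smul_smul, ← map_mul, ← ofAdd_add, add_sub_cancel]

omit [IsIsometricSMul G X] in
theorem disp_zero (x : X) : disp φ x (0 : A) = 0 := by simp [disp]

theorem disp_neg (x : X) (a : A) : disp φ x (-a) = disp φ x a := by
  have := dist_smul_smul_eq_disp φ x a 0
  rw [zero_sub] at this
  rw [← this, disp, dist_comm]
  simp

theorem disp_add_le (x : X) (a b : A) : disp φ x (a + b) ≤ disp φ x a + disp φ x b := by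
  have := dist_triangle x (φ (ofAdd a) • x) (φ (ofAdd (a + b)) • x)
  rwa [dist_smul_smul_eq_disp, add_sub_cancel_left] at this

theorem disp_le_add (x y : X) (a : A) : disp φ x a ≤ disp φ y a + 2 * dist x y := by
  have := dist_triangle4 x y (φ (ofAdd a) • y) (φ (ofAdd a) • x)
  rw [dist_smul, dist_comm y x] at this
  rw [disp, disp]
  linarith

theorem disp_sq_add_disp_sq_le (hX : IsCAT0 X) (x : X) (a b : A) :
    disp φ x (a + b) ^ 2 + disp φ x (a - b) ^ 2 ≤ 2 * disp φ x a ^ 2 + 2 * disp φ x b ^ 2 := by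
  have := hX.dist_sq_add_dist_sq_le (φ (ofAdd (0 : A)) • x) (φ (ofAdd a) • x)
    (φ (ofAdd (a + b)) • x) (φ (ofAdd b) • x)
  simp only [dist_smul_smul_eq_disp] at this
  rw [sub_zero, show b - a = -(a - b) by abel, sub_zero, show a + b - a = b by abel,
    show b - (a + b) = -a by abel, zero_sub, disp_neg, disp_neg, disp_neg] at this
  linarith

/-- The stable displacement of `a`. -/
noncomputable def stableDisp (x : X) (a : A) : ℝ := ⨅ k : ℕ, disp φ x (2 ^ k • a) / 2 ^ k

theorem antitone_disp_div (x : X) (a : A) :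
    Antitone fun k : ℕ => disp φ x (2 ^ k • a) / 2 ^ k := by
  refine antitone_nat_of_succ_le fun k => ?_
  have h1 := disp_add_le φ x (2 ^ k • a) (2 ^ k • a)
  rw [← two_nsmul, smul_smul, ← pow_succ'] at h1
  rw [div_le_div_iff₀ (by positivity) (by positivity), pow_succ]
  rw [← pow_succ, pow_succ (2 : ℝ), mul_comm (2 ^ k : ℝ) 2, ← mul_assoc]
  gcongr
  linarith

theorem tendsto_disp_div (x : X) (a : A) :
    Tendsto (fun k : ℕ => disp φ x (2 ^ k • a) / 2 ^ k) atTop (𝓝 (stableDisp φ x a)) :=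
  tendsto_atTop_ciInf (antitone_disp_div φ x a)
    ⟨0, by rintro _ ⟨k, rfl⟩; exact div_nonneg (disp_nonneg φ _ _) (by positivity)⟩

theorem stableDisp_le (x : X) (a : A) : stableDisp φ x a ≤ disp φ x a := by
  simpa using (antitone_disp_div φ x a).le_of_tendsto (tendsto_disp_div φ x a) 0

omit [IsIsometricSMul G X] in
theorem stableDisp_nonneg (x : X) (a : A) : 0 ≤ stableDisp φ x a :=
  Real.iInf_nonneg fun _ => div_nonneg (disp_nonneg φ _ _) (by positivity)

theorem stableDisp_eq (x y : X) (a : A) : stableDisp φ x a = stableDisp φ y a := by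
  have key : ∀ x y : X, stableDisp φ x a ≤ stableDisp φ y a := by
    intro x y
    have h1 : Tendsto (fun k : ℕ => disp φ y (2 ^ k • a) / 2 ^ k + 2 * dist x y / 2 ^ k) atTop
        (𝓝 (stableDisp φ y a + 0)) := by
      refine (tendsto_disp_div φ y a).add ?_
      refine tendsto_const_nhds.div_atTop (tendsto_pow_atTop_atTop_of_one_lt one_lt_two)
    rw [add_zero] at h1
    refine le_of_tendsto_of_tendsto' (tendsto_disp_div φ x a) h1 fun k => ?_
    rw [← add_div]
    gcongr
    exact disp_le_add φ x y _
  exact le_antisymm (key x y) (key y x)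

theorem stableDisp_two_nsmul (x : X) (a : A) :
    stableDisp φ x (2 • a) = 2 * stableDisp φ x a := by
  refine tendsto_nhds_unique (tendsto_disp_div φ x (2 • a)) ?_
  have h := ((tendsto_disp_div φ x a).comp (tendsto_add_atTop_nat 1)).const_mul 2
  refine h.congr fun k => ?_
  simp only [Function.comp_apply]
  rw [smul_smul, ← pow_succ, pow_succ (2 : ℝ)]
  field_simp

theorem stableDisp_parallelogram_le (hX : IsCAT0 X) (x : X) (a b : A) :
    stableDisp φ x (a + b) ^ 2 + stableDisp φ x (a - b) ^ 2 ≤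
      2 * stableDisp φ x a ^ 2 + 2 * stableDisp φ x b ^ 2 := by
  refine le_of_tendsto_of_tendsto'
    (((tendsto_disp_div φ x (a + b)).pow 2).add ((tendsto_disp_div φ x (a - b)).pow 2))
    ((((tendsto_disp_div φ x a).pow 2).const_mul 2).add
      (((tendsto_disp_div φ x b).pow 2).const_mul 2)) fun k => ?_
  have := disp_sq_add_disp_sq_le φ hX x (2 ^ k • a) (2 ^ k • b)
  rw [← smul_add, ← smul_sub] at this
  simp only [div_pow]
  rw [← add_div, mul_div_assoc', mul_div_assoc', ← add_div]
  gcongr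

/-- The reverse inequality is the known one for `a + b` and `a - b`, because stable displacement is
homogeneous under doubling. -/
theorem stableDisp_parallelogram (hX : IsCAT0 X) (x : X) (a b : A) :
    stableDisp φ x (a + b) ^ 2 + stableDisp φ x (a - b) ^ 2 =
      2 * stableDisp φ x a ^ 2 + 2 * stableDisp φ x b ^ 2 := by
  refine le_antisymm (stableDisp_parallelogram_le φ hX x a b) ?_
  have := stableDisp_parallelogram_le φ hX x (a + b) (a - b)
  rw [show a + b + (a - b) = 2 • a by rw [two_nsmul]; abel,
    show a + b - (a - b) = 2 • b by rw [two_nsmul]; abel, stableDisp_two_nsmul,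
    stableDisp_two_nsmul] at this
  linarith

/-- In the parallelogram inequality the stable displacements already give equality, and displacement
is never smaller than stable displacement; so both terms on the left must be equal to their stable
values. Minimality thus need only be checked on generators. -/
theorem disp_eq_stableDisp_closure (hX : IsCAT0 X) (x : X) {S : Set A}
    (hS : ∀ s ∈ S, disp φ x s = stableDisp φ x s) {a : A} (ha : a ∈ AddSubgroup.closure S) :
    disp φ x a = stableDisp φ x a := by
  induction ha using AddSubgroup.closure_induction with
  | mem s hs => exact hS s hs
  | zero =>
    refine le_antisymm ?_ (stableDisp_le φ x 0)
    rw [disp_zero]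
    exact stableDisp_nonneg φ x 0
  | add a b _ _ ha hb =>
    have h1 := disp_sq_add_disp_sq_le φ hX x a b
    have h2 := stableDisp_parallelogram φ hX x a b
    have h3 := stableDisp_le φ x (a + b)
    have h4 := stableDisp_le φ x (a - b)
    have h5 := stableDisp_nonneg φ x (a + b)
    have h6 := stableDisp_nonneg φ x (a - b)
    rw [ha, hb, ← h2] at h1
    nlinarith
  | neg a _ ha =>
    have : ∀ a, stableDisp φ x (-a) = stableDisp φ x a := fun a => by
      simp only [stableDisp, smul_neg, disp_neg]
    rw [this, disp_neg, ha]

/-- Replace `z` by the midpoint of `z` and `s z`. Its displacement by `s` joins midpoints of two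
sides of the triangle `z, s z, s² z`, so it is at most half the third side. Since the group is
commutative, convexity shows that no other displacement grows, and the elements of `S` can be
treated in turn. -/
theorem exists_disp_le_half (hX : IsCAT0 X) (S : Finset A) (y : X) :
    ∃ z : X, (∀ s ∈ S, disp φ z s ≤ disp φ y (2 • s) / 2) ∧ ∀ r, disp φ z r ≤ disp φ y r := by
  classical
  have ht : (1 / 2 : ℝ) ∈ Icc (0 : ℝ) 1 := by constructor <;> norm_num
  induction S using Finset.induction_on with
  | empty => exact ⟨y, by simp, fun _ => le_rfl⟩
  | insert s S _ ih =>
    obtain ⟨z, hz1, hz2⟩ := ih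
    have hr : ∀ r, disp φ (hX.pt z (φ (ofAdd s) • z) (1 / 2)) r ≤ disp φ z r := by
      intro r
      have h1 := hX.dist_pt_pt_le_add z (φ (ofAdd s) • z) (φ (ofAdd r) • z)
        (φ (ofAdd r) • φ (ofAdd s) • z) ht
      rw [disp, hX.smul_pt _ _ _ ht]
      refine h1.trans (le_of_eq ?_)
      have : dist (φ (ofAdd s) • z) (φ (ofAdd r) • φ (ofAdd s) • z) = disp φ z r := by
        rw [smul_smul, ← map_mul, ← ofAdd_add, dist_smul_smul_eq_disp, add_sub_cancel_right]
      rw [this, disp]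
      ring
    refine ⟨hX.pt z (φ (ofAdd s) • z) (1 / 2), ?_, fun r => (hr r).trans (hz2 r)⟩
    intro s' hs'
    rcases Finset.mem_insert.1 hs' with rfl | hs'
    · refine le_trans ?_ (div_le_div_of_nonneg_right (hz2 (2 • s')) zero_le_two)
      rw [disp, hX.smul_pt _ _ _ ht, hX.pt_symm _ _ ht]
      have h1 := hX.dist_pt_pt_le (φ (ofAdd s') • z) z (φ (ofAdd s') • φ (ofAdd s') • z) ht
      rw [show (1 : ℝ) - 1 / 2 = 1 / 2 by norm_num]
      refine h1.trans (le_of_eq ?_)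
      rw [smul_smul, ← map_mul, ← ofAdd_add, ← two_nsmul, disp]
      ring
    · exact (hr s').trans (hz1 s' hs')

theorem exists_disp_le_div_pow (hX : IsCAT0 X) (k : ℕ) (S : Finset A) (x : X) :
    ∃ y : X, ∀ s ∈ S, disp φ y s ≤ disp φ x (2 ^ k • s) / 2 ^ k := by
  classical
  induction k generalizing x with
  | zero => exact ⟨x, by simp⟩
  | succ k ih =>
    obtain ⟨z, hz, -⟩ := exists_disp_le_half φ hX (S.image fun s => 2 ^ k • s) x
    obtain ⟨y, hy⟩ := ih z
    refine ⟨y, fun s hs => (hy s hs).trans ?_⟩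
    have h1 := hz _ (Finset.mem_image_of_mem _ hs)
    rw [smul_smul, ← pow_succ'] at h1
    rw [pow_succ (2 : ℝ), mul_comm, ← div_div]
    gcongr

/-- A point of minimal displacement for all elements of a finitely generated abelian group. -/
theorem exists_disp_eq_stableDisp (hX : IsCAT0 X) (h : IsGeometricAction G X) [Nonempty X]
    {ι : Type*} [Fintype ι] {e : ι → A} (he : AddSubgroup.closure (range e) = ⊤) :
    ∃ x : X, ∀ a, disp φ x a = stableDisp φ x a := by
  have := h.properSpace hX
  obtain ⟨x₀⟩ := id ‹Nonempty X›
  obtain ⟨x, hx⟩ := h.exists_forall_displacement_le Finset.univ (fun i => φ (ofAdd (e i)))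
    (fun i => stableDisp φ x₀ (e i)) (by
      intro δ hδ
      have h1 : ∀ i ∈ Finset.univ, ∀ᶠ k : ℕ in atTop,
          disp φ x₀ (2 ^ k • e i) / 2 ^ k ≤ stableDisp φ x₀ (e i) + δ := fun i _ =>
        (tendsto_disp_div φ x₀ (e i)).eventually_le_const (lt_add_of_pos_right _ hδ)
      obtain ⟨k, hk⟩ := ((Filter.eventually_all_finset _).2 h1).exists
      classical
      obtain ⟨y, hy⟩ := exists_disp_le_div_pow φ hX k (Finset.univ.image e) x₀
      exact ⟨y, fun i hi => (hy _ (Finset.mem_image_of_mem _ hi)).trans (hk i hi)⟩)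
  refine ⟨x, fun a => disp_eq_stableDisp_closure φ hX x (S := range e) ?_ (he ▸ trivial)⟩
  rintro _ ⟨i, rfl⟩
  refine le_antisymm ?_ (stableDisp_le φ x _)
  rw [stableDisp_eq φ x x₀]
  exact hx i (Finset.mem_univ i)

/-- Orbits of finitely generated abelian groups are coarsely affine: the point at parameter `t` on
the geodesic from `x` to `(∑ nᵢ eᵢ) x` is uniformly close to `(∑ ⌊t nᵢ⌋ eᵢ) x`. -/
theorem exists_dist_floor_smul_pt_le (hX : IsCAT0 X) (h : IsGeometricAction G X)
    {ι : Type*} [Fintype ι] {e : ι → A} (he : AddSubgroup.closure (range e) = ⊤) (x : X) :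
    ∃ R : ℝ, ∀ (n : ι → ℤ), ∀ t ∈ Icc (0 : ℝ) 1,
      dist (φ (ofAdd (∑ i, ⌊t * n i⌋ • e i)) • x)
        (hX.pt x (φ (ofAdd (∑ i, n i • e i)) • x) t) ≤ R := by
  have : Nonempty X := ⟨x⟩
  obtain ⟨y, hy⟩ := exists_disp_eq_stableDisp φ hX h he
  obtain ⟨B, hB⟩ := exists_bilinear_of_parallelogram (fun a => disp φ y a ^ 2) (fun a b => by
    simp only [hy]
    exact stableDisp_parallelogram φ hX y a b)
  have hexp : ∀ c n : ι → ℤ, B (∑ i, c i • e i) (∑ i, n i • e i) =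
      ∑ i, ∑ j, (c i : ℝ) * n j * B (e i) (e j) := by
    intro c n
    simp only [map_sum, AddMonoidHom.finsetSum_apply, map_zsmul, AddMonoidHom.smul_apply,
      zsmul_eq_mul, Finset.mul_sum]
    rw [Finset.sum_comm]
    exact Finset.sum_congr rfl fun i _ => Finset.sum_congr rfl fun j _ => by ring
  set M := ∑ i, ∑ j, |B (e i) (e j)| with hM
  refine ⟨√M + 2 * dist x y, fun n t ht => ?_⟩
  set c : ι → ℤ := fun i => ⌊t * n i⌋ with hc
  -- With squared displacements given by `B`, the Stewart bound is the form evaluated at the real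
  -- vector `c - t n`, whose entries have absolute value at most `1`.
  have h1 : dist (φ (ofAdd (∑ i, c i • e i)) • y)
      (hX.pt y (φ (ofAdd (∑ i, n i • e i)) • y) t) ≤ √M := by
    apply Real.le_sqrt_of_sq_le
    have h2 := hX.dist_sq_pt_le y (φ (ofAdd (∑ i, n i • e i)) • y)
      (φ (ofAdd (∑ i, c i • e i)) • y) ht
    rw [dist_smul_smul_eq_disp, ← Finset.sum_sub_distrib] at h2
    simp only [← sub_smul] at h2
    change _ ≤ (1 - t) * disp φ y _ ^ 2 + t * _ - t * (1 - t) * disp φ y _ ^ 2 at h2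
    rw [hB, hB, hB, hexp, hexp, hexp] at h2
    rw [dist_comm]
    refine h2.trans ?_
    simp only [Finset.mul_sum]
    rw [hM, ← Finset.sum_add_distrib, ← Finset.sum_sub_distrib]
    refine Finset.sum_le_sum fun i _ => ?_
    rw [← Finset.sum_add_distrib, ← Finset.sum_sub_distrib]
    refine Finset.sum_le_sum fun j _ => ?_
    have hfl : ∀ i, |(c i : ℝ) - t * n i| ≤ 1 := fun i => by
      rw [abs_sub_comm, abs_of_nonneg (sub_nonneg.2 (Int.floor_le _))]
      linarith [Int.lt_floor_add_one (t * n i)]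
    calc _ = ((c i : ℝ) - t * n i) * ((c j : ℝ) - t * n j) * B (e i) (e j) := by
          push_cast
          ring
      _ ≤ |((c i : ℝ) - t * n i) * ((c j : ℝ) - t * n j) * B (e i) (e j)| := le_abs_self _
      _ = |(c i : ℝ) - t * n i| * |(c j : ℝ) - t * n j| * |B (e i) (e j)| := by
          rw [abs_mul, abs_mul]
      _ ≤ 1 * 1 * |B (e i) (e j)| := by
          gcongr
          · exact hfl i
          · exact hfl j
      _ = |B (e i) (e j)| := by ring
  have h3 : dist (φ (ofAdd (∑ i, n i • e i)) • x) (φ (ofAdd (∑ i, n i • e i)) • y) ≤ dist x y := by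
    rw [dist_smul]
  have h4 := hX.dist_pt_pt_le_max ht le_rfl h3
  have h5 := dist_triangle4 (φ (ofAdd (∑ i, c i • e i)) • x) (φ (ofAdd (∑ i, c i • e i)) • y)
    (hX.pt y (φ (ofAdd (∑ i, n i • e i)) • y) t) (hX.pt x (φ (ofAdd (∑ i, n i • e i)) • x) t)
  rw [dist_smul] at h5
  rw [dist_comm] at h4
  linarith

end Displacement

end CAT0Boundary

namespace CAT0Boundary

open scoped commutatorElement

/-! ### Linear isometries close to the identity. -/

section SmallRotations

theorem LinearIsometryEquiv.mul_apply {E : Type*} [NormedAddCommGroup E] [NormedSpace ℝ E]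
    (A B : E ≃ₗᵢ[ℝ] E) (v : E) : (A * B) v = A (B v) := rfl

variable {E : Type*} [NormedAddCommGroup E] [InnerProductSpace ℝ E]

/-- A linear isometry that moves every vector by at most `δ` times its norm. -/
def SmallRotation (δ : ℝ) (B : E ≃ₗᵢ[ℝ] E) : Prop := ∀ v, ‖B v - v‖ ≤ δ * ‖v‖

theorem SmallRotation.mono {δ δ' : ℝ} {B : E ≃ₗᵢ[ℝ] E} (h : SmallRotation δ B) (hδ : δ ≤ δ') :
    SmallRotation δ' B := fun v => (h v).trans (by gcongr)

/-- `⁅A, B⁆ - 1` is `(A - 1)(B - 1) - (B - 1)(A - 1)` composed with the isometry `(B A)⁻¹`. -/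
theorem SmallRotation.commutator {a b : ℝ} (ha : 0 ≤ a) (hb : 0 ≤ b) {A B : E ≃ₗᵢ[ℝ] E}
    (hA : SmallRotation a A) (hB : SmallRotation b B) : SmallRotation (2 * a * b) ⁅A, B⁆ := by
  intro v
  obtain ⟨u, rfl⟩ : ∃ u, v = (B * A) u := ⟨(B * A)⁻¹ v, by
    rw [← LinearIsometryEquiv.mul_apply, mul_inv_cancel, LinearIsometryEquiv.coe_one, id]⟩
  have h1 : ⁅A, B⁆ ((B * A) u) = A (B u) := by
    rw [← LinearIsometryEquiv.mul_apply, ← LinearIsometryEquiv.mul_apply]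
    congr 1
    rw [commutatorElement_def]
    group
  have h2 : ⁅A, B⁆ ((B * A) u) - (B * A) u =
      (A (B u - u) - (B u - u)) - (B (A u - u) - (A u - u)) := by
    rw [h1, LinearIsometryEquiv.mul_apply, map_sub, map_sub]
    abel
  rw [h2, LinearIsometryEquiv.norm_map]
  calc _ ≤ ‖A (B u - u) - (B u - u)‖ + ‖B (A u - u) - (A u - u)‖ := norm_sub_le _ _
    _ ≤ a * (b * ‖u‖) + b * (a * ‖u‖) := by
        refine add_le_add ((hA _).trans ?_) ((hB _).trans ?_)
        · exact mul_le_mul_of_nonneg_left (hB u) ha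
        · exact mul_le_mul_of_nonneg_left (hA u) hb
    _ = 2 * a * b * ‖u‖ := by ring

/-- The group of linear isometries has no small subgroups. -/
theorem eq_one_of_smallRotation_pow {C : E ≃ₗᵢ[ℝ] E}
    (hC : ∀ n : ℕ, SmallRotation (1 / 4) (C ^ n)) : C = 1 := by
  have key : ∀ (n : ℕ) (v : E), (3 / 2) ^ n * ‖C v - v‖ ≤ ‖(C ^ 2 ^ n) v - v‖ := by
    intro n v
    induction n with
    | zero => simp
    | succ n ih =>
      set D := C ^ 2 ^ n with hD
      have h1 : (C ^ 2 ^ (n + 1)) v = D (D v) := by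
        rw [pow_succ, pow_mul, ← hD, sq, LinearIsometryEquiv.mul_apply]
      -- Since `D² - 1 = 2 (D - 1) + (D - 1)²`, each squaring enlarges the displacement by at least
      -- `2 - 1/4 ≥ 3/2`, which cannot go on for ever.
      have h2 : (2 : ℝ) • (D v - v) = (D (D v) - v) - (D (D v - v) - (D v - v)) := by
        rw [map_sub, two_smul]
        abel
      have h3 : 2 * ‖D v - v‖ ≤ ‖D (D v) - v‖ + 1 / 4 * ‖D v - v‖ := by
        calc 2 * ‖D v - v‖ = ‖(2 : ℝ) • (D v - v)‖ := by rw [norm_smul]; simp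
          _ ≤ ‖D (D v) - v‖ + ‖D (D v - v) - (D v - v)‖ := by rw [h2]; exact norm_sub_le _ _
          _ ≤ _ := by gcongr; exact hC _ _
      rw [h1, pow_succ]
      have := norm_nonneg (D v - v)
      linarith
  ext v
  by_contra hne
  have hpos : 0 < ‖C v - v‖ := norm_pos_iff.2 (sub_ne_zero.2 hne)
  obtain ⟨n, hn⟩ := pow_unbounded_of_one_lt (1 / 4 * ‖v‖ / ‖C v - v‖)
    (show (1 : ℝ) < 3 / 2 by norm_num)
  rw [div_lt_iff₀ hpos] at hn
  exact absurd ((key n v).trans (hC _ v)) (not_le.2 hn)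

/-- If `A` commutes with `C = ⁅A, B⁆`, then `C ^ n = ⁅A ^ n, B⁆`, which differs from the identity by
at most twice the error `1 / 8` of `B`. All powers of `C` are therefore small, so `C = 1`. -/
theorem commutator_eq_one_of_smallRotation {A B : E ≃ₗᵢ[ℝ] E} (hB : SmallRotation (1 / 8) B)
    (hcomm : Commute A ⁅A, B⁆) : ⁅A, B⁆ = 1 := by
  set C := ⁅A, B⁆ with hC
  have hAB : A * B = C * B * A := by rw [hC, commutatorElement_def]; group
  have hpow : ∀ n : ℕ, A ^ n * B = C ^ n * B * A ^ n := by
    intro n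
    induction n with
    | zero => simp
    | succ n ih =>
      calc A ^ (n + 1) * B = A * (A ^ n * B) := by rw [pow_succ', mul_assoc]
        _ = (A * C ^ n) * B * A ^ n := by rw [ih]; group
        _ = C ^ n * (A * B) * A ^ n := by rw [(hcomm.pow_right n).eq]; group
        _ = C ^ (n + 1) * B * A ^ (n + 1) := by rw [hAB, pow_succ C, pow_succ' A]; group
  refine eq_one_of_smallRotation_pow fun n v => ?_
  obtain ⟨u, rfl⟩ : ∃ u, v = (B * A ^ n) u := ⟨(B * A ^ n)⁻¹ v, by
    rw [← LinearIsometryEquiv.mul_apply, mul_inv_cancel, LinearIsometryEquiv.coe_one, id]⟩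
  have h1 : (C ^ n) ((B * A ^ n) u) = (A ^ n) (B u) := by
    rw [← LinearIsometryEquiv.mul_apply, ← LinearIsometryEquiv.mul_apply, hpow, mul_assoc]
  rw [h1, LinearIsometryEquiv.norm_map, LinearIsometryEquiv.mul_apply]
  have h2 : (A ^ n) (B u) - B ((A ^ n) u) =
      (A ^ n) (B u - u) - (B ((A ^ n) u) - (A ^ n) u) := by
    rw [map_sub]
    abel
  have h3 := hB u
  have h4 := hB ((A ^ n) u)
  rw [LinearIsometryEquiv.norm_map] at h4
  rw [h2]
  refine (norm_sub_le _ _).trans ?_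
  rw [LinearIsometryEquiv.norm_map]
  linarith

/-- Fixed vectors of an isometry are orthogonal to the range of `A - 1`, so `A - 1` and its square
have the same kernel. -/
theorem map_sub_eq_zero_of_map_sub_map_sub {A : E ≃ₗᵢ[ℝ] E} {u : E}
    (h : A (A u - u) - (A u - u) = 0) : A u - u = 0 := by
  set z := A u - u with hz
  have hAz : A z = z := sub_eq_zero.1 h
  have h1 : inner ℝ z (A u) = inner ℝ z u := by
    conv_lhs => rw [← hAz]
    exact A.inner_map_map z u
  have h2 : inner ℝ z z = 0 := by
    conv_lhs => rw [hz, inner_sub_right, ← hz]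
    rw [h1, sub_self]
  exact inner_self_eq_zero.1 h2

theorem inner_map_sub_eq_zero {A : E ≃ₗᵢ[ℝ] E} {w : E} (hw : A w - w = 0) (u : E) :
    inner ℝ w (A u - u) = 0 := by
  have hAw : A w = w := sub_eq_zero.1 hw
  rw [inner_sub_right, sub_eq_zero]
  conv_lhs => rw [← hAw]
  exact A.inner_map_map w u

end SmallRotations

theorem exists_frequently_eq_of_finite {α : Type*} {T : Set α} (hT : T.Finite) {h : ℕ → α}
    (hh : ∀ j, h j ∈ T) : ∃ w, ∃ᶠ j in atTop, h j = w := by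
  have h1 : (⋃ w ∈ T, {j | h j = w}) ∈ hyperfilter ℕ :=
    Filter.mem_of_superset univ_mem fun j _ => mem_biUnion (hh j) rfl
  obtain ⟨w, -, hw⟩ := (Ultrafilter.finite_biUnion_mem_iff hT).1 h1
  have hw' : ∃ᶠ j in (hyperfilter ℕ : Filter ℕ), h j = w := Eventually.frequently hw
  exact ⟨w, hw'.filter_mono Nat.hyperfilter_le_atTop⟩

/-! ### Discrete groups of Euclidean isometries are virtually abelian. -/

section Bieberbach

variable {Γ E : Type*} [Group Γ] [NormedAddCommGroup E] [InnerProductSpace ℝ E] [MulAction Γ E]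
  [IsIsometricSMul Γ E]

variable (E) in
/-- The linear part of an isometric action on a Euclidean space. -/
noncomputable def linearPart : Γ →* (E ≃ₗᵢ[ℝ] E) :=
  MonoidHom.mk' (fun g => (IsometryEquiv.constSMul g : E ≃ᵢ E).toRealLinearIsometryEquiv)
    fun g h => by
      ext v
      rw [LinearIsometryEquiv.mul_apply,
        (IsometryEquiv.constSMul h).toRealLinearIsometryEquiv_apply v, map_sub]
      simp [IsometryEquiv.toRealLinearIsometryEquiv_apply, mul_smul]

theorem smul_eq_linearPart_add (g : Γ) (v : E) : g • v = linearPart E g v + g • (0 : E) := by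
  simp [linearPart, IsometryEquiv.toRealLinearIsometryEquiv_apply]

theorem commutator_smul_zero (g h : Γ) :
    ⁅g, h⁆ • (0 : E) = g • (0 : E) + linearPart E g (h • (0 : E)) -
      linearPart E ⁅g, h⁆ (h • (0 : E) + linearPart E h (g • (0 : E))) := by
  have h1 : ⁅g, h⁆ • h • g • (0 : E) = g • h • (0 : E) := by
    simp only [smul_smul]
    congr 1
    rw [commutatorElement_def]
    group
  rw [smul_eq_linearPart_add ⁅g, h⁆, smul_eq_linearPart_add h (g • 0),
    smul_eq_linearPart_add g (h • 0), add_comm (linearPart E h _)] at h1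
  rw [add_comm (g • (0 : E)), ← h1]
  abel

/-- Iterated commutators with `g` have linear parts shrinking by the factor `2 · 1/8 = 1/4`, while
their translation parts stay bounded. By discreteness one element recurs infinitely often, so its
linear part is trivial; `commutator_eq_one_of_smallRotation` then carries triviality back down to
the first commutator. -/
theorem commutator_linearPart_eq_one
    (hfin : ∀ r : ℝ, {g : Γ | ‖g • (0 : E)‖ ≤ r}.Finite) {g h : Γ}
    (hg : SmallRotation (1 / 8) (linearPart E g)) (hh : SmallRotation (1 / 8) (linearPart E h)) :
    ⁅linearPart E g, linearPart E h⁆ = 1 := by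
  let s : ℕ → Γ := fun j => (fun x => ⁅g, x⁆)^[j] h
  have hs : ∀ j, s (j + 1) = ⁅g, s j⁆ := fun j => Function.iterate_succ_apply' _ _ _
  set M := ‖g • (0 : E)‖ + ‖h • (0 : E)‖ with hM
  have hsmall : ∀ j, SmallRotation (1 / 8 * (1 / 4) ^ j) (linearPart E (s j)) ∧
      ‖s j • (0 : E)‖ ≤ M := by
    intro j
    induction j with
    | zero => exact ⟨hh.mono (by norm_num), by simp [s, hM]⟩
    | succ j ih =>
      obtain ⟨ih1, ih2⟩ := ih
      have h1 : SmallRotation (1 / 8 * (1 / 4) ^ (j + 1)) (linearPart E (s (j + 1))) := by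
        rw [hs, map_commutatorElement]
        refine (hg.commutator (by norm_num) (by positivity) ih1).mono (le_of_eq ?_)
        rw [pow_succ]
        ring
      refine ⟨h1, ?_⟩
      have hp : ∀ n : ℕ, (1 / 8 * (1 / 4) ^ n : ℝ) ≤ 1 / 8 := fun n =>
        mul_le_of_le_one_right (by norm_num) (pow_le_one₀ (by norm_num) (by norm_num))
      have h2 := h1.mono (hp _)
      have h3 := ih1.mono (hp _)
      rw [hs] at h2 ⊢
      rw [commutator_smul_zero, map_add]
      set a := g • (0 : E)
      set b := s j • (0 : E)
      set A := linearPart E g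
      set B := linearPart E (s j)
      set C := linearPart E ⁅g, s j⁆
      have h4 : a + A b - (C b + C (B a)) = (A b - b) - (C b - b) - (C (B a) - B a) - (B a - a) := by
        abel
      rw [h4]
      have e1 := hg b
      have e2 := h2 b
      have e3 := h2 (B a)
      have e4 := h3 a
      rw [LinearIsometryEquiv.norm_map] at e3
      have e5 := norm_sub_le ((A b - b) - (C b - b) - (C (B a) - B a)) (B a - a)
      have e6 := norm_sub_le ((A b - b) - (C b - b)) (C (B a) - B a)
      have e7 := norm_sub_le (A b - b) (C b - b)
      have e8 : ‖a‖ ≤ M := by rw [hM]; linarith [norm_nonneg (h • (0 : E))]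
      linarith [norm_nonneg a]
  obtain ⟨w, hw⟩ := exists_frequently_eq_of_finite (hfin M) fun j => (hsmall j).2
  have hw1 : linearPart E w = 1 := by
    ext v
    by_contra hne
    have hpos : 0 < ‖linearPart E w v - v‖ := norm_pos_iff.2 (sub_ne_zero.2 hne)
    have ht : Tendsto (fun j : ℕ => 1 / 8 * (1 / 4 : ℝ) ^ j * ‖v‖) atTop (𝓝 (1 / 8 * 0 * ‖v‖)) :=
      ((tendsto_pow_atTop_nhds_zero_of_lt_one (by norm_num) (by norm_num)).const_mul _).mul_const _
    rw [mul_zero, zero_mul] at ht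
    obtain ⟨j, rfl, hj⟩ := (hw.and_eventually (ht.eventually_lt_const hpos)).exists
    exact absurd ((hsmall j).1 v) (not_le.2 hj)
  obtain ⟨j, hj⟩ := hw.exists
  -- If the linear part of `s (j + 2)` is trivial, then `linearPart E g` commutes with that of `s (j
  -- + 1)`, itself a commutator with a small rotation.
  have hdesc : ∀ j, linearPart E (s (j + 1)) = 1 → ⁅linearPart E g, linearPart E h⁆ = 1 := by
    intro j
    induction j with
    | zero => intro h1; rwa [hs, map_commutatorElement] at h1
    | succ j ih =>
      intro h1
      apply ih
      rw [hs, map_commutatorElement]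
      apply commutator_eq_one_of_smallRotation
      · exact (hsmall j).1.mono
          (mul_le_of_le_one_right (by norm_num) (pow_le_one₀ (by norm_num) (by norm_num)))
      · rw [← map_commutatorElement, ← hs]
        rwa [hs, map_commutatorElement, commutatorElement_eq_one_iff_commute] at h1
  refine hdesc j ?_
  rw [hs, map_commutatorElement, hj, hw1, commutatorElement_one_right]

/-- `⁅g, h⁆` is now a translation, and commuting it repeatedly with `g` applies `A - 1` to its
vector, where `A` is the linear part of `g`. The vectors shrink, so by discreteness one vanishes; `A
- 1` and its powers have the same kernel. -/
theorem linearPart_sub_smul_commutator_eq_zero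
    (hfin : ∀ r : ℝ, {g : Γ | ‖g • (0 : E)‖ ≤ r}.Finite) {g h : Γ}
    (hg : SmallRotation (1 / 8) (linearPart E g)) (hh : SmallRotation (1 / 8) (linearPart E h)) :
    linearPart E g (⁅g, h⁆ • (0 : E)) - ⁅g, h⁆ • (0 : E) = 0 := by
  let s : ℕ → Γ := fun j => (fun x => ⁅g, x⁆)^[j] ⁅g, h⁆
  have hs : ∀ j, s (j + 1) = ⁅g, s j⁆ := fun j => Function.iterate_succ_apply' _ _ _
  have hlin : ∀ j, linearPart E (s j) = 1 := by
    intro j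
    induction j with
    | zero => exact (map_commutatorElement _ g h).trans (commutator_linearPart_eq_one hfin hg hh)
    | succ j ih => rw [hs, map_commutatorElement, ih, commutatorElement_one_right]
  have hstep : ∀ j, s (j + 1) • (0 : E) = linearPart E g (s j • (0 : E)) - s j • (0 : E) := by
    intro j
    rw [hs, commutator_smul_zero, ← hs, hlin, hlin]
    simp only [LinearIsometryEquiv.coe_one, id]
    abel
  have hnorm : ∀ j, ‖s j • (0 : E)‖ ≤ (1 / 8) ^ j * ‖⁅g, h⁆ • (0 : E)‖ := by
    intro j
    induction j with
    | zero => simp [s]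
    | succ j ih =>
      rw [hstep, pow_succ]
      linarith [hg (s j • (0 : E))]
  obtain ⟨w, hw⟩ := exists_frequently_eq_of_finite (hfin ‖⁅g, h⁆ • (0 : E)‖) fun j =>
    (hnorm j).trans (mul_le_of_le_one_left (norm_nonneg _)
      (pow_le_one₀ (by norm_num) (by norm_num)))
  have hw0 : w • (0 : E) = 0 := by
    by_contra hne
    have hpos : 0 < ‖w • (0 : E)‖ := norm_pos_iff.2 hne
    have ht : Tendsto (fun j : ℕ => (1 / 8 : ℝ) ^ j * ‖⁅g, h⁆ • (0 : E)‖) atTop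
        (𝓝 (0 * ‖⁅g, h⁆ • (0 : E)‖)) :=
      (tendsto_pow_atTop_nhds_zero_of_lt_one (by norm_num) (by norm_num)).mul_const _
    rw [zero_mul] at ht
    obtain ⟨j, rfl, hj⟩ := (hw.and_eventually (ht.eventually_lt_const hpos)).exists
    exact absurd (hnorm j) (not_le.2 hj)
  obtain ⟨j, hj⟩ := hw.exists
  have hdesc : ∀ j, s (j + 1) • (0 : E) = 0 →
      linearPart E g (⁅g, h⁆ • (0 : E)) - ⁅g, h⁆ • (0 : E) = 0 := by
    intro j
    induction j with
    | zero => intro h1; rwa [hstep] at h1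
    | succ j ih =>
      intro h1
      apply ih
      rw [hstep, hstep] at h1
      rw [hstep]
      exact map_sub_eq_zero_of_map_sub_map_sub h1
  refine hdesc j ?_
  rw [hstep, hj, hw0, map_zero, sub_zero]

/-- Elements with small linear parts in a discrete group of Euclidean isometries commute. -/
theorem smul_smul_comm_of_smallRotation
    (hfin : ∀ r : ℝ, {g : Γ | ‖g • (0 : E)‖ ≤ r}.Finite) {g h : Γ}
    (hg : SmallRotation (1 / 8) (linearPart E g)) (hh : SmallRotation (1 / 8) (linearPart E h))
    (v : E) : g • h • v = h • g • v := by
  have hlin := commutator_linearPart_eq_one hfin hg hh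
  have hlin' : linearPart E ⁅g, h⁆ = 1 := (map_commutatorElement _ g h).trans hlin
  set w := ⁅g, h⁆ • (0 : E) with hw
  have h1 := linearPart_sub_smul_commutator_eq_zero hfin hg hh
  have h2 := linearPart_sub_smul_commutator_eq_zero hfin hh hg
  -- The vector `w` lies in the sum of the ranges of `A - 1` and `B - 1`, and is fixed by both `A`
  -- and `B`, hence orthogonal to both ranges: it is zero.
  have h3 : w = (linearPart E g (h • (0 : E)) - h • (0 : E)) -
      (linearPart E h (g • (0 : E)) - g • (0 : E)) := by
    rw [hw, commutator_smul_zero, hlin']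
    simp only [LinearIsometryEquiv.coe_one, id]
    abel
  have h4 : ⁅h, g⁆ • (0 : E) = -w := by
    have hlin'' : linearPart E ⁅h, g⁆ = 1 := by
      rw [← commutatorElement_inv, map_inv, hlin', inv_one]
    rw [commutator_smul_zero, hlin'', h3]
    simp only [LinearIsometryEquiv.coe_one, id]
    abel
  rw [h4, map_neg, ← neg_sub', neg_eq_zero] at h2
  have h5 : inner ℝ w w = 0 := by
    conv_lhs => arg 3; rw [h3]
    rw [inner_sub_right, inner_map_sub_eq_zero h1, inner_map_sub_eq_zero h2, sub_zero]
  have h6 : w = 0 := inner_self_eq_zero.1 h5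
  have h7 : ∀ u : E, ⁅g, h⁆ • u = u := by
    intro u
    rw [smul_eq_linearPart_add, ← hw, h6, hlin', add_zero, LinearIsometryEquiv.coe_one, id]
  rw [← h7 (h • g • v), smul_smul, smul_smul, smul_smul]
  congr 1
  rw [commutatorElement_def]
  group

/-- A discrete group of Euclidean isometries is virtually abelian. -/
theorem exists_finiteIndex_smul_comm [FiniteDimensional ℝ E]
    (hfin : ∀ r : ℝ, {g : Γ | ‖g • (0 : E)‖ ≤ r}.Finite) :
    ∃ Γ' : Subgroup Γ, Γ'.FiniteIndex ∧
      ∀ g ∈ Γ', ∀ h ∈ Γ', ∀ v : E, g • h • v = h • g • v := by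
  let S : Set Γ := {g | SmallRotation (1 / 8) (linearPart E g)}
  refine ⟨Subgroup.closure S, ?_, ?_⟩
  -- Finite index by pigeonhole in the compact unit ball of operators: coset representatives whose
  -- linear parts are within `1 / 8` differ by a small rotation, so they represent the same coset.
  · let f : Γ → (E →L[ℝ] E) := fun g => (linearPart E g).toContinuousLinearEquiv
    have hf : ∀ g, f g ∈ Metric.closedBall (0 : E →L[ℝ] E) 1 := fun g => by
      rw [mem_closedBall_zero_iff]
      exact ContinuousLinearMap.opNorm_le_bound _ zero_le_one fun v =>
        le_of_eq (by simp [f])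
    have : ProperSpace (E →L[ℝ] E) := FiniteDimensional.proper ℝ _
    obtain ⟨t, -, htf, ht⟩ := (isCompact_closedBall (0 : E →L[ℝ] E) 1).finite_cover_balls
      (show (0 : ℝ) < 1 / 16 by norm_num)
    choose c hct hc using fun g => mem_iUnion₂.1 (ht (hf g))
    have : Finite t := htf
    have hinj : Function.Injective fun q : Γ ⧸ Subgroup.closure S =>
        (⟨c q.out, hct q.out⟩ : t) := by
      intro q q' hqq'
      have hcc : c q.out = c q'.out := congrArg Subtype.val hqq'
      rw [← q.out_eq, ← q'.out_eq]
      refine QuotientGroup.eq.2 (Subgroup.subset_closure fun v => ?_)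
      rw [map_mul, map_inv, LinearIsometryEquiv.mul_apply]
      have h1 := hc q.out
      have h2 := hc q'.out
      rw [← hcc] at h2
      have h3 : ‖f q'.out - f q.out‖ ≤ 1 / 8 := by
        rw [← dist_eq_norm]
        rw [Metric.mem_ball] at h1 h2
        linarith [dist_triangle_right (f q'.out) (f q.out) (c q.out)]
      have h4 : (linearPart E q.out)⁻¹ (linearPart E q'.out v) - v =
          (linearPart E q.out)⁻¹ (linearPart E q'.out v - linearPart E q.out v) := by
        rw [map_sub, ← LinearIsometryEquiv.mul_apply _ (linearPart E q.out), inv_mul_cancel]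
        rfl
      rw [h4, LinearIsometryEquiv.norm_map]
      exact ((f q'.out - f q.out).le_opNorm v).trans (by gcongr)
    have : Finite (Γ ⧸ Subgroup.closure S) := Finite.of_injective _ hinj
    exact Subgroup.finiteIndex_of_finite_quotient
  · intro g hg h hh
    have key : ∀ g ∈ S, ∀ h ∈ Subgroup.closure S, ∀ v : E, g • h • v = h • g • v := by
      intro g hg h hh
      induction hh using Subgroup.closure_induction with
      | mem h hh => exact smul_smul_comm_of_smallRotation hfin hg hh
      | one => simp
      | mul a b _ _ ha hb => intro v; rw [mul_smul, ha, hb, mul_smul]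
      | inv a _ ha =>
        intro v
        rw [← smul_left_cancel_iff a, ← ha, smul_inv_smul, smul_inv_smul]
    induction hg using Subgroup.closure_induction with
    | mem g hg => exact key g hg h hh
    | one => simp
    | mul a b _ _ ha hb => intro v; rw [mul_smul, hb, ha, mul_smul]
    | inv a _ ha =>
      intro v
      rw [← smul_left_cancel_iff a, smul_inv_smul, ha, smul_inv_smul]

end Bieberbach

end CAT0Boundary

namespace CAT0Boundary

/-! ### Geodesics parametrized by arclength and stopped at their endpoint. -/

section Arc

variable {X : Type*} [MetricSpace X]

namespace IsCAT0

variable (hX : IsCAT0 X)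

/-- The point at distance `s` from `x` on the geodesic from `x` to `y`, or `y` if there is none. -/
noncomputable def arc (x y : X) (s : ℝ) : X := hX.pt x y (min s (dist x y) / dist x y)

theorem min_dist_div_mem_Icc (x y : X) {s : ℝ} (hs : 0 ≤ s) :
    min s (dist x y) / dist x y ∈ Icc (0 : ℝ) 1 :=
  ⟨div_nonneg (le_min hs dist_nonneg) dist_nonneg,
    div_le_one_of_le₀ (min_le_right _ _) dist_nonneg⟩

theorem dist_arc_arc (x y : X) {s t : ℝ} (hs : 0 ≤ s) (ht : 0 ≤ t) :
    dist (hX.arc x y s) (hX.arc x y t) = |min s (dist x y) - min t (dist x y)| := by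
  rw [arc, arc, hX.dist_pt_pt x y (min_dist_div_mem_Icc x y hs) (min_dist_div_mem_Icc x y ht),
    ← sub_div]
  rcases (dist_nonneg (x := x) (y := y)).eq_or_lt with h0 | h0
  · rw [← h0, min_eq_right hs, min_eq_right ht]
    simp
  · rw [abs_div, abs_of_pos h0, div_mul_cancel₀ _ h0.ne']

theorem arc_zero (x y : X) : hX.arc x y 0 = x := by
  rw [arc, min_eq_left dist_nonneg, zero_div, hX.pt_zero]

theorem arc_of_dist_le (x y : X) {s : ℝ} (hs : dist x y ≤ s) : hX.arc x y s = y := by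
  rw [arc, min_eq_right hs]
  rcases (dist_nonneg (x := x) (y := y)).eq_or_lt with h0 | h0
  · rw [← h0, div_zero, hX.pt_zero]
    exact dist_eq_zero.1 h0.symm
  · rw [div_self h0.ne', hX.pt_one]

end IsCAT0

end Arc

/-! ### Chains of orbit points along geodesics of quasiconvex orbits. -/

section OrbitChains

variable {A X : Type*} [Group A] [MetricSpace X] [MulAction A X] (hX : IsCAT0 X)

/-- Points of geodesics between points of a quasiconvex orbit are uniformly close to the orbit. -/
theorem IsQuasiconvex.exists_dist_smul_pt_le {x₀ : X}
    (hq : IsQuasiconvex (MulAction.orbit A x₀)) :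
    ∃ ν : ℝ, 0 ≤ ν ∧ ∀ g g' : A, ∀ t ∈ Icc (0 : ℝ) 1,
      ∃ k : A, dist (k • x₀) (hX.pt (g • x₀) (g' • x₀) t) ≤ ν := by
  obtain ⟨ν, hν, h⟩ := hq
  refine ⟨ν + 1, by linarith, fun g g' t ht => ?_⟩
  have h1 := h _ ⟨g, rfl⟩ _ ⟨g', rfl⟩ _ (hX.geodesic (g • x₀) (g' • x₀)).choose_spec
    ⟨_, mul_dist_mem_Icc ht _ _, rfl⟩
  have h2 := Metric.cthickening_subset_thickening' (by linarith) (lt_add_one ν) _ h1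
  obtain ⟨_, ⟨k, rfl⟩, hk⟩ := Metric.mem_thickening_iff.1 h2
  exact ⟨k, by rw [dist_comm]; exact hk.le⟩

/-- The discrete substitute for a geodesic inside the group. Since the chain consists of group
elements, it can be transported by a homomorphism. -/
theorem exists_orbit_chain {x₀ : X} {ν : ℝ} (hν : 0 ≤ ν)
    (hq : ∀ g g' : A, ∀ t ∈ Icc (0 : ℝ) 1,
      ∃ k : A, dist (k • x₀) (hX.pt (g • x₀) (g' • x₀) t) ≤ ν) (g : A) :
    ∃ a : ℕ → A, a 0 = 1 ∧ (∀ i : ℕ, dist x₀ (g • x₀) + 1 ≤ i → a i = g) ∧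
      ∀ i : ℕ, dist (a i • x₀)
        (hX.arc x₀ (g • x₀) i) ≤ ν := by
  classical
  set d := dist x₀ (g • x₀) with hd
  choose k hk using fun i : ℕ => hq 1 g _ (IsCAT0.min_dist_div_mem_Icc x₀ (g • x₀) i.cast_nonneg)
  simp only [one_smul] at hk
  -- The bound `d + 1` rather than `d` keeps index `0` out of the second case, which matters when
  -- `g` is not `1` but fixes `x₀`.
  refine ⟨fun i => if i = 0 then 1 else if d + 1 ≤ i then g else k i, by simp, ?_, ?_⟩
  · intro i hi
    have : i ≠ 0 := by
      rintro rfl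
      norm_num at hi
      linarith [dist_nonneg (x := x₀) (y := g • x₀)]
    simp [this, hi]
  · intro i
    by_cases h0 : i = 0
    · simp [h0, hX.arc_zero, hν]
    by_cases h1 : d + 1 ≤ i
    · simp only [h0, h1, if_true, if_false]
      rw [hX.arc_of_dist_le _ _ (by linarith), dist_self]
      exact hν
    · simp only [h0, h1, if_false]
      exact hk i

variable {hX} in
theorem dist_orbit_chain_succ_le {x₀ y : X} {ν : ℝ} {a : ℕ → A}
    (ha : ∀ i : ℕ, dist (a i • x₀) (hX.arc x₀ y i) ≤ ν) (i : ℕ) :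
    dist (a i • x₀) (a (i + 1) • x₀) ≤ 2 * ν + 1 := by
  have h1 := hX.dist_arc_arc x₀ y i.cast_nonneg (i + 1).cast_nonneg
  have h2 : |min (i : ℝ) (dist x₀ y) - min ((i + 1 : ℕ) : ℝ) (dist x₀ y)| ≤ 1 := by
    push_cast
    refine (abs_min_sub_min_le_max _ _ _ _).trans ?_
    simp
  have h3 := dist_triangle4 (a i • x₀) (hX.arc x₀ y i)
    (hX.arc x₀ y (i + 1 : ℕ)) (a (i + 1) • x₀)
  have h4 := ha i
  have h5 := ha (i + 1)
  rw [dist_comm] at h5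
  linarith

variable {hX} in
-- The chain errs by `2 * ν`; a further `2` is lost because the arc stops at `y` while indices may
-- exceed its length by `2`.
theorem sub_le_dist_orbit_chain {x₀ y : X} {ν : ℝ} {a : ℕ → A}
    (ha : ∀ i : ℕ, dist (a i • x₀) (hX.arc x₀ y i) ≤ ν) {i j : ℕ}
    (hi : i ≤ dist x₀ y + 2) (hj : j ≤ dist x₀ y + 2) :
    |(i : ℝ) - j| - (2 * ν + 2) ≤ dist (a i • x₀) (a j • x₀) := by
  have h1 := hX.dist_arc_arc x₀ y i.cast_nonneg j.cast_nonneg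
  have hmin : ∀ i : ℕ, (i : ℝ) ≤ dist x₀ y + 2 →
      (i : ℝ) - 2 ≤ min (i : ℝ) (dist x₀ y) ∧ min (i : ℝ) (dist x₀ y) ≤ i := fun i hi =>
    ⟨le_min (by linarith) (by linarith), min_le_left _ _⟩
  have h2 : |(i : ℝ) - j| - 2 ≤ |min (i : ℝ) (dist x₀ y) - min (j : ℝ) (dist x₀ y)| := by
    obtain ⟨b1, b2⟩ := hmin i hi
    obtain ⟨b3, b4⟩ := hmin j hj
    rw [sub_le_iff_le_add, abs_le]
    have := neg_abs_le (min (i : ℝ) (dist x₀ y) - min (j : ℝ) (dist x₀ y))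
    have := le_abs_self (min (i : ℝ) (dist x₀ y) - min (j : ℝ) (dist x₀ y))
    constructor <;> linarith
  have h3 := dist_triangle4 (hX.arc x₀ y i) (a i • x₀)
    (a j • x₀) (hX.arc x₀ y j)
  have h4 := ha i
  have h5 := ha j
  rw [dist_comm] at h4
  linarith

variable [IsIsometricSMul A X]
include hX

/-- Successive quotients along a chain from `1` to `g` displace `x₀` by at most `2 * ν + 1`, and
only finitely many elements do so. -/
theorem group_fg_of_isQuasiconvex_orbit {x₀ : X} (hq : IsQuasiconvex (MulAction.orbit A x₀))
    (hfin : ∀ r : ℝ, {g : A | dist (g • x₀) x₀ ≤ r}.Finite) : Group.FG A := by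
  obtain ⟨ν, hν, h⟩ := hq.exists_dist_smul_pt_le hX
  refine Group.fg_iff.2 ⟨{g : A | dist (g • x₀) x₀ ≤ 2 * ν + 1}, ?_, hfin _⟩
  rw [Subgroup.eq_top_iff']
  intro g
  obtain ⟨a, ha0, ha1, ha2⟩ := exists_orbit_chain hX hν h g
  have key : ∀ i, a i ∈ Subgroup.closure {g : A | dist (g • x₀) x₀ ≤ 2 * ν + 1} := by
    intro i
    induction i with
    | zero => rw [ha0]; exact one_mem _
    | succ i ih =>
      rw [← mul_inv_cancel_left (a i) (a (i + 1))]
      refine mul_mem ih (Subgroup.subset_closure ?_)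
      have := dist_orbit_chain_succ_le ha2 i
      rwa [Set.mem_ofPred_eq, mul_smul, ← dist_smul (a i), smul_inv_smul, dist_comm]
  obtain ⟨n, hn⟩ := exists_nat_ge (dist x₀ (g • x₀) + 1)
  rw [← ha1 n hn]
  exact key n

/-- Orbit maps are coarsely Lipschitz on quasiconvex orbits. -/
theorem exists_dist_map_smul_le {B Y : Type*} [Group B] [MetricSpace Y] [MulAction B Y]
    [IsIsometricSMul B Y] (η : A →* B) (y₀ : Y) {x₀ : X}
    (hq : IsQuasiconvex (MulAction.orbit A x₀))
    (hfin : ∀ r : ℝ, {g : A | dist (g • x₀) x₀ ≤ r}.Finite) :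
    ∃ M : ℝ, 0 ≤ M ∧ ∀ g g' : A,
      dist (η g • y₀) (η g' • y₀) ≤ M * dist (g • x₀) (g' • x₀) + 2 * M := by
  obtain ⟨ν, hν, h⟩ := hq.exists_dist_smul_pt_le hX
  obtain ⟨M, hM⟩ := ((hfin (2 * ν + 1)).image fun g => dist y₀ (η g • y₀)).bddAbove
  have hM0 : 0 ≤ max M 0 := le_max_right _ _
  refine ⟨max M 0, hM0, ?_⟩
  have key : ∀ g : A, dist y₀ (η g • y₀) ≤ max M 0 * dist x₀ (g • x₀) + 2 * max M 0 := by
    intro g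
    obtain ⟨a, ha0, ha1, ha2⟩ := exists_orbit_chain hX hν h g
    have hstep : ∀ n : ℕ, dist y₀ (η (a n) • y₀) ≤ n * max M 0 := by
      intro n
      induction n with
      | zero => simp [ha0]
      | succ n ih =>
        have h1 : dist (η (a n) • y₀) (η (a (n + 1)) • y₀) ≤ max M 0 := by
          refine le_trans ?_ (le_max_left _ _)
          refine hM ⟨(a n)⁻¹ * a (n + 1), ?_, ?_⟩
          · have := dist_orbit_chain_succ_le ha2 n
            rwa [Set.mem_ofPred_eq, mul_smul, ← dist_smul (a n), smul_inv_smul, dist_comm]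
          · simp only
            rw [← dist_smul (η (a n)), smul_smul, ← map_mul, mul_inv_cancel_left]
        push_cast
        linarith [dist_triangle y₀ (η (a n) • y₀) (η (a (n + 1)) • y₀)]
    have h2 := hstep (⌈dist x₀ (g • x₀) + 1⌉₊)
    rw [ha1 _ (Nat.le_ceil _)] at h2
    have h3 := (Nat.ceil_lt_add_one (show 0 ≤ dist x₀ (g • x₀) + 1 by positivity)).le
    nlinarith
  intro g g'
  have := key (g⁻¹ * g')
  rwa [map_mul, map_inv, mul_smul, mul_smul, ← dist_smul (η g), smul_inv_smul, ← dist_smul g x₀,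
    smul_inv_smul] at this

end OrbitChains

end CAT0Boundary

namespace CAT0Boundary

open scoped commutatorElement

/-! ### One abelian group acting on two spaces. -/

section AbelianActions

open Multiplicative (ofAdd)

/-- If a finitely generated abelian group acts on two `CAT(0)` spaces through geometric actions and
an orbit map is coarsely Lipschitz, then the orbit map is coarsely affine. -/
theorem exists_dist_pt_le_of_addCommGroup {A G₁ G₂ X₁ X₂ : Type*} [AddCommGroup A]
    [Module.Finite ℤ A] [Group G₁] [Group G₂] [MetricSpace X₁] [MetricSpace X₂] [MulAction G₁ X₁]
    [MulAction G₂ X₂] [IsIsometricSMul G₁ X₁] [IsIsometricSMul G₂ X₂]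
    (hX₁ : IsCAT0 X₁) (hX₂ : IsCAT0 X₂)
    (hG₁ : IsGeometricAction G₁ X₁) (hG₂ : IsGeometricAction G₂ X₂)
    (φ₁ : Multiplicative A →* G₁) (φ₂ : Multiplicative A →* G₂) (x₁ : X₁) (x₂ : X₂) {M N : ℝ}
    (hM : 0 ≤ M) (hφ : ∀ a b, dist (φ₂ a • x₂) (φ₂ b • x₂) ≤ M * dist (φ₁ a • x₁) (φ₁ b • x₁) + N)
    (C : ℝ) :
    ∃ D : ℝ, ∀ a b, ∀ t ∈ Icc (0 : ℝ) 1, dist (φ₁ b • x₁) (hX₁.pt x₁ (φ₁ a • x₁) t) ≤ C →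
      dist (φ₂ b • x₂) (hX₂.pt x₂ (φ₂ a • x₂) t) ≤ D := by
  obtain ⟨m, e, he⟩ := Submodule.fg_iff_exists_fin_generating_family.1
    (Module.Finite.fg_top (R := ℤ) (M := A))
  have he' : AddSubgroup.closure (range e) = ⊤ := by
    rw [← Submodule.span_int_eq_addSubgroupClosure, he]
    rfl
  obtain ⟨R₁, h₁⟩ := exists_dist_floor_smul_pt_le φ₁ hX₁ hG₁ he' x₁
  obtain ⟨R₂, h₂⟩ := exists_dist_floor_smul_pt_le φ₂ hX₂ hG₂ he' x₂
  refine ⟨M * (C + R₁) + N + R₂, fun a b t ht hab => ?_⟩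
  obtain ⟨n, hn⟩ : ∃ n : Fin m → ℤ, ∑ i, n i • e i = a.toAdd :=
    (Submodule.mem_span_range_iff_exists_fun ℤ).1 (he ▸ Submodule.mem_top)
  have h1 := h₁ n t ht
  have h2 := h₂ n t ht
  rw [hn, ofAdd_toAdd] at h1 h2
  -- The element `c` does not depend on the space: it marks parameter `t` in both. So `b` is near
  -- `c` in `X₁`, hence in `X₂`.
  set c := ofAdd (∑ i, ⌊t * n i⌋ • e i)
  have h3 := dist_triangle_right (φ₁ b • x₁) (φ₁ c • x₁) (hX₁.pt x₁ (φ₁ a • x₁) t)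
  have h4 := hφ b c
  have h5 := dist_triangle (φ₂ b • x₂) (φ₂ c • x₂) (hX₂.pt x₂ (φ₂ a • x₂) t)
  have h6 : M * dist (φ₁ b • x₁) (φ₁ c • x₁) ≤ M * (C + R₁) := by gcongr; linarith
  linarith

theorem group_fg_of_injective {K Z : Type*} [CommGroup K] [CommGroup Z] [Group.FG Z] (f : K →* Z)
    (hf : Function.Injective f) : Group.FG K := by
  have : Module.Finite ℤ (Additive Z) :=
    Module.Finite.iff_addGroup_fg.2 inferInstance
  have : Module.Finite ℤ (Additive K) :=
    Module.Finite.of_injective (MonoidHom.toAdditive f).toIntLinearMap hf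
  exact GroupFG.iff_add_fg.2 (Module.Finite.iff_addGroup_fg.1 this)

end AbelianActions

/-! ### Local finiteness of isolated flats and their stabilizers. -/

section Flats

variable {X : Type*} [MetricSpace X]

theorem IsFlat.exists_dist_eq {F : Set X} (hF : IsFlat F) {y : X} (hy : y ∈ F) {T : ℝ}
    (hT : 0 ≤ T) : ∃ z ∈ F, dist y z = T := by
  obtain ⟨k, hk, f, hf, rfl⟩ := hF
  obtain ⟨v, rfl⟩ := hy
  have hk0 : 0 < k := by omega
  refine ⟨_, ⟨v + EuclideanSpace.single ⟨0, hk0⟩ T, rfl⟩, ?_⟩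
  rw [hf.dist_eq]
  simp [abs_of_nonneg hT]

/-- A family of flats as in the definition of isolated flats. -/
structure IsIsolatedFlatFamily (𝓕 : Set (Set X)) : Prop where
  isFlat : ∀ F ∈ 𝓕, IsFlat F
  maximal : ∃ B : ℝ, ∀ F : Set X, IsFlat F → ∃ F' ∈ 𝓕, F ⊆ Metric.cthickening B F'
  isolated : ∃ ψ : ℝ≥0 → ℝ≥0, ∀ F₁ ∈ 𝓕, ∀ F₂ ∈ 𝓕, F₁ ≠ F₂ → ∀ k : ℝ≥0,
    ∀ x ∈ Metric.cthickening k F₁ ∩ Metric.cthickening k F₂,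
    ∀ y ∈ Metric.cthickening k F₁ ∩ Metric.cthickening k F₂, dist x y ≤ ψ k
  image_mem : ∀ g : X ≃ᵢ X, ∀ F ∈ 𝓕, g '' F ∈ 𝓕

theorem HasIsolatedFlats.exists_family (h : HasIsolatedFlats X) :
    ∃ 𝓕 : Set (Set X), IsIsolatedFlatFamily 𝓕 := by
  obtain ⟨𝓕, h1, h2, h3, h4⟩ := h
  exact ⟨𝓕, h1, h2, h3, h4⟩

/-- An isolated family of flats is locally finite. -/
theorem IsIsolatedFlatFamily.finite_near [ProperSpace X] {𝓕 : Set (Set X)}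
    (h𝓕 : IsIsolatedFlatFamily 𝓕) (x : X) (C : ℝ) :
    {F ∈ 𝓕 | ∃ y ∈ F, dist x y ≤ C}.Finite := by
  obtain ⟨ψ, hψ⟩ := h𝓕.isolated
  -- Each flat receives a pair of its points at distance `T` near `x`. Two flats whose pairs are
  -- within `1` of each other share, up to `1`, two points further apart than `ψ 1`, hence coincide.
  -- Compactness of a ball in `X × X` leaves finitely many.
  set T : ℝ := ψ 1 + 1 with hT
  have hT0 : 0 ≤ T := by positivity
  have hex : ∀ F : {F ∈ 𝓕 | ∃ y ∈ F, dist x y ≤ C}, ∃ p : X × X, p.1 ∈ F.1 ∧ p.2 ∈ F.1 ∧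
      dist p.1 p.2 = T ∧ dist x p.1 ≤ C := by
    rintro ⟨F, hF, y, hy, hxy⟩
    obtain ⟨z, hz, hyz⟩ := (h𝓕.isFlat F hF).exists_dist_eq hy hT0
    exact ⟨(y, z), hy, hz, hyz, hxy⟩
  choose p hp1 hp2 hp3 hp4 using hex
  obtain ⟨t, -, htf, ht⟩ := (isCompact_closedBall (x, x) (C + T)).finite_cover_balls
    (show (0 : ℝ) < 1 / 2 by norm_num)
  have hp : ∀ F, p F ∈ Metric.closedBall (x, x) (C + T) := by
    intro F
    rw [Metric.mem_closedBall, Prod.dist_eq, dist_comm, dist_comm _ x]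
    exact max_le (by linarith [hp4 F]) (by linarith [dist_triangle x (p F).1 (p F).2, hp3 F, hp4 F])
  choose c hct hc using fun F => mem_iUnion₂.1 (ht (hp F))
  have : Finite t := htf
  refine Set.finite_coe_iff.1 (Finite.of_injective (fun F => (⟨c F, hct F⟩ : t)) ?_)
  intro F₁ F₂ h12
  have hcc : c F₁ = c F₂ := congrArg Subtype.val h12
  by_contra hne
  have h1 := hc F₁
  have h2 := hc F₂
  rw [← hcc] at h2
  have h3 : dist (p F₁) (p F₂) ≤ 1 := by
    rw [Metric.mem_ball] at h1 h2
    linarith [dist_triangle_right (p F₁) (p F₂) (c F₁)]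
  rw [Prod.dist_eq] at h3
  have h4 := hψ F₁.1 F₁.2.1 F₂.1 F₂.2.1 (fun h => hne (Subtype.ext h)) 1
    (p F₁).1 ⟨Metric.self_subset_cthickening _ (hp1 F₁),
      Metric.mem_cthickening_of_dist_le _ _ _ _ (hp1 F₂) ((le_max_left _ _).trans h3)⟩
    (p F₁).2 ⟨Metric.self_subset_cthickening _ (hp2 F₁),
      Metric.mem_cthickening_of_dist_le _ _ _ _ (hp2 F₂) ((le_max_right _ _).trans h3)⟩
  rw [hp3, hT] at h4
  linarith

variable {G : Type*} [Group G] [MulAction G X] [IsIsometricSMul G X]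

instance Subgroup.instIsIsometricSMul (H : Subgroup G) : IsIsometricSMul H X :=
  ⟨fun h => isometry_smul X (h : G)⟩

open scoped Pointwise in
theorem IsIsolatedFlatFamily.smul_mem {𝓕 : Set (Set X)} (h𝓕 : IsIsolatedFlatFamily 𝓕) (g : G)
    {F : Set X} (hF : F ∈ 𝓕) : g • F ∈ 𝓕 :=
  h𝓕.image_mem (IsometryEquiv.constSMul g) F hF

open scoped Pointwise in
/-- Isolated flats have cocompact stabilizers. -/
theorem IsIsolatedFlatFamily.exists_stabilizer_smul_dist_le [ProperSpace X] {𝓕 : Set (Set X)}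
    (h𝓕 : IsIsolatedFlatFamily 𝓕) (hG : IsGeometricAction G X) {F : Set X} (hF : F ∈ 𝓕) (x : X) :
    ∃ R : ℝ, ∀ y ∈ F, ∃ g ∈ MulAction.stabilizer G F, dist (g • x) y ≤ R := by
  classical
  obtain ⟨R₀, hR₀⟩ := hG.exists_smul_dist_le x
  have hfin := h𝓕.finite_near x R₀
  -- One fixed element is chosen for each translate of `F`. Only finitely many translates come near
  -- `x`, so correcting by these elements costs a bounded amount.
  let c : Set X → G := fun F' => if h : ∃ g : G, g • F = F' then h.choose else 1
  have hc : ∀ g : G, c (g • F) • F = g • F := by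
    intro g
    have : ∃ g' : G, g' • F = g • F := ⟨g, rfl⟩
    simp only [c, this, dif_pos]
    exact this.choose_spec
  obtain ⟨R₁, hR₁⟩ := (hfin.image fun F' => dist x ((c F')⁻¹ • x)).bddAbove
  refine ⟨R₀ + R₁, fun y hy => ?_⟩
  obtain ⟨g, hg⟩ := hR₀ y
  have hmem : g • F ∈ {F ∈ 𝓕 | ∃ y ∈ F, dist x y ≤ R₀} :=
    ⟨h𝓕.smul_mem g hF, g • y, Set.smul_mem_smul_set hy, by rwa [dist_comm]⟩
  refine ⟨g⁻¹ * c (g • F), ?_, ?_⟩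
  · rw [MulAction.mem_stabilizer_iff, mul_smul, hc, inv_smul_smul]
  · have h1 := hR₁ ⟨_, hmem, rfl⟩
    simp only at h1
    have h2 : dist ((g⁻¹ * c (g • F)) • x) y = dist (c (g • F) • x) (g • y) := by
      rw [← dist_smul g, smul_smul, mul_inv_cancel_left]
    have h3 : dist (c (g • F) • x) x = dist x ((c (g • F))⁻¹ • x) := by
      rw [← dist_smul (c (g • F)) x, smul_inv_smul]
    rw [h2]
    linarith [dist_triangle_right (c (g • F) • x) (g • y) x]

theorem exists_dist_le_of_finiteIndex {Γ : Type*} [Group Γ] [MulAction Γ X] [IsIsometricSMul Γ X]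
    (Z : Subgroup Γ) [Z.FiniteIndex] {F : Set X} {x : X} {R : ℝ}
    (hR : ∀ y ∈ F, ∃ g : Γ, dist (g • x) y ≤ R) :
    ∃ R' : ℝ, ∀ y ∈ F, ∃ z ∈ Z, dist (z • x) y ≤ R' := by
  obtain ⟨M, hM⟩ := (Set.finite_range fun q : Γ ⧸ Z => dist x ((q.out)⁻¹ • x)).bddAbove
  refine ⟨M + R, fun y hy => ?_⟩
  obtain ⟨g, hg⟩ := hR y hy
  set q : Γ ⧸ Z := QuotientGroup.mk g⁻¹ with hq
  have h1 : q.out⁻¹ * g⁻¹ ∈ Z := QuotientGroup.eq.1 (by rw [QuotientGroup.out_eq'])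
  refine ⟨(q.out⁻¹ * g⁻¹)⁻¹, inv_mem h1, ?_⟩
  have h2 : dist x (q.out⁻¹ • x) ≤ M := hM ⟨q, rfl⟩
  have h3 : dist ((q.out⁻¹ * g⁻¹)⁻¹ • x) (g • x) = dist x (q.out⁻¹ • x) := by
    rw [← dist_smul (q.out⁻¹ * g⁻¹), smul_inv_smul, mul_smul, inv_smul_smul]
  linarith [dist_triangle ((q.out⁻¹ * g⁻¹)⁻¹ • x) (g • x) y]

/-- The stabilizer of an isolated flat contains a finitely generated abelian group that acts
coarsely transitively on the flat. -/
theorem IsIsolatedFlatFamily.exists_abelian [ProperSpace X] (hX : IsCAT0 X) {𝓕 : Set (Set X)}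
    (h𝓕 : IsIsolatedFlatFamily 𝓕) (hG : IsGeometricAction G X) {F : Set X} (hF : F ∈ 𝓕) (x : X) :
    ∃ Z : Subgroup G, (∀ a ∈ Z, ∀ b ∈ Z, a * b = b * a) ∧ Group.FG Z ∧
      ∃ R : ℝ, ∀ y ∈ F, ∃ z ∈ Z, dist (z • x) y ≤ R := by
  open scoped Pointwise in
  obtain ⟨k, hk, f, hf, hFf⟩ := h𝓕.isFlat F hF
  let E := EuclideanSpace ℝ (Fin k)
  let Γ := MulAction.stabilizer G F
  have hΓ : ∀ (g : Γ) (v : E), ∃ w : E, f w = g • f v := by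
    rintro ⟨g, hg⟩ v
    have : g • f v ∈ g • F := Set.smul_mem_smul_set (hFf ▸ mem_range_self v)
    rw [MulAction.mem_stabilizer_iff.1 hg, hFf] at this
    exact this
  choose a ha using hΓ
  let _ : MulAction Γ E :=
    { smul := a
      one_smul := fun v => hf.injective ((ha 1 v).trans (one_smul _ _))
      mul_smul := fun g h v => hf.injective (by
        change f (a (g * h) v) = f (a g (a h v))
        rw [ha, ha, ha, mul_smul]) }
  have hfa : ∀ (g : Γ) (v : E), f (g • v) = g • f v := ha
  have : IsIsometricSMul Γ E := ⟨fun g => Isometry.of_dist_eq fun v w => by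
    rw [← hf.dist_eq, hfa, hfa, dist_smul, hf.dist_eq]⟩
  have hfinΓ : ∀ (x y : X) (r : ℝ), {g : Γ | dist (g • x) y ≤ r}.Finite := fun x y r =>
    (hG.finite_setOf_dist_le x y r).preimage Subtype.val_injective.injOn
  obtain ⟨Γ', hΓ'1, hΓ'2⟩ := exists_finiteIndex_smul_comm (Γ := Γ) (E := E) (fun r => by
    refine (hfinΓ (f 0) (f 0) r).subset fun g hg => ?_
    rw [Set.mem_ofPred_eq, ← hfa, hf.dist_eq, dist_zero_right]
    exact hg)
  have hcob : ∀ x : X, ∃ R : ℝ, ∀ y ∈ F, ∃ g : Γ, dist (g • x) y ≤ R := fun x => by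
    obtain ⟨R, hR⟩ := h𝓕.exists_stabilizer_smul_dist_le hG hF x
    refine ⟨R, fun y hy => ?_⟩
    obtain ⟨g, hg, h⟩ := hR y hy
    exact ⟨⟨g, hg⟩, h⟩
  -- The flat is convex, because images of segments are geodesics and geodesics are unique; an orbit
  -- of its stabilizer is coarsely dense in it, hence quasiconvex.
  have : Group.FG Γ := by
    refine group_fg_of_isQuasiconvex_orbit hX (x₀ := f 0) ?_ (hfinΓ _ _)
    obtain ⟨R, hR⟩ := hcob (f 0)
    refine ⟨max R 0, le_max_right _ _, ?_⟩
    rintro _ ⟨g, rfl⟩ _ ⟨g', rfl⟩ γ hγ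
    rintro _ ⟨s, hs, rfl⟩
    simp only at hγ hs
    have hs' : s / dist (g • f 0) (g' • f 0) ∈ Icc (0 : ℝ) 1 :=
      ⟨div_nonneg hs.1 dist_nonneg, div_le_one_of_le₀ hs.2 dist_nonneg⟩
    have hmem : γ s ∈ F := by
      rw [hX.geodesic_eq_pt_div hγ hs, hFf]
      refine ⟨AffineMap.lineMap (g • (0 : E)) (g' • (0 : E))
        (s / dist (g • f 0) (g' • f 0)), ?_⟩
      refine hX.eq_pt_of_dist hs' ?_ ?_
      · rw [← hfa, ← hfa, hf.dist_eq, hf.dist_eq, dist_left_lineMap, Real.norm_eq_abs,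
          abs_of_nonneg]
        rw [← hf.dist_eq, hfa, hfa]
        exact hs'.1
      · rw [← hfa, ← hfa, hf.dist_eq, hf.dist_eq, dist_right_lineMap, Real.norm_eq_abs,
          abs_of_nonneg]
        rw [← hf.dist_eq, hfa, hfa]
        linarith [hs'.2]
    obtain ⟨g'', hg''⟩ := hR _ hmem
    refine Metric.mem_cthickening_of_dist_le _ (g'' • f 0) _ _ ⟨g'', rfl⟩ ?_
    rw [dist_comm]
    exact hg''.trans (le_max_left _ _)
  -- `Γ'` commutes only as a group acting on `E`, and the action may have a kernel. Commutators
  -- still fix `f 0`, so there are finitely many of them, and a finitely generated group with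
  -- finitely many commutators has centre of finite index.
  have : Finite (commutatorSet Γ') := by
    refine ((hfinΓ (f 0) (f 0) 0).preimage (f := Subtype.val) Subtype.val_injective.injOn).subset ?_
    rintro _ ⟨g, h, rfl⟩
    have h1 : (⁅g, h⁆ : Γ').1 • (0 : E) = 0 := by
      have h2 := hΓ'2 g g.2 h h.2 (g.1⁻¹ • h.1⁻¹ • (0 : E))
      rw [smul_inv_smul, smul_inv_smul] at h2
      conv_rhs => rw [← h2]
      simp only [commutatorElement_def, Subgroup.coe_mul, Subgroup.coe_inv, mul_smul]
    change dist ((⁅g, h⁆ : Γ').1 • f 0) (f 0) ≤ 0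
    rw [← hfa, h1, dist_self]
  let Z' : Subgroup Γ := (Subgroup.center Γ').map Γ'.subtype
  have : Z'.FiniteIndex := ⟨by
    rw [Subgroup.index_map_subtype]
    exact mul_ne_zero Subgroup.FiniteIndex.index_ne_zero hΓ'1.index_ne_zero⟩
  refine ⟨Z'.map Γ.subtype, ?_, ?_, ?_⟩
  · rintro _ ⟨_, ⟨a, ha, rfl⟩, rfl⟩ _ ⟨_, ⟨b, hb, rfl⟩, rfl⟩
    have := Subgroup.mem_center_iff.1 ha b
    have := congrArg (fun g : Γ' => (g : G)) this
    exact this.symm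
  · have hfg : Group.FG (Subgroup.center Γ') := inferInstance
    have hfg' : Group.FG Z' := Group.fg_of_surjective
      (f := ((Subgroup.center Γ').equivMapOfInjective _ Γ'.subtype_injective).toMonoidHom)
      (MulEquiv.surjective _)
    exact Group.fg_of_surjective
      (f := (Z'.equivMapOfInjective _ Γ.subtype_injective).toMonoidHom) (MulEquiv.surjective _)
  · obtain ⟨R, hR⟩ := hcob x
    obtain ⟨R', hR'⟩ := exists_dist_le_of_finiteIndex Z' hR
    refine ⟨R', fun y hy => ?_⟩
    obtain ⟨z, hz, h⟩ := hR' y hy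
    exact ⟨z, ⟨z, hz, rfl⟩, h⟩

end Flats

/-! ### Positions of orbit points near flats, compared in the two spaces. -/

section OrbitsNearFlats

/-- Elements that map a point close to a set on which `Z` acts coarsely transitively lie in
finitely many cosets of the preimage of `Z`. -/
theorem IsGeometricAction.exists_finite_mul_inv_mem {H G₂ X₂ : Type*} [Group H] [Group G₂]
    [MetricSpace X₂] [MulAction G₂ X₂] [IsIsometricSMul G₂ X₂] [ProperSpace X₂]
    (hG₂ : IsGeometricAction G₂ X₂) (φ₂ : H →* G₂) {Z : Subgroup G₂} {F : Set X₂} {x₂ : X₂}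
    {R : ℝ} (hR : ∀ y ∈ F, ∃ z ∈ Z, dist (z • x₂) y ≤ R) (C : ℝ) :
    ∃ S : Set H, S.Finite ∧ ∀ h : H, (∃ y ∈ F, dist (φ₂ h • x₂) y ≤ C) →
      ∃ s ∈ S, φ₂ (h * s⁻¹) ∈ Z := by
  classical
  have hfin := hG₂.finite_setOf_dist_le x₂ x₂ (C + R)
  -- Near the flat, `φ₂ h` is an element of `Z` times one of finitely many elements; `c` picks,
  -- where possible, one preimage in `H` for each coset of `Z` that arises.
  let c : G₂ → H := fun g => if h : ∃ h : H, φ₂ h * g⁻¹ ∈ Z then h.choose else 1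
  refine ⟨c '' {g | dist (g • x₂) x₂ ≤ C + R}, hfin.image c, ?_⟩
  rintro h ⟨y, hy, hhy⟩
  obtain ⟨z, hz, hzy⟩ := hR y hy
  refine ⟨_, ⟨z⁻¹ * φ₂ h, ?_, rfl⟩, ?_⟩
  · rw [Set.mem_ofPred_eq, ← dist_smul z, smul_smul, mul_inv_cancel_left]
    linarith [dist_triangle_right (φ₂ h • x₂) (z • x₂) y]
  · have hex : ∃ h' : H, φ₂ h' * (z⁻¹ * φ₂ h)⁻¹ ∈ Z := ⟨h, by
      rwa [mul_inv_rev, mul_inv_cancel_left, inv_inv]⟩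
    have h1 : φ₂ (c (z⁻¹ * φ₂ h)) * (z⁻¹ * φ₂ h)⁻¹ ∈ Z := by
      simp only [c, hex, dif_pos]
      exact hex.choose_spec
    have h2 := mul_mem hz (inv_mem h1)
    rwa [mul_inv_rev, inv_inv, mul_assoc, mul_inv_cancel_left, ← map_inv, ← map_mul] at h2

variable {H G₁ G₂ X₁ X₂ : Type*} [Group H] [Group G₁] [Group G₂] [MetricSpace X₁] [MetricSpace X₂]
  [MulAction G₁ X₁] [MulAction G₂ X₂] [IsIsometricSMul G₁ X₁] [IsIsometricSMul G₂ X₂]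
  (hX₁ : IsCAT0 X₁) (hX₂ : IsCAT0 X₂)
  (hG₁ : IsGeometricAction G₁ X₁) (hG₂ : IsGeometricAction G₂ X₂)
  (φ₁ : H →* G₁) (φ₂ : H →* G₂)

include hG₁ hG₂

/-- Injectivity of `φ₂` makes the preimage of `Z` abelian and, as a subgroup of a finitely generated
abelian group, finitely generated; this preimage acts on both spaces. -/
theorem exists_dist_pt_le_of_comm {Z : Subgroup G₂} (hZ : ∀ a ∈ Z, ∀ b ∈ Z, a * b = b * a)
    (hZfg : Group.FG Z) (hφ₂ : Function.Injective φ₂) (x₁ : X₁) (x₂ : X₂) {M N : ℝ} (hM : 0 ≤ M)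
    (hφ : ∀ a b, dist (φ₂ a • x₂) (φ₂ b • x₂) ≤ M * dist (φ₁ a • x₁) (φ₁ b • x₁) + N) (C : ℝ) :
    ∃ D : ℝ, ∀ a b, φ₂ a ∈ Z → φ₂ b ∈ Z → ∀ t ∈ Icc (0 : ℝ) 1,
      dist (φ₁ b • x₁) (hX₁.pt x₁ (φ₁ a • x₁) t) ≤ C →
      dist (φ₂ b • x₂) (hX₂.pt x₂ (φ₂ a • x₂) t) ≤ D := by
  let K : Subgroup H := Z.comap φ₂
  let _ : CommGroup Z :=
    { (inferInstance : Group Z) with mul_comm := fun a b => Subtype.ext (hZ a a.2 b b.2) }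
  let _ : CommGroup K :=
    { (inferInstance : Group K) with
      mul_comm := fun a b => Subtype.ext (hφ₂ (by
        rw [Subgroup.coe_mul, Subgroup.coe_mul, map_mul, map_mul]
        exact hZ _ a.2 _ b.2)) }
  have hK : Group.FG K := group_fg_of_injective (φ₂.subgroupComap Z) fun a b hab =>
    Subtype.ext (hφ₂ (congrArg Subtype.val hab))
  have : Module.Finite ℤ (Additive K) :=
    Module.Finite.iff_addGroup_fg.2 (GroupFG.iff_add_fg.1 hK)
  let ι : Multiplicative (Additive K) →* H :=
    MonoidHom.mk' (fun a => (a.toAdd.toMul : K).1) fun _ _ => rfl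
  obtain ⟨D, hD⟩ := exists_dist_pt_le_of_addCommGroup hX₁ hX₂ hG₁ hG₂ (φ₁.comp ι) (φ₂.comp ι)
    x₁ x₂ hM (fun a b => hφ (ι a) (ι b)) C
  exact ⟨D, fun a b ha hb t ht h =>
    hD (.ofAdd (.ofMul ⟨a, ha⟩)) (.ofAdd (.ofMul ⟨b, hb⟩)) t ht h⟩

/-- Elements whose orbit points lie near `F` differ from the preimage of `Z` by right factors in a
finite set, which move orbit points by a bounded amount in either space. -/
theorem exists_dist_pt_le_of_near_flat [ProperSpace X₂] {𝓕 : Set (Set X₂)}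
    (h𝓕 : IsIsolatedFlatFamily 𝓕) (hφ₂ : Function.Injective φ₂) (x₁ : X₁) (x₂ : X₂)
    {M N : ℝ} (hM : 0 ≤ M)
    (hφ : ∀ a b, dist (φ₂ a • x₂) (φ₂ b • x₂) ≤ M * dist (φ₁ a • x₁) (φ₁ b • x₁) + N) (C : ℝ)
    {F : Set X₂} (hF : F ∈ 𝓕) :
    ∃ D : ℝ, ∀ b c, (∃ y ∈ F, dist (φ₂ b • x₂) y ≤ C) → (∃ y ∈ F, dist (φ₂ c • x₂) y ≤ C) →
      ∀ t ∈ Icc (0 : ℝ) 1, dist (φ₁ b • x₁) (hX₁.pt x₁ (φ₁ c • x₁) t) ≤ C →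
      dist (φ₂ b • x₂) (hX₂.pt x₂ (φ₂ c • x₂) t) ≤ D := by
  obtain ⟨Z, hZ, hZfg, R, hR⟩ := h𝓕.exists_abelian hX₂ hG₂ hF x₂
  obtain ⟨S, hS, hSZ⟩ := hG₂.exists_finite_mul_inv_mem φ₂ hR C
  obtain ⟨M₁, hM₁⟩ := (hS.image fun s => dist x₁ (φ₁ s • x₁)).bddAbove
  obtain ⟨M₂, hM₂⟩ := (hS.image fun s => dist x₂ (φ₂ s • x₂)).bddAbove
  obtain ⟨D, hD⟩ := exists_dist_pt_le_of_comm hX₁ hX₂ hG₁ hG₂ φ₁ φ₂ hZ hZfg hφ₂ x₁ x₂ hM hφ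
    (C + 2 * M₁)
  refine ⟨D + 2 * M₂, fun b c hb hc t ht hbc => ?_⟩
  obtain ⟨s, hs, hbs⟩ := hSZ b hb
  obtain ⟨u, hu, hcu⟩ := hSZ c hc
  have e1 : ∀ (b : H), ∀ s ∈ S, dist (φ₁ (b * s⁻¹) • x₁) (φ₁ b • x₁) ≤ M₁ := by
    intro b s hs
    have : dist (φ₁ (b * s⁻¹) • x₁) (φ₁ b • x₁) = dist x₁ (φ₁ s • x₁) := by
      rw [← dist_smul (φ₁ (b * s⁻¹)) x₁, smul_smul, ← map_mul, inv_mul_cancel_right]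
    rw [this]
    exact hM₁ ⟨s, hs, rfl⟩
  have e2 : ∀ (b : H), ∀ s ∈ S, dist (φ₂ (b * s⁻¹) • x₂) (φ₂ b • x₂) ≤ M₂ := by
    intro b s hs
    have : dist (φ₂ (b * s⁻¹) • x₂) (φ₂ b • x₂) = dist x₂ (φ₂ s • x₂) := by
      rw [← dist_smul (φ₂ (b * s⁻¹)) x₂, smul_smul, ← map_mul, inv_mul_cancel_right]
    rw [this]
    exact hM₂ ⟨s, hs, rfl⟩
  have hM₁0 : 0 ≤ M₁ := dist_nonneg.trans (e1 b s hs)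
  have hM₂0 : 0 ≤ M₂ := dist_nonneg.trans (e2 b s hs)
  have h1 := hX₁.dist_pt_pt_le_max (x := x₁) (x' := x₁) ht (by rwa [dist_self]) (e1 c u hu)
  have h2 := hX₂.dist_pt_pt_le_max (x := x₂) (x' := x₂) ht (by rwa [dist_self]) (e2 c u hu)
  have h3 := hD (c * u⁻¹) (b * s⁻¹) hcu hbs t ht (by
    have := dist_triangle4_right (φ₁ (b * s⁻¹) • x₁) (hX₁.pt x₁ (φ₁ (c * u⁻¹) • x₁) t)
      (φ₁ b • x₁) (hX₁.pt x₁ (φ₁ c • x₁) t)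
    linarith [e1 b s hs])
  have h4 := dist_triangle4_left (φ₂ (b * s⁻¹) • x₂) (hX₂.pt x₂ (φ₂ (c * u⁻¹) • x₂) t)
      (φ₂ b • x₂) (hX₂.pt x₂ (φ₂ c • x₂) t)
  linarith [e2 b s hs]

/-- Uniformly over all isolated flats, orbit points near a flat of `X₂` are in the same position on
geodesics in both spaces. -/
theorem exists_dist_pt_le_of_near_flats [ProperSpace X₂] {𝓕 : Set (Set X₂)}
    (h𝓕 : IsIsolatedFlatFamily 𝓕) (hφ₂ : Function.Injective φ₂) (x₁ : X₁) (x₂ : X₂)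
    {M N : ℝ} (hM : 0 ≤ M)
    (hφ : ∀ a b, dist (φ₂ a • x₂) (φ₂ b • x₂) ≤ M * dist (φ₁ a • x₁) (φ₁ b • x₁) + N) (C : ℝ) :
    ∃ D : ℝ, ∀ F ∈ 𝓕, ∀ a b c, (∃ y ∈ F, dist (φ₂ a • x₂) y ≤ C) →
      (∃ y ∈ F, dist (φ₂ b • x₂) y ≤ C) → (∃ y ∈ F, dist (φ₂ c • x₂) y ≤ C) →
      ∀ t ∈ Icc (0 : ℝ) 1, dist (φ₁ b • x₁) (hX₁.pt (φ₁ a • x₁) (φ₁ c • x₁) t) ≤ C →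
      dist (φ₂ b • x₂) (hX₂.pt (φ₂ a • x₂) (φ₂ c • x₂) t) ≤ D := by
  open scoped Pointwise in
  choose! D hD using fun F (hF : F ∈ 𝓕) =>
    exists_dist_pt_le_of_near_flat hX₁ hX₂ hG₁ hG₂ φ₁ φ₂ h𝓕 hφ₂ x₁ x₂ hM hφ C hF
  -- Translating by `a⁻¹` brings the flat within `C` of `x₂`, so finitely many constants suffice.
  obtain ⟨D', hD'⟩ := ((h𝓕.finite_near x₂ C).image D).bddAbove
  refine ⟨D', fun F hF a b c ha hb hc t ht h => ?_⟩
  set F' : Set X₂ := (φ₂ a)⁻¹ • F with hF'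
  have hmem : F' ∈ 𝓕 := h𝓕.smul_mem _ hF
  have htrans : ∀ b, (∃ y ∈ F, dist (φ₂ b • x₂) y ≤ C) →
      ∃ y ∈ F', dist (φ₂ (a⁻¹ * b) • x₂) y ≤ C := by
    rintro b ⟨y, hy, hby⟩
    refine ⟨(φ₂ a)⁻¹ • y, Set.smul_mem_smul_set hy, ?_⟩
    rwa [map_mul, map_inv, mul_smul, dist_smul]
  have h0 : ∃ y ∈ F', dist x₂ y ≤ C := by
    have := htrans a ha
    rwa [inv_mul_cancel, map_one, one_smul] at this
  have e1 : ∀ b, φ₁ a • φ₁ (a⁻¹ * b) • x₁ = φ₁ b • x₁ := fun b => by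
    rw [smul_smul, ← map_mul, mul_inv_cancel_left]
  have e2 : ∀ b, φ₂ a • φ₂ (a⁻¹ * b) • x₂ = φ₂ b • x₂ := fun b => by
    rw [smul_smul, ← map_mul, mul_inv_cancel_left]
  have h1 := hD F' hmem (a⁻¹ * b) (a⁻¹ * c) (htrans b hb) (htrans c hc) t ht (by
    rwa [← dist_smul (φ₁ a), e1, hX₁.smul_pt _ _ _ ht, e1])
  rw [← dist_smul (φ₂ a), e2, hX₂.smul_pt _ _ _ ht, e2] at h1
  exact h1.trans (hD' ⟨F', ⟨hmem, h0⟩, rfl⟩)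

end OrbitsNearFlats

end CAT0Boundary

namespace CAT0Boundary

/-! ### Divergence of geodesics from a common origin. -/

section ArcLemmas

variable {X : Type*} [MetricSpace X]

namespace IsCAT0

variable (hX : IsCAT0 X)

theorem dist_left_arc (x y : X) {s : ℝ} (hs : 0 ≤ s) : dist x (hX.arc x y s) = min s (dist x y) := by
  have := hX.dist_arc_arc x y le_rfl hs
  rwa [hX.arc_zero, min_eq_left dist_nonneg, zero_sub, abs_neg,
    abs_of_nonneg (le_min hs dist_nonneg)] at this

theorem pt_eq_arc (x y : X) {t : ℝ} (ht : t ∈ Icc (0 : ℝ) 1) :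
    hX.pt x y t = hX.arc x y (t * dist x y) := by
  rcases (dist_nonneg (x := x) (y := y)).eq_or_lt with h0 | h0
  · obtain rfl := dist_eq_zero.1 h0.symm
    rw [hX.pt_self x ht, arc, dist_self, div_zero, hX.pt_zero]
  · rw [arc, min_eq_left (mul_le_of_le_one_left dist_nonneg ht.2), mul_div_cancel_right₀ _ h0.ne']

theorem exists_arc_eq_pt (x y : X) {s : ℝ} (hs : 0 ≤ s) :
    ∃ t ∈ Icc (0 : ℝ) 1, hX.arc x y s = hX.pt x y t :=
  ⟨_, min_dist_div_mem_Icc x y hs, rfl⟩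

theorem arc_eq_pt_arc (x y : X) {s m : ℝ} (hs : 0 ≤ s) (hsm : s ≤ m) (hm : 0 < m)
    (hmd : m ≤ dist x y) : hX.arc x y s = hX.pt x (hX.arc x y m) (s / m) := by
  have h1 : s / m ∈ Icc (0 : ℝ) 1 := ⟨div_nonneg hs hm.le, div_le_one_of_le₀ hsm hm.le⟩
  refine hX.eq_pt_of_dist h1 ?_ ?_
  · rw [hX.dist_left_arc x y hs, hX.dist_left_arc x y hm.le, min_eq_left (hsm.trans hmd),
      min_eq_left hmd, div_mul_cancel₀ _ hm.ne']
  · rw [hX.dist_left_arc x y hm.le, hX.dist_arc_arc x y hm.le hs, min_eq_left (hsm.trans hmd),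
      min_eq_left hmd, sub_mul, div_mul_cancel₀ _ hm.ne', abs_of_nonneg (by linarith), one_mul]

/-- Geodesics from a common origin spread at least linearly, so a bound at time `m` improves by the
factor `s / m` at time `s`. All passages from bounded closeness to convergence rest on this. -/
theorem dist_arc_arc_le_div_mul (x y z : X) {s m : ℝ} (hs : 0 ≤ s) (hsm : s ≤ m) (hm : 0 < m)
    (hmy : m ≤ dist x y) (hmz : m ≤ dist x z) :
    dist (hX.arc x y s) (hX.arc x z s) ≤ s / m * dist (hX.arc x y m) (hX.arc x z m) := by
  rw [hX.arc_eq_pt_arc x y hs hsm hm hmy, hX.arc_eq_pt_arc x z hs hsm hm hmz]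
  exact hX.dist_pt_pt_le _ _ _ ⟨div_nonneg hs hm.le, div_le_one_of_le₀ hsm hm.le⟩

/-- If geodesics from `x` to `y` and to `z` contain points at distance at most `K` from each other,
then they are close to each other up to these points. -/
theorem dist_arc_arc_le_of_dist_pt_pt_le (x y z : X) {t t' K r : ℝ} (ht : t ∈ Icc (0 : ℝ) 1)
    (ht' : t' ∈ Icc (0 : ℝ) 1) (hK : dist (hX.pt x y t) (hX.pt x z t') ≤ K) (hr : 0 ≤ r)
    (hrt : r + K < t * dist x y) :
    r ≤ dist x y ∧ r ≤ dist x z ∧ dist (hX.arc x y r) (hX.arc x z r) ≤ 2 * K := by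
  have hK0 : 0 ≤ K := dist_nonneg.trans hK
  have h1 := hX.dist_left_pt x y ht
  have h2 := hX.dist_left_pt x z ht'
  have h3 := abs_dist_sub_le (hX.pt x y t) (hX.pt x z t') x
  rw [dist_comm _ x, dist_comm _ x, h1, h2] at h3
  replace h3 := h3.trans hK
  have h4 := abs_le.1 h3
  have hd := mul_le_of_le_one_left (dist_nonneg (x := x) (y := y)) ht.2
  have hd' := mul_le_of_le_one_left (dist_nonneg (x := x) (y := z)) ht'.2
  have h5 : r < t' * dist x z := by linarith
  refine ⟨by linarith, by linarith, ?_⟩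
  -- Pulling the farther of the two points back to the distance `m` of the nearer one costs at most
  -- `K`, which explains the bound `2 * K`.
  set m := min (t * dist x y) (t' * dist x z) with hm
  have hrm : r < m := lt_min (by linarith) h5
  have hm0 : 0 < m := hr.trans_lt hrm
  have hmy : m ≤ dist x y := (min_le_left _ _).trans hd
  have hmz : m ≤ dist x z := (min_le_right _ _).trans hd'
  have h6 := hX.dist_arc_arc_le_div_mul x y z hr hrm.le hm0 hmy hmz
  have h7 : dist (hX.arc x y m) (hX.arc x z m) ≤ 2 * K := by
    rw [hX.pt_eq_arc x y ht, hX.pt_eq_arc x z ht'] at hK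
    have e1 := hX.dist_arc_arc x y hm0.le (t := t * dist x y) (mul_nonneg ht.1 dist_nonneg)
    have e2 := hX.dist_arc_arc x z hm0.le (t := t' * dist x z) (mul_nonneg ht'.1 dist_nonneg)
    rw [min_eq_left hmy, min_eq_left hd] at e1
    rw [min_eq_left hmz, min_eq_left hd'] at e2
    have e3 := dist_triangle4 (hX.arc x y m) (hX.arc x y (t * dist x y))
      (hX.arc x z (t' * dist x z)) (hX.arc x z m)
    rw [dist_comm (hX.arc x z (t' * dist x z)), e1, e2] at e3
    have e4 : |m - t * dist x y| + |m - t' * dist x z| ≤ K := by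
      rw [hm]
      rcases le_total (t * dist x y) (t' * dist x z) with h | h
      · rw [min_eq_left h, sub_self, abs_zero, zero_add]
        exact h3
      · rw [min_eq_right h, sub_self, abs_zero, add_zero, abs_sub_comm]
        exact h3
    linarith
  refine h6.trans ((mul_le_of_le_one_left dist_nonneg ?_).trans h7)
  exact div_le_one_of_le₀ hrm.le hm0.le

end IsCAT0

end ArcLemmas

/-! ### Polygonal paths as continuous quasigeodesics. -/

section PolygonalPaths

variable {X : Type*} [MetricSpace X] (hX : IsCAT0 X)

/-- The path through the points `y 0, y 1, …` at integer times that is geodesic in between. -/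
noncomputable def IsCAT0.polygon (y : ℕ → X) (u : ℝ) : X :=
  hX.pt (y ⌊u⌋₊) (y (⌊u⌋₊ + 1)) (u - ⌊u⌋₊)

namespace IsCAT0

theorem sub_floor_mem_Icc {u : ℝ} (hu : 0 ≤ u) : u - ⌊u⌋₊ ∈ Icc (0 : ℝ) 1 :=
  ⟨sub_nonneg.2 (Nat.floor_le hu), by linarith [(Nat.lt_floor_add_one u)]⟩

theorem polygon_natCast (y : ℕ → X) (i : ℕ) : hX.polygon y i = y i := by
  rw [polygon, Nat.floor_natCast, sub_self, hX.pt_zero]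

variable {y : ℕ → X} {M : ℝ} (hy : ∀ i, dist (y i) (y (i + 1)) ≤ M)
include hy

theorem dist_polygon_floor_le {u : ℝ} (hu : 0 ≤ u) :
    dist (y ⌊u⌋₊) (hX.polygon y u) ≤ M * (u - ⌊u⌋₊) := by
  have h := sub_floor_mem_Icc hu
  rw [polygon, hX.dist_left_pt _ _ h, mul_comm]
  exact mul_le_mul_of_nonneg_right (hy _) h.1

theorem dist_polygon_le {u v : ℝ} (hu : 0 ≤ u) (huv : u ≤ v) :
    dist (hX.polygon y u) (hX.polygon y v) ≤ M * (v - u) := by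
  have hv := hu.trans huv
  have h1 := sub_floor_mem_Icc hu
  have h2 := sub_floor_mem_Icc hv
  have hM : 0 ≤ M := dist_nonneg.trans (hy 0)
  rcases (Nat.floor_le_floor huv).eq_or_lt with h | h
  · rw [polygon, polygon, ← h]
    rw [← h] at h2
    rw [hX.dist_pt_pt _ _ h1 h2, mul_comm]
    refine mul_le_mul (hy _) (le_of_eq ?_) (abs_nonneg _) hM
    rw [abs_sub_comm, abs_of_nonneg] <;> linarith
  · have e1 : dist (hX.polygon y u) (y (⌊u⌋₊ + 1)) ≤ (1 - (u - ⌊u⌋₊)) * M := by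
      rw [polygon, hX.dist_pt_right _ _ h1]
      exact mul_le_mul_of_nonneg_left (hy _) (by linarith [h1.2])
    have e2 : dist (y (⌊u⌋₊ + 1)) (y ⌊v⌋₊) ≤ M * ((⌊v⌋₊ : ℝ) - (⌊u⌋₊ + 1)) := by
      have := dist_le_Ico_sum_of_dist_le (f := y) (d := fun _ => M) (Nat.succ_le_of_lt h)
        (fun _ _ => hy _)
      rw [Finset.sum_const, Nat.card_Ico, nsmul_eq_mul, Nat.cast_sub (Nat.succ_le_of_lt h)] at this
      refine this.trans (le_of_eq ?_)
      push_cast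
      ring
    have e3 := hX.dist_polygon_floor_le hy hv
    have e4 := dist_triangle4 (hX.polygon y u) (y (⌊u⌋₊ + 1)) (y ⌊v⌋₊) (hX.polygon y v)
    linarith

theorem dist_polygon_le_mul_abs {u v : ℝ} (hu : 0 ≤ u) (hv : 0 ≤ v) :
    dist (hX.polygon y u) (hX.polygon y v) ≤ M * |u - v| := by
  rcases le_total u v with h | h
  · rw [abs_sub_comm, abs_of_nonneg (sub_nonneg.2 h)]
    exact hX.dist_polygon_le hy hu h
  · rw [abs_of_nonneg (sub_nonneg.2 h), dist_comm]
    exact hX.dist_polygon_le hy hv h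

/-- Rounding times down to integers costs `1` in the time difference and `M` at each of the two
points, hence the constant `ε + 1 + 2 * M`. -/
theorem isQuasigeodesic_polygon {lam ε : ℝ} (hlam : 1 ≤ lam) (hM : M ≤ lam) {N : ℕ}
    (hε : 0 ≤ ε)
    (hlow : ∀ i ≤ N, ∀ j ≤ N, 1 / lam * |(i : ℝ) - j| - ε ≤ dist (y i) (y j)) :
    IsQuasigeodesic lam (ε + 1 + 2 * M) N (hX.polygon y) where
  nonneg := N.cast_nonneg
  cont := by
    have : LipschitzOnWith (Real.toNNReal M) (hX.polygon y) (Icc 0 N) :=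
      LipschitzOnWith.of_dist_le_mul fun u hu v hv => by
        rw [Real.coe_toNNReal _ (dist_nonneg.trans (hy 0)), Real.dist_eq]
        exact hX.dist_polygon_le_mul_abs hy hu.1 hv.1
    exact this.continuousOn
  lower := by
    intro u hu v hv
    have hM0 : 0 ≤ M := dist_nonneg.trans (hy 0)
    have h1 := sub_floor_mem_Icc hu.1
    have h2 := sub_floor_mem_Icc hv.1
    have h3 := hlow _ (Nat.floor_le_of_le hu.2) _ (Nat.floor_le_of_le hv.2)
    have h4 := hX.dist_polygon_floor_le hy hu.1
    have h5 := hX.dist_polygon_floor_le hy hv.1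
    have h6 := dist_triangle4 (y ⌊u⌋₊) (hX.polygon y u) (hX.polygon y v) (y ⌊v⌋₊)
    rw [dist_comm (hX.polygon y v)] at h6
    have h7 : M * (u - ⌊u⌋₊) ≤ M := mul_le_of_le_one_right hM0 h1.2
    have h8 : M * (v - ⌊v⌋₊) ≤ M := mul_le_of_le_one_right hM0 h2.2
    have h9 : |u - v| ≤ |(⌊u⌋₊ : ℝ) - ⌊v⌋₊| + 1 := by
      have e : u - v = ((⌊u⌋₊ : ℝ) - ⌊v⌋₊) + ((u - ⌊u⌋₊) - (v - ⌊v⌋₊)) := by ring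
      rw [e]
      refine (abs_add_le _ _).trans (add_le_add le_rfl (abs_le.2 ⟨?_, ?_⟩)) <;>
        linarith [h1.1, h1.2, h2.1, h2.2]
    have h10 : 1 / lam * |u - v| ≤ 1 / lam * |(⌊u⌋₊ : ℝ) - ⌊v⌋₊| + 1 := by
      have hl : 1 / lam ≤ 1 := div_le_one_of_le₀ hlam (by linarith)
      have hl0 : 0 ≤ 1 / lam := by positivity
      nlinarith
    linarith
  upper := by
    intro u hu v hv
    have hM0 : 0 ≤ M := dist_nonneg.trans (hy 0)
    refine (hX.dist_polygon_le_mul_abs hy hu.1 hv.1).trans ?_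
    have : M * |u - v| ≤ lam * |u - v| := by gcongr
    linarith

end IsCAT0

theorem IsGeodesic.isQuasigeodesic {γ : ℝ → X} {x y : X} (h : IsGeodesic γ x y) {lam ε : ℝ}
    (hlam : 1 ≤ lam) (hε : 0 ≤ ε) : IsQuasigeodesic lam ε (dist x y) γ where
  nonneg := dist_nonneg
  cont := by
    have : LipschitzOnWith 1 γ (Icc 0 (dist x y)) :=
      LipschitzOnWith.of_dist_le_mul fun u hu v hv => by
        rw [h.isom u hu v hv, Real.dist_eq, NNReal.coe_one, one_mul]
    exact this.continuousOn
  lower := by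
    intro s hs t ht
    rw [h.isom s hs t ht]
    have := mul_le_of_le_one_left (abs_nonneg (s - t)) (div_le_one_of_le₀ hlam (by linarith))
    linarith
  upper := by
    intro s hs t ht
    rw [h.isom s hs t ht]
    have := le_mul_of_one_le_left (abs_nonneg (s - t)) hlam
    linarith

end PolygonalPaths

/-! ### The partitions occurring in relative fellow travelling. -/

section Partitions

theorem partition_cover {n : ℕ} {t s : ℕ → ℝ} {x : ℝ} (h0 : t 0 ≤ x) (hn : x ≤ s n) :
    (∃ j ≤ n, x ∈ Icc (t j) (s j)) ∨ ∃ j < n, x ∈ Icc (s j) (t (j + 1)) := by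
  induction n with
  | zero => exact Or.inl ⟨0, le_rfl, h0, hn⟩
  | succ n ih =>
    rcases le_total x (s n) with h | h
    · rcases ih h with ⟨j, hj, hx⟩ | ⟨j, hj, hx⟩
      · exact Or.inl ⟨j, hj.trans n.le_succ, hx⟩
      · exact Or.inr ⟨j, hj.trans n.lt_succ_self, hx⟩
    · rcases le_total x (t (n + 1)) with h' | h'
      · exact Or.inr ⟨n, n.lt_succ_self, h, h'⟩
      · exact Or.inl ⟨n + 1, le_rfl, h', hn⟩

theorem partition_bounds {n : ℕ} {t s : ℕ → ℝ} (hts : ∀ i ≤ n, t i ≤ s i)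
    (hst : ∀ i < n, s i ≤ t (i + 1)) {j : ℕ} (hj : j ≤ n) : t 0 ≤ t j ∧ s j ≤ s n := by
  constructor
  · induction j with
    | zero => exact le_rfl
    | succ j ih =>
      exact (ih (by omega)).trans ((hts j (by omega)).trans (hst j (by omega)))
  · induction n with
    | zero => rw [Nat.le_zero.1 hj]
    | succ n ih =>
      rcases hj.eq_or_lt with rfl | h
      · exact le_rfl
      · exact (ih (fun i hi => hts i (by omega)) (fun i hi => hst i (by omega)) (by omega)).trans
          ((hst n (by omega)).trans (hts (n + 1) le_rfl))

end Partitions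

end CAT0Boundary

namespace CAT0Boundary

/-! ### Images of geodesics under the isomorphism. -/

section EquivariantImages

theorem exists_dist_lt_of_hausdorffEDist_le {X : Type*} [MetricSpace X] {s t : Set X} {L : ℝ}
    (hL : 0 ≤ L) (h : Metric.hausdorffEDist s t ≤ ENNReal.ofReal L) {x : X} (hx : x ∈ s) :
    ∃ y ∈ t, dist x y < L + 1 := by
  have h1 : Metric.hausdorffEDist s t < ENNReal.ofReal (L + 1) :=
    h.trans_lt ((ENNReal.ofReal_lt_ofReal_iff (by linarith)).2 (by linarith))
  obtain ⟨y, hy, hxy⟩ := Metric.exists_edist_lt_of_hausdorffEDist_lt hx h1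
  refine ⟨y, hy, ?_⟩
  rwa [edist_dist, ENNReal.ofReal_lt_ofReal_iff (by linarith)] at hxy

theorem exists_dist_lt_of_mem_cthickening {X : Type*} [MetricSpace X] {s : Set X} {δ : ℝ}
    (hδ : 0 ≤ δ) {x : X} (hx : x ∈ Metric.cthickening δ s) : ∃ y ∈ s, dist x y < δ + 1 :=
  Metric.mem_thickening_iff.1
    (Metric.cthickening_subset_thickening' (by linarith) (lt_add_one δ) _ hx)

theorem IsCAT0.exists_arc_eq_pt_arc_arc {X : Type*} [MetricSpace X] (hX : IsCAT0 X) (x y : X)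
    {s u v : ℝ} (hs : 0 ≤ s) (hsu : s ≤ u) (huv : u ≤ v) :
    ∃ t ∈ Icc (0 : ℝ) 1, hX.arc x y u = hX.pt (hX.arc x y s) (hX.arc x y v) t := by
  have e1 := IsCAT0.min_dist_div_mem_Icc x y hs
  have e2 := IsCAT0.min_dist_div_mem_Icc x y (hs.trans (hsu.trans huv))
  have h1 : min s (dist x y) / dist x y ≤ min u (dist x y) / dist x y := by gcongr
  have h2 : min u (dist x y) / dist x y ≤ min v (dist x y) / dist x y := by gcongr
  rcases (h1.trans h2).eq_or_lt with h | h
  · refine ⟨0, ⟨le_rfl, zero_le_one⟩, ?_⟩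
    rw [hX.pt_zero, arc, arc, le_antisymm (h2.trans h.symm.le) h1]
  · set a := min s (dist x y) / dist x y
    set b := min u (dist x y) / dist x y
    set c := min v (dist x y) / dist x y
    have hca : 0 < c - a := by linarith
    have ht : (b - a) / (c - a) ∈ Icc (0 : ℝ) 1 :=
      ⟨div_nonneg (by linarith) hca.le, div_le_one_of_le₀ (by linarith) hca.le⟩
    refine ⟨_, ht, ?_⟩
    rw [arc, arc, arc, hX.pt_pt x y e1 e2 ht]
    congr 1
    field_simp
    ring

variable {G₁ G₂ X₁ X₂ : Type*} [Group G₁] [Group G₂] [MetricSpace X₁] [MetricSpace X₂]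
  [MulAction G₁ X₁] [MulAction G₂ X₂] [IsIsometricSMul G₁ X₁] [IsIsometricSMul G₂ X₂]
  (hX₁ : IsCAT0 X₁) (hX₂ : IsCAT0 X₂)
  (hG₁ : IsGeometricAction G₁ X₁) (hG₂ : IsGeometricAction G₂ X₂)
  {H : Subgroup G₁} {φ : H →* G₂}

include hG₁ hG₂

/-- The image chain spans a quasigeodesic, compared with the geodesic through relative fellow
travelling. On the flat pieces, where nothing is known of the path itself, the affine control near
flats locates `φ (a i) • x₂` between the two ends of the piece, and these ends do fellow travel. -/
theorem exists_dist_orbit_chain_le (hflat : HasIsolatedFlats X₂) (hrftp : HasRFTP X₂)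
    (hφinj : Function.Injective φ) (x₁ : X₁) (x₂ : X₂) {M : ℝ} (hM : 1 ≤ M)
    (hφ : ∀ a b, dist (φ a • x₂) (φ b • x₂) ≤ M * dist (a • x₁) (b • x₁) + 2 * M)
    (hφ' : ∀ a b, dist (a • x₁) (b • x₁) ≤ M * dist (φ a • x₂) (φ b • x₂) + 2 * M)
    {ν : ℝ} (hν : 0 ≤ ν) :
    ∃ D : ℝ, ∀ (h : H) (a : ℕ → H), a 0 = 1 →
      (∀ i : ℕ, dist x₁ (h • x₁) + 1 ≤ i → a i = h) →
      (∀ i : ℕ, dist (a i • x₁) (hX₁.arc x₁ (h • x₁) i) ≤ ν) →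
      ∀ i : ℕ, i ≤ dist x₁ (h • x₁) + 1 →
        ∃ t ∈ Icc (0 : ℝ) 1, dist (φ (a i) • x₂) (hX₂.pt x₂ (φ h • x₂) t) ≤ D := by
  have := hG₂.properSpace hX₂
  obtain ⟨𝓕, h𝓕⟩ := hflat.exists_family
  obtain ⟨B, hB⟩ := h𝓕.maximal
  have hM0 : 0 < M := by linarith
  set m := M * (2 * ν + 1) + 2 * M with hm
  have hm0 : 0 ≤ m := by positivity
  set lam := max M m with hlam
  have hlam1 : 1 ≤ lam := hM.trans (le_max_left _ _)
  have hε0 : 0 ≤ 2 * ν + 4 := by linarith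
  obtain ⟨L, hL, hrftp⟩ := hrftp lam (2 * ν + 4 + 1 + 2 * m) hlam1 (by positivity)
  -- The first entry bounds the distance in `X₂` of image points to a flat of the family, the second
  -- the distance in `X₁` of a chain point to the geodesic between two others.
  set C := max (L + 1 + (max B 0 + 1)) (2 * ν) with hC
  obtain ⟨D, hD⟩ := exists_dist_pt_le_of_near_flats hX₁ hX₂ hG₁ hG₂ H.subtype φ h𝓕 hφinj x₁ x₂
    hM0.le hφ C
  refine ⟨max (L + 1) (D + (m + (L + 1))), fun h a ha0 ha1 ha2 i hi => ?_⟩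
  set d := dist x₁ (h • x₁) with hd
  have hd0 : 0 ≤ d := dist_nonneg
  -- Then `d + 1 ≤ N ≤ d + 2`: the chain has reached `h`, and the lower distance bound still
  -- applies.
  set N := ⌈d⌉₊ + 1 with hN
  have hNd : d + 1 ≤ N := by
    rw [hN]
    push_cast
    linarith [Nat.le_ceil d]
  have hNd' : (N : ℝ) ≤ d + 2 := by
    rw [hN]
    push_cast
    linarith [Nat.ceil_lt_add_one hd0]
  have hiN : (i : ℝ) ≤ N := hi.trans hNd
  set y : ℕ → X₂ := fun i => φ (a i) • x₂ with hy
  have hstep : ∀ i, dist (y i) (y (i + 1)) ≤ m := fun i =>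
    (hφ _ _).trans (by rw [hm]; gcongr; exact dist_orbit_chain_succ_le ha2 i)
  have hlow : ∀ i ≤ N, ∀ j ≤ N, 1 / lam * |(i : ℝ) - j| - (2 * ν + 4) ≤ dist (y i) (y j) := by
    intro i hi j hj
    have h1 := sub_le_dist_orbit_chain ha2 (i := i) (j := j)
      ((Nat.cast_le.2 hi).trans hNd') ((Nat.cast_le.2 hj).trans hNd')
    have h2 := h1.trans (hφ' (a i) (a j))
    have h3 : 1 / lam * |(i : ℝ) - j| ≤ 1 / M * |(i : ℝ) - j| := by
      gcongr
      exact le_max_left _ _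
    have h4 : 1 / M * |(i : ℝ) - j| ≤ 1 / M * (M * dist (y i) (y j) + 2 * M + (2 * ν + 2)) := by
      gcongr
      linarith
    have h5 : 1 / M * (M * dist (y i) (y j) + 2 * M + (2 * ν + 2)) =
        dist (y i) (y j) + 2 + 1 / M * (2 * ν + 2) := by
      field_simp
    have h6 : 1 / M * (2 * ν + 2) ≤ 2 * ν + 2 :=
      mul_le_of_le_one_left (by positivity) (div_le_one_of_le₀ hM hM0.le)
    linarith
  obtain ⟨σ, hσ⟩ := hX₂.geodesic x₂ (φ h • x₂)
  have hy0 : hX₂.polygon y 0 = x₂ := by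
    have := hX₂.polygon_natCast y 0
    rw [Nat.cast_zero] at this
    rw [this, hy]
    simp [ha0]
  have hyN : hX₂.polygon y N = φ h • x₂ := by
    rw [hX₂.polygon_natCast, hy]
    simp only
    rw [ha1 N hNd]
  obtain ⟨n, F, hF, t, s, t', s', ⟨ht0, hsn, hts, hst⟩, ⟨ht0', hsn', hts', hst'⟩, hhaus, hnear⟩ :=
    hrftp N (hX₂.polygon y) (dist x₂ (φ h • x₂)) σ
      (hX₂.isQuasigeodesic_polygon hstep hlam1 (le_max_right _ _) hε0 hlow)
      (hσ.isQuasigeodesic hlam1 (by positivity))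
      (hy0.trans hσ.source.symm) (hyN.trans hσ.target.symm)
  have hclose : ∀ j ≤ n, ∀ u ∈ Icc (t j) (s j),
      ∃ w ∈ Icc (0 : ℝ) 1, dist (hX₂.polygon y u) (hX₂.pt x₂ (φ h • x₂) w) ≤ L + 1 := by
    intro j hj u hu
    obtain ⟨_, ⟨w, hw, rfl⟩, hwu⟩ := exists_dist_lt_of_hausdorffEDist_le hL (hhaus j hj)
      (mem_image_of_mem _ hu)
    obtain ⟨b1, b2⟩ := partition_bounds hts' hst' hj
    have hw' : w ∈ Icc 0 (dist x₂ (φ h • x₂)) :=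
      ⟨(ht0'.symm.le.trans b1).trans hw.1, (hw.2.trans b2).trans hsn'.le⟩
    refine ⟨w / dist x₂ (φ h • x₂), ⟨div_nonneg hw'.1 dist_nonneg,
      div_le_one_of_le₀ hw'.2 dist_nonneg⟩, ?_⟩
    rw [← hX₂.geodesic_eq_pt_div hσ hw']
    exact hwu.le
  have hyi : ∀ i : ℕ, φ (a i) • x₂ = hX₂.polygon y i := fun i => (hX₂.polygon_natCast y i).symm
  rcases partition_cover (ht0.le.trans i.cast_nonneg) (hiN.trans hsn.symm.le) with
    ⟨j, hj, hij⟩ | ⟨j, hj, hij⟩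
  · obtain ⟨w, hw, h1⟩ := hclose j hj i hij
    exact ⟨w, hw, by rw [hyi]; exact h1.trans (le_max_left _ _)⟩
  · have hsj0 : 0 ≤ s j := by
      obtain ⟨b1, -⟩ := partition_bounds hts hst hj.le
      linarith [hts j hj.le]
    have htj0 : 0 ≤ t (j + 1) := hsj0.trans (hij.1.trans hij.2)
    -- The outermost integer times of the flat piece; only at integer times is the path at orbit
    -- points.
    set i₁ := ⌈s j⌉₊ with hi₁
    set i₂ := ⌊t (j + 1)⌋₊ with hi₂
    have hi1 : i₁ ≤ i := Nat.ceil_le.2 hij.1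
    have hi2 : i ≤ i₂ := Nat.le_floor hij.2
    have b1 : s j ≤ i₁ := Nat.le_ceil _
    have b2 : (i₂ : ℝ) ≤ t (j + 1) := Nat.floor_le htj0
    have b3 : (i₁ : ℝ) ≤ i := Nat.cast_le.2 hi1
    have b4 : (i : ℝ) ≤ i₂ := Nat.cast_le.2 hi2
    -- The flats of the fellow traveller property are arbitrary; maximality replaces them by members
    -- of the isolated family.
    obtain ⟨F', hF', hFF'⟩ := hB (F j) (hF j hj)
    have hnearF : ∀ k : ℕ, (k : ℝ) ∈ Icc (s j) (t (j + 1)) →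
        ∃ z ∈ F', dist (φ (a k) • x₂) z ≤ C := by
      intro k hk
      obtain ⟨z, hz, hkz⟩ := exists_dist_lt_of_mem_cthickening hL
        ((hnear j hj).1 (mem_image_of_mem _ hk))
      obtain ⟨z', hz', hzz'⟩ := exists_dist_lt_of_mem_cthickening (le_max_right B 0)
        (Metric.cthickening_mono (le_max_left B 0) _ (hFF' hz))
      refine ⟨z', hz', ?_⟩
      rw [hyi]
      refine le_trans ?_ (le_max_left _ _)
      linarith [dist_triangle (hX₂.polygon y k) z z']
    obtain ⟨τ, hτ, harc⟩ := hX₁.exists_arc_eq_pt_arc_arc x₁ (h • x₁) i₁.cast_nonneg b3 b4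
    have h1 := hD F' hF' (a i₁) (a i) (a i₂) (hnearF i₁ ⟨b1, b3.trans hij.2⟩) (hnearF i hij)
      (hnearF i₂ ⟨hij.1.trans b4, b2⟩) τ hτ (by
        have e1 := hX₁.dist_pt_pt_le_max hτ (ha2 i₁) (ha2 i₂)
        rw [← harc] at e1
        have e2 := dist_triangle_right (a i • x₁) (hX₁.pt (a i₁ • x₁) (a i₂ • x₁) τ)
          (hX₁.arc x₁ (h • x₁) i)
        refine le_trans ?_ (le_max_right _ _)
        exact e2.trans (by linarith [ha2 i]))
    obtain ⟨w₁, hw₁, e1⟩ := hclose j hj.le (s j) ⟨hts j hj.le, le_rfl⟩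
    obtain ⟨w₂, hw₂, e2⟩ := hclose (j + 1) hj (t (j + 1)) ⟨le_rfl, hts (j + 1) hj⟩
    have e3 : dist (hX₂.polygon y i₁) (hX₂.polygon y (s j)) ≤ m := by
      refine (hX₂.dist_polygon_le_mul_abs hstep i₁.cast_nonneg hsj0).trans ?_
      refine mul_le_of_le_one_right hm0 ?_
      rw [abs_of_nonneg (sub_nonneg.2 b1)]
      linarith [Nat.ceil_lt_add_one hsj0]
    have e4 : dist (hX₂.polygon y i₂) (hX₂.polygon y (t (j + 1))) ≤ m := by
      refine (hX₂.dist_polygon_le_mul_abs hstep i₂.cast_nonneg htj0).trans ?_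
      refine mul_le_of_le_one_right hm0 ?_
      rw [abs_sub_comm, abs_of_nonneg (sub_nonneg.2 b2)]
      linarith [Nat.lt_floor_add_one (t (j + 1))]
    have e5 : dist (φ (a i₁) • x₂) (hX₂.pt x₂ (φ h • x₂) w₁) ≤ m + (L + 1) := by
      rw [hyi]
      exact (dist_triangle _ _ _).trans (add_le_add e3 e1)
    have e6 : dist (φ (a i₂) • x₂) (hX₂.pt x₂ (φ h • x₂) w₂) ≤ m + (L + 1) := by
      rw [hyi]
      exact (dist_triangle _ _ _).trans (add_le_add e4 e2)
    -- The ends `i₁`, `i₂` are near points `w₁`, `w₂` of the target geodesic, so by convexity the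
    -- point at `τ` between them is near its point at `(1 - τ) * w₁ + τ * w₂`.
    have e7 := hX₂.dist_pt_pt_le_max hτ e5 e6
    rw [hX₂.pt_pt _ _ hw₁ hw₂ hτ] at e7
    refine ⟨(1 - τ) * w₁ + τ * w₂, ?_, ?_⟩
    · obtain ⟨c1, c2⟩ := hτ
      obtain ⟨c3, c4⟩ := hw₁
      obtain ⟨c5, c6⟩ := hw₂
      constructor <;> nlinarith
    · refine le_trans ?_ (le_max_right _ _)
      exact (dist_triangle _ _ _).trans (add_le_add h1 e7)

/-- An isomorphism of quasiconvex subgroups maps orbit points near a geodesic to orbit points near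
the geodesic between the images of its endpoints. -/
theorem exists_dist_map_smul_pt_le (hflat : HasIsolatedFlats X₂) (hrftp : HasRFTP X₂)
    (hφinj : Function.Injective φ) (x₁ : X₁) (x₂ : X₂) {M : ℝ} (hM : 1 ≤ M)
    (hφ : ∀ a b, dist (φ a • x₂) (φ b • x₂) ≤ M * dist (a • x₁) (b • x₁) + 2 * M)
    (hφ' : ∀ a b, dist (a • x₁) (b • x₁) ≤ M * dist (φ a • x₂) (φ b • x₂) + 2 * M)
    (hq : IsQuasiconvex (MulAction.orbit H x₁)) (C : ℝ) :
    ∃ D : ℝ, ∀ h k : H, (∃ t ∈ Icc (0 : ℝ) 1, dist (k • x₁) (hX₁.pt x₁ (h • x₁) t) ≤ C) →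
      ∃ t ∈ Icc (0 : ℝ) 1, dist (φ k • x₂) (hX₂.pt x₂ (φ h • x₂) t) ≤ D := by
  obtain ⟨ν, hν, hnear⟩ := hq.exists_dist_smul_pt_le hX₁
  obtain ⟨D, hD⟩ := exists_dist_orbit_chain_le hX₁ hX₂ hG₁ hG₂ hflat hrftp hφinj x₁ x₂ hM hφ hφ' hν
  refine ⟨M * (C + 1 + ν) + 2 * M + D, ?_⟩
  rintro h k ⟨t, ht, hk⟩
  obtain ⟨a, ha0, ha1, ha2⟩ := exists_orbit_chain hX₁ hν hnear h
  set d := dist x₁ (h • x₁) with hd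
  have htd : 0 ≤ t * d := mul_nonneg ht.1 dist_nonneg
  set i := ⌊t * d⌋₊ with hi
  have hid : (i : ℝ) ≤ t * d := Nat.floor_le htd
  have htd' : t * d ≤ d := mul_le_of_le_one_left dist_nonneg ht.2
  obtain ⟨w, hw, h1⟩ := hD h a ha0 ha1 ha2 i (by linarith)
  refine ⟨w, hw, ?_⟩
  rw [hX₁.pt_eq_arc _ _ ht] at hk
  have h2 : dist (hX₁.arc x₁ (h • x₁) (t * d)) (hX₁.arc x₁ (h • x₁) i) ≤ 1 := by
    rw [hX₁.dist_arc_arc _ _ htd i.cast_nonneg, min_eq_left htd', min_eq_left (hid.trans htd'),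
      abs_of_nonneg (sub_nonneg.2 hid)]
    linarith [Nat.lt_floor_add_one (t * d)]
  have h3 := dist_triangle4_right (k • x₁) (a i • x₁) (hX₁.arc x₁ (h • x₁) (t * d))
    (hX₁.arc x₁ (h • x₁) i)
  have h4 : dist (k • x₁) (a i • x₁) ≤ C + 1 + ν := by
    have := dist_triangle4 (k • x₁) (hX₁.arc x₁ (h • x₁) (t * d)) (hX₁.arc x₁ (h • x₁) i) (a i • x₁)
    have := ha2 i
    rw [dist_comm] at this
    linarith
  have h5 := hφ k (a i)
  have h6 : M * dist (k • x₁) (a i • x₁) ≤ M * (C + 1 + ν) := by gcongr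
  linarith [dist_triangle (φ k • x₂) (φ (a i) • x₂) (hX₂.pt x₂ (φ h • x₂) w)]

/-- If two geodesics between orbit points stay close for a long time in `X₁`, then so do the
corresponding geodesics in `X₂`. -/
theorem exists_dist_arc_arc_le (hflat : HasIsolatedFlats X₂) (hrftp : HasRFTP X₂)
    (hφinj : Function.Injective φ) (x₁ : X₁) (x₂ : X₂) {M : ℝ} (hM : 1 ≤ M)
    (hφ : ∀ a b, dist (φ a • x₂) (φ b • x₂) ≤ M * dist (a • x₁) (b • x₁) + 2 * M)
    (hφ' : ∀ a b, dist (a • x₁) (b • x₁) ≤ M * dist (φ a • x₂) (φ b • x₂) + 2 * M)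
    (hq : IsQuasiconvex (MulAction.orbit H x₁)) :
    ∃ K : ℝ, ∀ r : ℝ, 0 ≤ r → ∃ R : ℝ, 0 ≤ R ∧ ∀ h h' : H, R ≤ dist x₁ (h • x₁) →
      R ≤ dist x₁ (h' • x₁) →
      dist (hX₁.arc x₁ (h • x₁) R) (hX₁.arc x₁ (h' • x₁) R) ≤ 3 →
      r ≤ dist x₂ (φ h • x₂) ∧ r ≤ dist x₂ (φ h' • x₂) ∧
      dist (hX₂.arc x₂ (φ h • x₂) r) (hX₂.arc x₂ (φ h' • x₂) r) ≤ K := by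
  obtain ⟨ν, hν, hnear⟩ := hq.exists_dist_smul_pt_le hX₁
  obtain ⟨D, hD⟩ := exists_dist_map_smul_pt_le hX₁ hX₂ hG₁ hG₂ hflat hrftp hφinj x₁ x₂ hM hφ hφ' hq
    (ν + 3)
  -- `R` is large enough that an orbit point `k • x₁` within `ν` of distance `R` has image at
  -- distance at least `r + 3 * |D| + 1` from `x₂`. That image is within `D` of both geodesics,
  -- which are therefore `2 * D`-close beyond time `r`.
  refine ⟨2 * (2 * D), fun r hr => ⟨M * (r + 3 * |D| + 1) + 2 * M + ν, by positivity, ?_⟩⟩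
  intro h h' hR hR' hRR'
  set R := M * (r + 3 * |D| + 1) + 2 * M + ν with hRdef
  have hR0 : 0 ≤ R := by positivity
  obtain ⟨t, ht, e1⟩ := hX₁.exists_arc_eq_pt x₁ (h • x₁) hR0
  obtain ⟨t', ht', e1'⟩ := hX₁.exists_arc_eq_pt x₁ (h' • x₁) hR0
  obtain ⟨k, hk⟩ := hnear 1 h t ht
  rw [one_smul, ← e1] at hk
  obtain ⟨w, hw, h1⟩ := hD h k ⟨t, ht, by rw [← e1]; linarith⟩
  obtain ⟨w', hw', h2⟩ := hD h' k ⟨t', ht', by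
    rw [← e1']
    linarith [dist_triangle (k • x₁) (hX₁.arc x₁ (h • x₁) R) (hX₁.arc x₁ (h' • x₁) R)]⟩
  have h3 : R - ν ≤ dist x₁ (k • x₁) := by
    have := hX₁.dist_left_arc x₁ (h • x₁) hR0
    rw [min_eq_left hR] at this
    linarith [dist_triangle x₁ (k • x₁) (hX₁.arc x₁ (h • x₁) R)]
  have h4 := hφ' 1 k
  rw [one_smul, map_one, one_smul] at h4
  have h5 : r + 3 * |D| + 1 ≤ dist x₂ (φ k • x₂) := by
    refine le_of_mul_le_mul_left ?_ (show 0 < M by linarith)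
    linarith
  have hD0 : D ≤ |D| := le_abs_self D
  have h6 := hX₂.dist_left_pt x₂ (φ h • x₂) hw
  have h7 := dist_triangle_right x₂ (φ k • x₂) (hX₂.pt x₂ (φ h • x₂) w)
  refine hX₂.dist_arc_arc_le_of_dist_pt_pt_le x₂ _ _ hw hw' ?_ hr ?_
  · linarith [dist_triangle_left (hX₂.pt x₂ (φ h • x₂) w) (hX₂.pt x₂ (φ h' • x₂) w') (φ k • x₂)]
  · linarith

end EquivariantImages

end CAT0Boundary

namespace CAT0Boundary

/-! ### Limits of geodesics and asymptotic rays. -/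

section Rays

variable {X : Type*} [MetricSpace X]

theorem Ray.dist_eq (c : Ray X) (s t : ℝ≥0) : dist (c.1 s) (c.1 t) = |(s : ℝ) - t| := by
  rw [c.2.dist_eq, NNReal.dist_eq]

theorem Ray.dist_zero (c : Ray X) (t : ℝ≥0) : dist (c.1 0) (c.1 t) = t := by
  rw [c.dist_eq, NNReal.coe_zero, zero_sub, abs_neg, abs_of_nonneg t.coe_nonneg]

theorem endpoint_eq_iff {c c' : Ray X} :
    c.endpoint = c'.endpoint ↔ ∃ K : ℝ, ∀ t : ℝ≥0, dist (c.1 t) (c'.1 t) ≤ K :=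
  Quotient.eq (r := asymptoticSetoid X)

namespace IsCAT0

variable (hX : IsCAT0 X)

theorem arc_ray (c : Ray X) {s t : ℝ≥0} (hst : s ≤ t) : hX.arc (c.1 0) (c.1 t) s = c.1 s := by
  rcases eq_or_ne t 0 with rfl | ht
  · obtain rfl : s = 0 := le_antisymm hst bot_le
    rw [NNReal.coe_zero, hX.arc_zero]
  · have ht' : (0 : ℝ) < t := NNReal.coe_pos.2 (pos_iff_ne_zero.2 ht)
    have hst' : (s : ℝ) ≤ t := NNReal.coe_le_coe.2 hst
    rw [arc, c.dist_zero, min_eq_left hst']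
    symm
    refine hX.eq_pt_of_dist ⟨div_nonneg s.coe_nonneg t.coe_nonneg, div_le_one_of_le₀ hst' t.coe_nonneg⟩ ?_ ?_
    · rw [c.dist_zero, c.dist_zero, div_mul_cancel₀ _ ht'.ne']
    · rw [c.dist_eq, c.dist_zero, sub_mul, div_mul_cancel₀ _ ht'.ne', one_mul,
        abs_of_nonneg (sub_nonneg.2 hst')]

theorem geodesic_eq_arc {γ : ℝ → X} {x y : X} (h : IsGeodesic γ x y) {s : ℝ}
    (hs : s ∈ Icc 0 (dist x y)) : γ s = hX.arc x y s := by
  rw [hX.geodesic_eq_pt_div h hs, arc, min_eq_left hs.2]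

/-- The geodesics from the origin of the ray `c` to the points `x n` converge to `c`. -/
def TendsToRay (x : ℕ → X) (c : Ray X) : Prop :=
  ∀ (r : ℝ≥0) (ε : ℝ), 0 < ε → ∀ᶠ n in atTop,
    (r : ℝ) < dist (c.1 0) (x n) ∧ dist (hX.arc (c.1 0) (x n) r) (c.1 r) < ε

theorem convergesToBoundary_iff_exists {x : ℕ → X} {ξ : VisualBoundary X} :
    ConvergesToBoundary x ξ ↔ ∃ c : Ray X, c.endpoint = ξ ∧ hX.TendsToRay x c := by
  refine exists_congr fun c => and_congr_right fun _ => forall_congr' fun r =>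
    forall_congr' fun ε => forall_congr' fun _ => eventually_congr (Eventually.of_forall fun n =>
      and_congr_right fun hr => ?_)
  constructor
  · rintro ⟨γ, hγ, h⟩
    rwa [← hX.geodesic_eq_arc hγ ⟨r.coe_nonneg, hr.le⟩]
  · intro h
    obtain ⟨γ, hγ⟩ := hX.geodesic (c.1 0) (x n)
    exact ⟨γ, hγ, by rwa [hX.geodesic_eq_arc hγ ⟨r.coe_nonneg, hr.le⟩]⟩

theorem exists_scale (r : ℝ≥0) {K ε : ℝ} (hK : 0 ≤ K) (hε : 0 < ε) :
    ∃ m : ℝ≥0, r ≤ m ∧ 0 < m ∧ (r : ℝ) / m * K < ε := by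
  have hm : ((r + r * K / ε + 1 : ℝ).toNNReal : ℝ) = r + r * K / ε + 1 :=
    Real.coe_toNNReal _ (by positivity)
  have h0 : 0 ≤ (r : ℝ) * K / ε := by positivity
  refine ⟨(r + r * K / ε + 1 : ℝ).toNNReal, ?_, ?_, ?_⟩
  · rw [← NNReal.coe_le_coe, hm]
    linarith
  · rw [← NNReal.coe_pos, hm]
    positivity
  · rw [hm, div_mul_eq_mul_div, div_lt_iff₀ (by positivity)]
    have h1 : ε * (r * K / ε) = r * K := by field_simp
    have h2 : 0 ≤ ε * (r : ℝ) := by positivity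
    linarith

/-- A uniform bound at all times already gives convergence: a `K`-bound at a late time becomes an
arbitrarily small one at time `r`. -/
theorem tendsToRay_of_dist_le {x : ℕ → X} {c : Ray X} {K : ℝ}
    (h : ∀ r : ℝ≥0, ∀ᶠ n in atTop, ∃ t ∈ Icc (0 : ℝ) 1,
      dist (hX.pt (c.1 0) (x n) t) (c.1 r) ≤ K) : hX.TendsToRay x c := by
  intro r ε hε
  have hK : 0 ≤ K := by
    obtain ⟨n, t, -, h⟩ := (h 0).exists
    exact dist_nonneg.trans h
  obtain ⟨m, hrm, hm, hmε⟩ := exists_scale r (mul_nonneg zero_le_two hK) hε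
  obtain ⟨K', rfl⟩ : ∃ K' : ℝ≥0, (K' : ℝ) = K := ⟨K.toNNReal, Real.coe_toNNReal _ hK⟩
  filter_upwards [h (m + 1 + K' + 1)] with n hn
  obtain ⟨t, ht, h1⟩ := hn
  have hm1 : m + 1 ≤ m + 1 + K' + 1 := by
    rw [add_assoc (m + 1)]
    exact le_self_add
  have h2 := hX.dist_arc_arc_le_of_dist_pt_pt_le (c.1 0) (c.1 (m + 1 + K' + 1)) (x n)
    (t := 1) (t' := t) (K := K') (r := ((m + 1 : ℝ≥0) : ℝ)) ⟨zero_le_one, le_rfl⟩ ht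
    (by rwa [hX.pt_one, dist_comm]) (m + 1).coe_nonneg (by
      rw [c.dist_zero, one_mul]
      push_cast
      linarith)
  obtain ⟨-, h3, h4⟩ := h2
  rw [hX.arc_ray c hm1] at h4
  have hrm' : (r : ℝ) ≤ m := hrm
  have hm' : (0 : ℝ) < m := hm
  push_cast at h3
  refine ⟨by linarith, ?_⟩
  have h5 := hX.dist_arc_arc_le_div_mul (c.1 0) (c.1 (m + 1 + K' + 1)) (x n) (s := r)
    (m := ((m + 1 : ℝ≥0) : ℝ)) r.coe_nonneg (by push_cast; linarith) (by push_cast; linarith)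
    (by rw [c.dist_zero]; exact_mod_cast hm1) (by push_cast; linarith)
  rw [hX.arc_ray c (hrm.trans (le_self_add.trans hm1)), hX.arc_ray c hm1] at h5
  rw [dist_comm]
  refine lt_of_le_of_lt (h5.trans (mul_le_mul ?_ h4 dist_nonneg (by positivity))) hmε
  push_cast
  gcongr
  linarith

theorem TendsToRay.of_endpoint_eq {x : ℕ → X} {c c' : Ray X} (h : hX.TendsToRay x c)
    (hc : c.endpoint = c'.endpoint) : hX.TendsToRay x c' := by
  obtain ⟨K, hK⟩ := endpoint_eq_iff.1 hc
  refine hX.tendsToRay_of_dist_le (K := K + 1 + K) fun r => ?_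
  filter_upwards [h r 1 one_pos] with n hn
  obtain ⟨t, ht, h1⟩ := hX.exists_arc_eq_pt (c.1 0) (x n) r.coe_nonneg
  refine ⟨t, ht, ?_⟩
  have h2 := hX.dist_pt_pt_le_max (y := x n) (y' := x n) ht (hK 0)
    (by rw [dist_self]; exact dist_nonneg.trans (hK 0))
  have h3 := hn.2
  rw [h1] at h3
  have h4 := dist_triangle4 (hX.pt (c'.1 0) (x n) t) (hX.pt (c.1 0) (x n) t) (c.1 r) (c'.1 r)
  rw [dist_comm (hX.pt (c'.1 0) (x n) t) (hX.pt (c.1 0) (x n) t)] at h4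
  linarith [hK r]

theorem TendsToRay.of_dist_le {x x' : ℕ → X} {c : Ray X} (h : hX.TendsToRay x c) {K : ℝ}
    (hK : ∀ n, dist (x n) (x' n) ≤ K) : hX.TendsToRay x' c := by
  refine hX.tendsToRay_of_dist_le (K := K + 1) fun r => ?_
  filter_upwards [h r 1 one_pos] with n hn
  obtain ⟨t, ht, h1⟩ := hX.exists_arc_eq_pt (c.1 0) (x n) r.coe_nonneg
  refine ⟨t, ht, ?_⟩
  have h2 := hX.dist_pt_pt_le_max (x := c.1 0) (x' := c.1 0) ht
    (by rw [dist_self]; exact dist_nonneg.trans (hK n)) (hK n)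
  have h3 := hn.2
  rw [h1] at h3
  linarith [dist_triangle_left (hX.pt (c.1 0) (x' n) t) (c.1 r) (hX.pt (c.1 0) (x n) t)]

/-- One `dist p q` is paid for convexity at equal affine parameter, the other for the difference in
length of the two geodesics. -/
theorem dist_arc_arc_le_two_mul (p q x : X) {r : ℝ} (hr : 0 ≤ r) (hp : r ≤ dist p x)
    (hq : r ≤ dist q x) : dist (hX.arc p x r) (hX.arc q x r) ≤ 2 * dist p q := by
  rcases hr.eq_or_lt with rfl | hr0
  · rw [hX.arc_zero, hX.arc_zero]
    linarith [dist_nonneg (x := p) (y := q)]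
  have hp0 := hr0.trans_le hp
  have hq0 := hr0.trans_le hq
  have ht : r / dist p x ∈ Icc (0 : ℝ) 1 := ⟨by positivity, div_le_one_of_le₀ hp hp0.le⟩
  have ht' : r / dist q x ∈ Icc (0 : ℝ) 1 := ⟨by positivity, div_le_one_of_le₀ hq hq0.le⟩
  rw [arc, arc, min_eq_left hp, min_eq_left hq]
  have h1 := hX.dist_pt_pt_le_max (y := x) (y' := x) ht (le_refl (dist p q))
    (by rw [dist_self]; exact dist_nonneg)
  have h2 := hX.dist_pt_pt q x ht ht'
  have h3 : |r / dist p x - r / dist q x| * dist q x ≤ dist p q := by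
    have e : r / dist p x - r / dist q x = r / dist p x * ((dist q x - dist p x) / dist q x) := by
      field_simp
    rw [e, abs_mul, abs_of_nonneg ht.1, abs_div, abs_of_pos hq0, mul_assoc,
      div_mul_cancel₀ _ hq0.ne']
    have h4 := abs_dist_sub_le q p x
    rw [dist_comm q p] at h4
    exact (mul_le_of_le_one_left (abs_nonneg _) ht.2).trans h4
  linarith [dist_triangle (hX.pt p x (r / dist p x)) (hX.pt q x (r / dist p x))
    (hX.pt q x (r / dist q x))]

theorem TendsToRay.dist_le {x : ℕ → X} {c c' : Ray X} (h : hX.TendsToRay x c)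
    (h' : hX.TendsToRay x c') (r : ℝ≥0) : dist (c.1 r) (c'.1 r) ≤ 2 * dist (c.1 0) (c'.1 0) := by
  refine le_of_forall_pos_le_add fun ε hε => ?_
  obtain ⟨n, h1, h2⟩ := ((h r (ε / 2) (half_pos hε)).and (h' r (ε / 2) (half_pos hε))).exists
  have h3 := hX.dist_arc_arc_le_two_mul (c.1 0) (c'.1 0) (x n) r.coe_nonneg h1.1.le h2.1.le
  have h4 := dist_triangle4 (c.1 r) (hX.arc (c.1 0) (x n) r) (hX.arc (c'.1 0) (x n) r) (c'.1 r)
  rw [dist_comm (c.1 r) (hX.arc _ _ _)] at h4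
  have h5 := h1.2
  have h6 := h2.2
  linarith

theorem TendsToRay.endpoint_eq {x : ℕ → X} {c c' : Ray X} (h : hX.TendsToRay x c)
    (h' : hX.TendsToRay x c') : c.endpoint = c'.endpoint :=
  endpoint_eq_iff.2 ⟨_, h.dist_le hX h'⟩

theorem TendsToRay.eq {x : ℕ → X} {c c' : Ray X} (h : hX.TendsToRay x c)
    (h' : hX.TendsToRay x c') (h0 : c.1 0 = c'.1 0) : c = c' := by
  refine Subtype.ext (ContinuousMap.ext fun r => ?_)
  have := h.dist_le hX h' r
  rw [h0, dist_self, mul_zero] at this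
  exact dist_le_zero.1 this

theorem tendsToRay_natCast (c : Ray X) : hX.TendsToRay (fun n : ℕ => c.1 n) c := by
  intro r ε hε
  filter_upwards [eventually_gt_atTop ⌈r⌉₊] with n hn
  have h1 : r < n := (Nat.le_ceil r).trans_lt (Nat.cast_lt.2 hn)
  rw [hX.arc_ray c h1.le, dist_self, c.dist_zero]
  exact ⟨h1, hε⟩

/-- Uniformly bounded divergence at every time makes the arcs Cauchy at each fixed time, by the
linear spreading of geodesics; their limits form a ray. -/
theorem exists_tendsToRay [CompleteSpace X] {x : ℕ → X} {p : X} {K : ℝ}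
    (h : ∀ r : ℝ≥0, ∃ N : ℕ, ∀ m ≥ N, ∀ n ≥ N, (r : ℝ) ≤ dist p (x m) ∧
      (r : ℝ) ≤ dist p (x n) ∧ dist (hX.arc p (x m) r) (hX.arc p (x n) r) ≤ K) :
    ∃ c : Ray X, c.1 0 = p ∧ hX.TendsToRay x c := by
  have hK : 0 ≤ K := by
    obtain ⟨N, hN⟩ := h 0
    exact dist_nonneg.trans (hN N le_rfl N le_rfl).2.2
  have hcauchy : ∀ r : ℝ≥0, CauchySeq fun n => hX.arc p (x n) r := by
    intro r
    refine Metric.cauchySeq_iff.2 fun ε hε => ?_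
    obtain ⟨m, hrm, hm, hmε⟩ := exists_scale r hK hε
    obtain ⟨N, hN⟩ := h m
    refine ⟨N, fun i hi j hj => ?_⟩
    obtain ⟨h1, h2, h3⟩ := hN i hi j hj
    exact ((hX.dist_arc_arc_le_div_mul p (x i) (x j) r.coe_nonneg hrm hm h1 h2).trans
      (mul_le_mul_of_nonneg_left h3 (div_nonneg r.coe_nonneg m.coe_nonneg))).trans_lt hmε
  choose ℓ hℓ using fun r => cauchySeq_tendsto_of_complete (hcauchy r)
  have hdist : ∀ r : ℝ≥0, ∀ᶠ n in atTop, (r : ℝ) ≤ dist p (x n) := fun r => by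
    obtain ⟨N, hN⟩ := h r
    filter_upwards [eventually_ge_atTop N] with n hn
    exact (hN n hn n hn).1
  have hiso : Isometry ℓ := Isometry.of_dist_eq fun r s => by
    refine tendsto_nhds_unique ((hℓ r).dist (hℓ s)) (tendsto_const_nhds.congr' ?_)
    filter_upwards [hdist r, hdist s] with n hr hs
    rw [hX.dist_arc_arc _ _ r.coe_nonneg s.coe_nonneg, NNReal.dist_eq, min_eq_left hr,
      min_eq_left hs]
  have h0 : ℓ 0 = p := by
    refine tendsto_nhds_unique (hℓ 0) (tendsto_const_nhds.congr fun n => ?_)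
    rw [NNReal.coe_zero, hX.arc_zero]
  refine ⟨⟨⟨ℓ, hiso.continuous⟩, hiso⟩, h0, fun r ε hε => ?_⟩
  filter_upwards [hdist (r + 1), Metric.tendsto_nhds.1 (hℓ r) ε hε] with n h1 h2
  change (r : ℝ) < dist (ℓ 0) (x n) ∧ dist (hX.arc (ℓ 0) (x n) r) (ℓ r) < ε
  rw [h0]
  push_cast at h1
  exact ⟨by linarith, h2⟩

/-- The geodesics from `p` to points running along a given representative stay within a bounded
distance of it, hence converge. -/
theorem exists_ray [CompleteSpace X] (hX : IsCAT0 X) (p : X) (ξ : VisualBoundary X) :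
    ∃ c : Ray X, c.1 0 = p ∧ c.endpoint = ξ := by
  obtain ⟨c, rfl⟩ := Quotient.exists_rep ξ
  have hc := hX.tendsToRay_natCast c
  obtain ⟨c', h0, hc'⟩ := hX.exists_tendsToRay (x := fun n : ℕ => c.1 n) (p := p)
    (K := 4 * dist p (c.1 0)) (fun r => by
      refine ⟨⌈(r : ℝ) + dist p (c.1 0)⌉₊, fun m hm n hn => ?_⟩
      have key : ∀ n ≥ ⌈(r : ℝ) + dist p (c.1 0)⌉₊, (r : ℝ) ≤ dist p (c.1 n) ∧
          dist (hX.arc p (c.1 n) r) (c.1 r) ≤ 2 * dist p (c.1 0) := by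
        intro n hn
        have h1 : (r : ℝ) + dist p (c.1 0) ≤ n := Nat.ceil_le.1 hn
        have h2 := c.dist_zero n
        rw [NNReal.coe_natCast] at h2
        have h3 : (r : ℝ) ≤ dist p (c.1 n) := by
          linarith [dist_triangle_left (c.1 0) (c.1 n) p]
        have h4 : (r : ℝ) ≤ n := by linarith [dist_nonneg (x := p) (y := c.1 0)]
        refine ⟨h3, ?_⟩
        have h5 := hX.dist_arc_arc_le_two_mul p (c.1 0) (c.1 n) r.coe_nonneg h3 (h4.trans h2.symm.le)
        have h6 := hX.arc_ray c (s := r) (t := n) (by exact_mod_cast h4)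
        rw [← h6]
        exact h5
      obtain ⟨a1, a2⟩ := key m hm
      obtain ⟨b1, b2⟩ := key n hn
      refine ⟨a1, b1, ?_⟩
      linarith [dist_triangle_right (hX.arc p (c.1 m) r) (hX.arc p (c.1 n) r) (c.1 r)])
  exact ⟨c', h0, hc'.endpoint_eq hX hc⟩

end IsCAT0

end Rays

end CAT0Boundary

namespace CAT0Boundary

/-! ### The cone topology in terms of rays from a basepoint. -/

section ConeTopology

variable {X : Type*} [MetricSpace X]

namespace IsCAT0

variable [CompleteSpace X] (hX : IsCAT0 X)

/-- The ray from `p` to the boundary point `ξ`. -/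
noncomputable def ray (p : X) (ξ : VisualBoundary X) : Ray X :=
  (hX.exists_ray p ξ).choose

theorem ray_zero (p : X) (ξ : VisualBoundary X) : (hX.ray p ξ).1 0 = p :=
  (hX.exists_ray p ξ).choose_spec.1

theorem endpoint_ray (p : X) (ξ : VisualBoundary X) : (hX.ray p ξ).endpoint = ξ :=
  (hX.exists_ray p ξ).choose_spec.2

theorem ray_endpoint (c : Ray X) : hX.ray (c.1 0) c.endpoint = c :=
  ((hX.tendsToRay_natCast c).of_endpoint_eq hX (hX.endpoint_ray _ _).symm).eq hX
    (hX.tendsToRay_natCast c) (hX.ray_zero _ _)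

theorem convergesToBoundary_iff (p : X) {x : ℕ → X} {ξ : VisualBoundary X} :
    ConvergesToBoundary x ξ ↔ hX.TendsToRay x (hX.ray p ξ) := by
  rw [hX.convergesToBoundary_iff_exists]
  constructor
  · rintro ⟨c, rfl, hc⟩
    exact hc.of_endpoint_eq hX (hX.endpoint_ray _ _).symm
  · exact fun h => ⟨_, hX.endpoint_ray p ξ, h⟩

theorem dist_ray_ray_le (p q : X) (ξ : VisualBoundary X) (r : ℝ≥0) :
    dist ((hX.ray p ξ).1 r) ((hX.ray q ξ).1 r) ≤ 2 * dist p q := by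
  have h1 := hX.tendsToRay_natCast (hX.ray p ξ)
  have h2 : (hX.ray p ξ).endpoint = (hX.ray q ξ).endpoint := by
    rw [hX.endpoint_ray, hX.endpoint_ray]
  have h3 := h1.dist_le hX (h1.of_endpoint_eq hX h2) r
  rwa [hX.ray_zero, hX.ray_zero] at h3

theorem dist_ray_le_div_mul (p : X) (ξ ξ' : VisualBoundary X) {s m : ℝ≥0} (hsm : s ≤ m)
    (hm : 0 < m) : dist ((hX.ray p ξ).1 s) ((hX.ray p ξ').1 s) ≤
      s / m * dist ((hX.ray p ξ).1 m) ((hX.ray p ξ').1 m) := by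
  have key : ∀ ξ, (m : ℝ) ≤ dist p ((hX.ray p ξ).1 m) := fun ξ => by
    have := (hX.ray p ξ).dist_zero m
    rw [hX.ray_zero] at this
    exact this.ge
  have h := hX.dist_arc_arc_le_div_mul p ((hX.ray p ξ).1 m) ((hX.ray p ξ').1 m) s.coe_nonneg
    (NNReal.coe_le_coe.2 hsm) (NNReal.coe_pos.2 hm) (key ξ) (key ξ')
  have e : ∀ ξ (u : ℝ≥0), u ≤ m → hX.arc p ((hX.ray p ξ).1 m) u = (hX.ray p ξ).1 u :=
    fun ξ u hu => by
      have := hX.arc_ray (hX.ray p ξ) hu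
      rwa [hX.ray_zero] at this
  rwa [e ξ s hsm, e ξ' s hsm, e ξ m le_rfl, e ξ' m le_rfl] at h

/-- Endpoints give a bijection from the rays issuing from `p` to the boundary, so coinducing along
it is inducing along its inverse. -/
theorem coneTopology_eq_induced (p : X) : coneTopology p =
    TopologicalSpace.induced (fun ξ => (hX.ray p ξ).1) inferInstance := by
  let e : {c : Ray X // c.1 0 = p} ≃ VisualBoundary X :=
    { toFun := fun c => c.1.endpoint
      invFun := fun ξ => ⟨hX.ray p ξ, hX.ray_zero p ξ⟩
      left_inv := by
        rintro ⟨c, rfl⟩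
        exact Subtype.ext (hX.ray_endpoint c)
      right_inv := fun ξ => hX.endpoint_ray p ξ }
  change TopologicalSpace.coinduced e inferInstance = _
  rw [← e.induced_symm]
  change TopologicalSpace.induced e.symm (TopologicalSpace.induced Subtype.val
    (TopologicalSpace.induced Subtype.val inferInstance)) = _
  rw [induced_compose, induced_compose]
  rfl

theorem coneTopologyOn_eq_induced (p : X) (S : Set (VisualBoundary X)) : coneTopologyOn p S =
    TopologicalSpace.induced (fun ξ : S => (hX.ray p ξ).1) inferInstance := by
  rw [coneTopologyOn, hX.coneTopology_eq_induced p, induced_compose]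
  rfl

end IsCAT0

namespace ConvergesToBoundary

theorem unique (hX : IsCAT0 X) {x : ℕ → X} {ξ ξ' : VisualBoundary X}
    (h : ConvergesToBoundary x ξ) (h' : ConvergesToBoundary x ξ') : ξ = ξ' := by
  obtain ⟨c, rfl, hc⟩ := hX.convergesToBoundary_iff_exists.1 h
  obtain ⟨c', rfl, hc'⟩ := hX.convergesToBoundary_iff_exists.1 h'
  exact hc.endpoint_eq hX hc'

theorem of_dist_le (hX : IsCAT0 X) {x x' : ℕ → X} {ξ : VisualBoundary X}
    (h : ConvergesToBoundary x ξ) {K : ℝ} (hK : ∀ n, dist (x n) (x' n) ≤ K) :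
    ConvergesToBoundary x' ξ := by
  obtain ⟨c, rfl, hc⟩ := hX.convergesToBoundary_iff_exists.1 h
  exact hX.convergesToBoundary_iff_exists.2 ⟨c, rfl, hc.of_dist_le hX hK⟩

end ConvergesToBoundary

end ConeTopology

theorem continuous_induced_of_forall_dist_lt {S T Y Z : Type*} [PseudoMetricSpace Y]
    [PseudoMetricSpace Z] {g : S → C(ℝ≥0, Y)} {g' : T → C(ℝ≥0, Z)} {f : S → T}
    (h : ∀ (ξ : S) (r : ℝ≥0) (ε : ℝ), 0 < ε → ∃ R : ℝ≥0, ∃ δ > 0, ∀ ξ' : S,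
      (∀ s ≤ R, dist (g ξ s) (g ξ' s) < δ) → ∀ s ≤ r, dist (g' (f ξ) s) (g' (f ξ') s) < ε) :
    Continuous[TopologicalSpace.induced g inferInstance,
      TopologicalSpace.induced g' inferInstance] f := by
  let _ : TopologicalSpace S := TopologicalSpace.induced g inferInstance
  refine continuous_induced_rng.2 (continuous_iff_continuousAt.2 fun ξ =>
    ContinuousMap.tendsto_iff_forall_isCompact_tendstoUniformlyOn.2 fun C hC =>
      Metric.tendstoUniformlyOn_iff.2 fun ε hε => ?_)
  obtain ⟨r, hr⟩ := hC.bddAbove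
  obtain ⟨R, δ, hδ, hR⟩ := h ξ r ε hε
  have hg : Continuous g := continuous_induced_dom
  filter_upwards [Metric.tendstoUniformlyOn_iff.1
    (ContinuousMap.tendsto_iff_forall_isCompact_tendstoUniformlyOn.1 (hg.tendsto ξ) (Icc 0 R)
      isCompact_Icc) δ hδ] with ξ' hξ' s hs
  exact hR ξ' (fun s hs => hξ' s ⟨bot_le, hs⟩) s (hr hs)

/-! ### From control of geodesics to maps between boundaries. -/

section TwoSpaces

variable {X₁ X₂ : Type*} [MetricSpace X₁] [MetricSpace X₂] [CompleteSpace X₁] [CompleteSpace X₂]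
  (hX₁ : IsCAT0 X₁) (hX₂ : IsCAT0 X₂)

include hX₁ hX₂ in
-- A bound `K` independent of `r` suffices: linear spreading makes it small in the target and lets
-- closeness at a late time supply the hypothesis in the source. Changing basepoints adds only
-- bounded errors.
theorem continuous_coneTopologyOn {S₁ : Set (VisualBoundary X₁)} {S₂ : Set (VisualBoundary X₂)}
    {f : S₁ → S₂} {x₁ : X₁} {x₂ : X₂} {K : ℝ}
    (h : ∀ r : ℝ≥0, ∃ R : ℝ≥0, ∀ ξ ξ' : S₁,
      dist ((hX₁.ray x₁ ξ).1 R) ((hX₁.ray x₁ ξ').1 R) ≤ 1 →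
        dist ((hX₂.ray x₂ (f ξ)).1 r) ((hX₂.ray x₂ (f ξ')).1 r) ≤ K) (p₁ : X₁) (p₂ : X₂) :
    Continuous[coneTopologyOn p₁ S₁, coneTopologyOn p₂ S₂] f := by
  rw [hX₁.coneTopologyOn_eq_induced, hX₂.coneTopologyOn_eq_induced]
  refine continuous_induced_of_forall_dist_lt fun ξ r ε hε => ?_
  have hK : 0 ≤ K := by
    obtain ⟨R, hR⟩ := h r
    exact dist_nonneg.trans (hR ξ ξ (by rw [dist_self]; exact zero_le_one))
  have hK' : 0 ≤ K + 4 * dist x₂ p₂ := by positivity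
  obtain ⟨m, hrm, hm, hmε⟩ := IsCAT0.exists_scale r hK' hε
  obtain ⟨R, hR⟩ := h m
  obtain ⟨N, hRN, hN, hN1⟩ := IsCAT0.exists_scale R
    (K := 1 + 4 * dist x₁ p₁) (by positivity) one_pos
  refine ⟨N, 1, one_pos, fun ξ' hξ' s hs => ?_⟩
  have h1 := hξ' N le_rfl
  have h2 : dist ((hX₁.ray x₁ ξ).1 N) ((hX₁.ray x₁ ξ').1 N) ≤ 1 + 4 * dist x₁ p₁ := by
    have h3 := hX₁.dist_ray_ray_le x₁ p₁ ξ N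
    have h4 := hX₁.dist_ray_ray_le x₁ p₁ ξ' N
    have h5 := dist_triangle4 ((hX₁.ray x₁ ξ).1 N) ((hX₁.ray p₁ ξ).1 N) ((hX₁.ray p₁ ξ').1 N)
      ((hX₁.ray x₁ ξ').1 N)
    rw [dist_comm ((hX₁.ray p₁ ξ').1 N)] at h5
    linarith
  have h3 := hR ξ ξ' (((hX₁.dist_ray_le_div_mul x₁ ξ ξ' hRN hN).trans
    (mul_le_mul_of_nonneg_left h2 (div_nonneg R.coe_nonneg N.coe_nonneg))).trans hN1.le)
  have h4 : dist ((hX₂.ray p₂ (f ξ)).1 m) ((hX₂.ray p₂ (f ξ')).1 m) ≤ K + 4 * dist x₂ p₂ := by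
    have h5 := hX₂.dist_ray_ray_le x₂ p₂ (f ξ) m
    have h6 := hX₂.dist_ray_ray_le x₂ p₂ (f ξ') m
    have h7 := dist_triangle4 ((hX₂.ray p₂ (f ξ)).1 m) ((hX₂.ray x₂ (f ξ)).1 m)
      ((hX₂.ray x₂ (f ξ')).1 m) ((hX₂.ray p₂ (f ξ')).1 m)
    rw [dist_comm ((hX₂.ray p₂ (f ξ)).1 m)  ((hX₂.ray x₂ (f ξ)).1 m)] at h7
    linarith
  refine ((hX₂.dist_ray_le_div_mul p₂ (f ξ) (f ξ') (hs.trans hrm) hm).trans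
    (mul_le_mul ?_ h4 dist_nonneg (div_nonneg r.coe_nonneg m.coe_nonneg))).trans_lt hmε
  exact div_le_div_of_nonneg_right (NNReal.coe_le_coe.2 hs) m.coe_nonneg

/-- Geodesics from `x₁` to points `u a` which are close at a late time correspond to geodesics
from `x₂` to the points `v a` which are `K`-close at a prescribed time. -/
def ArcControl {A : Type*} (x₁ : X₁) (x₂ : X₂) (u : A → X₁) (v : A → X₂) (K : ℝ) : Prop :=
  ∀ r : ℝ, 0 ≤ r → ∃ R : ℝ, 0 ≤ R ∧ ∀ a b : A, R ≤ dist x₁ (u a) → R ≤ dist x₁ (u b) →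
    dist (hX₁.arc x₁ (u a) R) (hX₁.arc x₁ (u b) R) ≤ 3 →
    r ≤ dist x₂ (v a) ∧ r ≤ dist x₂ (v b) ∧
      dist (hX₂.arc x₂ (v a) r) (hX₂.arc x₂ (v b) r) ≤ K

namespace ArcControl

variable {hX₁ hX₂} {A : Type*} {x₁ : X₁} {x₂ : X₂} {u : A → X₁} {v : A → X₂} {K : ℝ}

theorem exists_convergesToBoundary (h : ArcControl hX₁ hX₂ x₁ x₂ u v K) {a : ℕ → A}
    {ξ : VisualBoundary X₁} (ha : ConvergesToBoundary (fun n => u (a n)) ξ) :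
    ∃ ζ : VisualBoundary X₂, ConvergesToBoundary (fun n => v (a n)) ζ := by
  have ha' := (hX₁.convergesToBoundary_iff x₁).1 ha
  obtain ⟨c, -, hc⟩ := hX₂.exists_tendsToRay (x := fun n => v (a n)) (p := x₂) (K := K)
    (fun r => by
      obtain ⟨R, hR, hab⟩ := h r r.coe_nonneg
      lift R to ℝ≥0 using hR
      obtain ⟨N, hN⟩ := eventually_atTop.1 (ha' R 1 one_pos)
      rw [hX₁.ray_zero] at hN
      refine ⟨N, fun m hm n hn => hab (a m) (a n) (hN m hm).1.le (hN n hn).1.le ?_⟩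
      have h1 := (hN m hm).2
      have h2 := (hN n hn).2
      linarith [dist_triangle_right (hX₁.arc x₁ (u (a m)) R) (hX₁.arc x₁ (u (a n)) R)
        ((hX₁.ray x₁ ξ).1 R)])
  exact ⟨c.endpoint, hX₂.convergesToBoundary_iff_exists.2 ⟨c, rfl, hc⟩⟩

/-- Far along the sequences the arcs are within `1` of the rays in both spaces; this accounts for `3
= 1 + 1 + 1` in `ArcControl` and for `K + 2` here. -/
theorem exists_dist_ray_le (h : ArcControl hX₁ hX₂ x₁ x₂ u v K) (r : ℝ≥0) :
    ∃ R : ℝ≥0, ∀ (a b : ℕ → A) (ξ ξ' : VisualBoundary X₁) (ζ ζ' : VisualBoundary X₂),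
      ConvergesToBoundary (fun n => u (a n)) ξ → ConvergesToBoundary (fun n => u (b n)) ξ' →
      ConvergesToBoundary (fun n => v (a n)) ζ → ConvergesToBoundary (fun n => v (b n)) ζ' →
      dist ((hX₁.ray x₁ ξ).1 R) ((hX₁.ray x₁ ξ').1 R) ≤ 1 →
      dist ((hX₂.ray x₂ ζ).1 r) ((hX₂.ray x₂ ζ').1 r) ≤ K + 2 := by
  obtain ⟨R, hR, hab⟩ := h r r.coe_nonneg
  lift R to ℝ≥0 using hR
  refine ⟨R, fun a b ξ ξ' ζ ζ' hξ hξ' hζ hζ' hd => ?_⟩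
  obtain ⟨n, h1, h2, h3, h4⟩ := ((((hX₁.convergesToBoundary_iff x₁).1 hξ) R 1 one_pos).and
    ((((hX₁.convergesToBoundary_iff x₁).1 hξ') R 1 one_pos).and
    ((((hX₂.convergesToBoundary_iff x₂).1 hζ) r 1 one_pos).and
    (((hX₂.convergesToBoundary_iff x₂).1 hζ') r 1 one_pos)))).exists
  rw [IsCAT0.ray_zero] at h1 h2 h3 h4
  obtain ⟨-, -, h5⟩ := hab (a n) (b n) h1.1.le h2.1.le (by
    have h6 := dist_triangle4 (hX₁.arc x₁ (u (a n)) R) ((hX₁.ray x₁ ξ).1 R)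
      ((hX₁.ray x₁ ξ').1 R) (hX₁.arc x₁ (u (b n)) R)
    rw [dist_comm ((hX₁.ray x₁ ξ').1 R) (hX₁.arc x₁ (u (b n)) R)] at h6
    linarith [h1.2, h2.2])
  have h6 := dist_triangle4 ((hX₂.ray x₂ ζ).1 r) (hX₂.arc x₂ (v (a n)) r)
    (hX₂.arc x₂ (v (b n)) r) ((hX₂.ray x₂ ζ').1 r)
  rw [dist_comm ((hX₂.ray x₂ ζ).1 r) (hX₂.arc x₂ (v (a n)) r)] at h6
  linarith [h3.2, h4.2]

/-- The rays to the two limits stay `K + 2`-close at all times, that is, they are asymptotic. This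
makes the boundary map well defined. -/
theorem eq_of_convergesToBoundary (h : ArcControl hX₁ hX₂ x₁ x₂ u v K) {a b : ℕ → A}
    {ξ : VisualBoundary X₁} {ζ ζ' : VisualBoundary X₂}
    (ha : ConvergesToBoundary (fun n => u (a n)) ξ) (hb : ConvergesToBoundary (fun n => u (b n)) ξ)
    (ha' : ConvergesToBoundary (fun n => v (a n)) ζ)
    (hb' : ConvergesToBoundary (fun n => v (b n)) ζ') : ζ = ζ' := by
  rw [← hX₂.endpoint_ray x₂ ζ, ← hX₂.endpoint_ray x₂ ζ']
  refine endpoint_eq_iff.2 ⟨K + 2, fun r => ?_⟩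
  obtain ⟨R, hR⟩ := h.exists_dist_ray_le r
  exact hR a b ξ ξ ζ ζ' ha hb ha' hb' (by rw [dist_self]; exact zero_le_one)

end ArcControl

end TwoSpaces

end CAT0Boundary

namespace CAT0Boundary

/-! ### The equivariant homeomorphisms of limit sets and boundaries. -/

section LimitSets

variable {G₁ G₂ X₁ X₂ : Type*} [Group G₁] [Group G₂] [MetricSpace X₁] [MetricSpace X₂]
  [MulAction G₁ X₁] [MulAction G₂ X₂] [IsIsometricSMul G₁ X₁] [IsIsometricSMul G₂ X₂]
  {H₁ : Subgroup G₁} {H₂ : Subgroup G₂}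

theorem ConvergesToBoundary.smul_basepoint (hX₁ : IsCAT0 X₁) {x : X₁} {a : ℕ → H₁}
    {ξ : VisualBoundary X₁} (h : ConvergesToBoundary (fun n => a n • x) ξ) (y : X₁) :
    ConvergesToBoundary (fun n => a n • y) ξ :=
  h.of_dist_le hX₁ fun n => (dist_smul (a n) x y).le

theorem exists_convergesToBoundary_of_mem_limitSet (hX₁ : IsCAT0 X₁) {ξ : VisualBoundary X₁}
    (hξ : ξ ∈ limitSet X₁ H₁) (x : X₁) :
    ∃ a : ℕ → H₁, ConvergesToBoundary (fun n => a n • x) ξ := by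
  obtain ⟨y, a, ha⟩ := hξ
  exact ⟨a, ha.smul_basepoint hX₁ x⟩

theorem ArcControl.exists_limitSet_map [CompleteSpace X₁] [CompleteSpace X₂] {hX₁ : IsCAT0 X₁}
    {hX₂ : IsCAT0 X₂} {η : H₁ → H₂} {x₁ : X₁} {x₂ : X₂} {K : ℝ}
    (h : ArcControl hX₁ hX₂ x₁ x₂ (fun a : H₁ => a • x₁) (fun a : H₁ => η a • x₂) K) :
    ∃ f : limitSet X₁ H₁ → limitSet X₂ H₂,
      (∀ (p₁ : X₁) (p₂ : X₂),
        Continuous[coneTopologyOn p₁ (limitSet X₁ H₁), coneTopologyOn p₂ (limitSet X₂ H₂)] f) ∧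
      ∀ (y₁ : X₁) (y₂ : X₂) (a : ℕ → H₁) (ξ : limitSet X₁ H₁),
        ConvergesToBoundary (fun n => a n • y₁) (ξ : VisualBoundary X₁) →
        ConvergesToBoundary (fun n => η (a n) • y₂) (f ξ : VisualBoundary X₂) := by
  choose a ha using fun ξ : limitSet X₁ H₁ =>
    exists_convergesToBoundary_of_mem_limitSet hX₁ ξ.2 x₁
  choose ζ hζ using fun ξ => h.exists_convergesToBoundary (ha ξ)
  refine ⟨fun ξ => ⟨ζ ξ, x₂, fun n => η (a ξ n), hζ ξ⟩, ?_, ?_⟩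
  · refine continuous_coneTopologyOn hX₁ hX₂ (x₁ := x₁) (x₂ := x₂) (K := K + 2) fun r => ?_
    obtain ⟨R, hR⟩ := h.exists_dist_ray_le r
    exact ⟨R, fun ξ ξ' => hR _ _ _ _ _ _ (ha ξ) (ha ξ') (hζ ξ) (hζ ξ')⟩
  · intro y₁ y₂ b ξ hb
    have hb' := hb.smul_basepoint hX₁ x₁
    obtain ⟨ζ', hζ'⟩ := h.exists_convergesToBoundary hb'
    obtain rfl : ζ ξ = ζ' := h.eq_of_convergesToBoundary (ha ξ) hb' (hζ ξ) hζ'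
    exact ConvergesToBoundary.smul_basepoint (a := fun n => η (b n)) hX₂ hζ' y₂

theorem exists_arcControl (hX₁ : IsCAT0 X₁) (hX₂ : IsCAT0 X₂) (hG₁ : IsGeometricAction G₁ X₁)
    (hG₂ : IsGeometricAction G₂ X₂) (hflat : HasIsolatedFlats X₂) (hrftp : HasRFTP X₂)
    {x₁ : X₁} {x₂ : X₂} (hq₁ : IsQuasiconvex (MulAction.orbit H₁ x₁))
    (hq₂ : IsQuasiconvex (MulAction.orbit H₂ x₂)) (η : H₁ ≃* H₂) :
    ∃ K : ℝ, ArcControl hX₁ hX₂ x₁ x₂ (fun a : H₁ => a • x₁) (fun a : H₁ => η a • x₂) K := by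
  have := hG₁.properSpace hX₁
  have := hG₂.properSpace hX₂
  have hfin₁ : ∀ r : ℝ, {g : H₁ | dist (g • x₁) x₁ ≤ r}.Finite := fun r =>
    (hG₁.finite_setOf_dist_le x₁ x₁ r).preimage Subtype.val_injective.injOn
  have hfin₂ : ∀ r : ℝ, {g : H₂ | dist (g • x₂) x₂ ≤ r}.Finite := fun r =>
    (hG₂.finite_setOf_dist_le x₂ x₂ r).preimage Subtype.val_injective.injOn
  obtain ⟨M, -, h⟩ := exists_dist_map_smul_le hX₁ (η : H₁ →* H₂) x₂ hq₁ hfin₁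
  obtain ⟨M', -, h'⟩ := exists_dist_map_smul_le hX₂ (η.symm : H₂ →* H₁) x₁ hq₂ hfin₂
  have hM : M ≤ max 1 (max M M') := (le_max_left _ _).trans (le_max_right _ _)
  have hM' : M' ≤ max 1 (max M M') := (le_max_right _ _).trans (le_max_right _ _)
  refine exists_dist_arc_arc_le hX₁ hX₂ hG₁ hG₂ hflat hrftp
    (φ := H₂.subtype.comp (η : H₁ →* H₂)) (H₂.subtype_injective.comp η.injective) x₁ x₂
    (le_max_left 1 (max M M')) (fun a b => (h a b).trans ?_) (fun a b => ?_) hq₁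
  · gcongr
  · have h1 := h' (η a) (η b)
    simp only [MonoidHom.coe_coe, MulEquiv.symm_apply_apply] at h1
    refine h1.trans ?_
    change _ ≤ _ * dist (η a • x₂) (η b • x₂) + _
    gcongr

theorem exists_limitSet_equiv (hX₁ : IsCAT0 X₁) (hX₂ : IsCAT0 X₂)
    (hG₁ : IsGeometricAction G₁ X₁) (hG₂ : IsGeometricAction G₂ X₂)
    (hflat₁ : HasIsolatedFlats X₁) (hflat₂ : HasIsolatedFlats X₂)
    (hrftp₁ : HasRFTP X₁) (hrftp₂ : HasRFTP X₂)
    (hq₁ : IsQuasiconvexSubgroup X₁ H₁) (hq₂ : IsQuasiconvexSubgroup X₂ H₂) (η : H₁ ≃* H₂) :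
    ∃ f : limitSet X₁ H₁ ≃ limitSet X₂ H₂,
      (∀ (p₁ : X₁) (p₂ : X₂),
        Continuous[coneTopologyOn p₁ (limitSet X₁ H₁), coneTopologyOn p₂ (limitSet X₂ H₂)] f ∧
        Continuous[coneTopologyOn p₂ (limitSet X₂ H₂), coneTopologyOn p₁ (limitSet X₁ H₁)]
          f.symm) ∧
      (∀ (h : H₁) (ξ : limitSet X₁ H₁), f (h • ξ) = η h • f ξ) ∧
      (∀ (x₁ : X₁) (x₂ : X₂) (h : ℕ → H₁) (ξ : limitSet X₁ H₁),
        ConvergesToBoundary (fun n => h n • x₁) (ξ : VisualBoundary X₁) →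
        ConvergesToBoundary (fun n => η (h n) • x₂) (f ξ : VisualBoundary X₂)) := by
  have := hG₁.properSpace hX₁
  have := hG₂.properSpace hX₂
  obtain ⟨x₁, hq₁⟩ := hq₁
  obtain ⟨x₂, hq₂⟩ := hq₂
  obtain ⟨K, hK⟩ := exists_arcControl hX₁ hX₂ hG₁ hG₂ hflat₂ hrftp₂ hq₁ hq₂ η
  obtain ⟨K', hK'⟩ := exists_arcControl hX₂ hX₁ hG₂ hG₁ hflat₁ hrftp₁ hq₂ hq₁ η.symm
  obtain ⟨f, hfcont, hf⟩ := hK.exists_limitSet_map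
  obtain ⟨f', hfcont', hf'⟩ := hK'.exists_limitSet_map
  -- The convergence property determines each map: going forth and back returns the original
  -- sequence, and limits are unique.
  have left_inv : ∀ ξ, f' (f ξ) = ξ := fun ξ => by
    obtain ⟨a, ha⟩ := exists_convergesToBoundary_of_mem_limitSet hX₁ ξ.2 x₁
    have h := hf' x₂ x₁ _ _ (hf x₁ x₂ a ξ ha)
    simp only [MulEquiv.symm_apply_apply] at h
    exact Subtype.ext (h.unique hX₁ ha)
  have right_inv : ∀ ξ, f (f' ξ) = ξ := fun ξ => by
    obtain ⟨a, ha⟩ := exists_convergesToBoundary_of_mem_limitSet hX₂ ξ.2 x₂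
    have h := hf x₁ x₂ _ _ (hf' x₂ x₁ a ξ ha)
    simp only [MulEquiv.apply_symm_apply] at h
    exact Subtype.ext (h.unique hX₂ ha)
  refine ⟨⟨f, f', left_inv, right_inv⟩, fun p₁ p₂ => ⟨hfcont p₁ p₂, hfcont' p₂ p₁⟩,
    fun h ξ => ?_, hf⟩
  -- Both sides of the equivariance identity are limits of `η (h * a n) • x₂`.
  obtain ⟨a, ha⟩ := exists_convergesToBoundary_of_mem_limitSet hX₁ ξ.2 x₁
  have h1 := (hf x₁ x₂ a ξ ha).smul (η h : G₂)
  have h2 := hf x₁ x₂ (fun n => h * a n) (h • ξ) (by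
    simp only [mul_smul]
    exact ha.smul (h : G₁))
  simp only [map_mul, mul_smul] at h2
  exact Subtype.ext (h2.unique hX₂ h1)

omit [IsIsometricSMul G₁ X₁] in
theorem IsGeometricAction.isQuasiconvexSubgroup_top [Nonempty X₁]
    (hG₁ : IsGeometricAction G₁ X₁) : IsQuasiconvexSubgroup X₁ (⊤ : Subgroup G₁) := by
  have := hG₁.isometric
  obtain ⟨x₀⟩ := ‹Nonempty X₁›
  obtain ⟨R, hR⟩ := hG₁.exists_smul_dist_le x₀
  have hR0 : 0 ≤ R := by
    obtain ⟨g, hg⟩ := hR x₀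
    exact dist_nonneg.trans hg
  refine ⟨x₀, R, hR0, fun _ _ _ _ γ _ => ?_⟩
  rintro _ ⟨t, -, rfl⟩
  obtain ⟨g, hg⟩ := hR (γ t)
  refine Metric.mem_cthickening_of_dist_le _ (g⁻¹ • x₀) _ _ ⟨⟨g⁻¹, trivial⟩, rfl⟩ ?_
  rwa [← dist_smul g, smul_inv_smul]

/-- By cocompactness the points of a ray are uniformly close to orbit points, so its endpoint is a
limit of the orbit. -/
theorem IsGeometricAction.limitSet_top (hX₁ : IsCAT0 X₁) (hG₁ : IsGeometricAction G₁ X₁) :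
    limitSet X₁ (⊤ : Subgroup G₁) = univ := by
  refine eq_univ_of_forall fun ξ => ?_
  obtain ⟨c, rfl⟩ : ∃ c : Ray X₁, c.endpoint = ξ := Quotient.exists_rep ξ
  obtain ⟨R, hR⟩ := hG₁.exists_smul_dist_le (c.1 0)
  choose g hg using hR
  refine ⟨c.1 0, fun n => ⟨(g (c.1 n))⁻¹, trivial⟩, ?_⟩
  refine ConvergesToBoundary.of_dist_le hX₁ (x := fun n : ℕ => c.1 n) (K := R)
    (hX₁.convergesToBoundary_iff_exists.2 ⟨c, rfl, hX₁.tendsToRay_natCast c⟩) fun n => ?_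
  change dist (c.1 n) ((g (c.1 n))⁻¹ • c.1 0) ≤ R
  rw [← dist_smul (g (c.1 n)), smul_inv_smul]
  exact hg _

theorem continuous_coneTopology_of_coneTopologyOn_univ {X Y : Type*} [MetricSpace X]
    [MetricSpace Y] {p : X} {q : Y} {S : Set (VisualBoundary X)} {T : Set (VisualBoundary Y)}
    {f : S → T} (hS : ∀ ξ, ξ ∈ S) (hf : Continuous[coneTopologyOn p S, coneTopologyOn q T] f) :
    Continuous[coneTopology p, coneTopology q] fun ξ => (f ⟨ξ, hS ξ⟩ : VisualBoundary Y) := by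
  let _ := coneTopology p
  let _ := coneTopology q
  exact continuous_subtype_val.comp (hf.comp (continuous_id.subtype_mk hS))

theorem exists_visualBoundary_equiv [Nonempty X₁] [Nonempty X₂] (hX₁ : IsCAT0 X₁)
    (hX₂ : IsCAT0 X₂) (hG₁ : IsGeometricAction G₁ X₁) (hG₂ : IsGeometricAction G₂ X₂)
    (hflat₁ : HasIsolatedFlats X₁) (hflat₂ : HasIsolatedFlats X₂)
    (hrftp₁ : HasRFTP X₁) (hrftp₂ : HasRFTP X₂) (η : G₁ ≃* G₂) :
    ∃ f : VisualBoundary X₁ ≃ VisualBoundary X₂,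
      (∀ (p₁ : X₁) (p₂ : X₂),
        Continuous[coneTopology p₁, coneTopology p₂] f ∧
        Continuous[coneTopology p₂, coneTopology p₁] f.symm) ∧
      (∀ (g : G₁) (ξ : VisualBoundary X₁), f (g • ξ) = η g • f ξ) := by
  obtain ⟨f, hf, hη, -⟩ := exists_limitSet_equiv hX₁ hX₂ hG₁ hG₂ hflat₁ hflat₂ hrftp₁ hrftp₂
    hG₁.isQuasiconvexSubgroup_top hG₂.isQuasiconvexSubgroup_top
    ((Subgroup.topEquiv.trans η).trans Subgroup.topEquiv.symm)
  have h₁ : ∀ ξ, ξ ∈ limitSet X₁ (⊤ : Subgroup G₁) := fun ξ =>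
    hG₁.limitSet_top hX₁ ▸ mem_univ ξ
  have h₂ : ∀ ξ, ξ ∈ limitSet X₂ (⊤ : Subgroup G₂) := fun ξ =>
    hG₂.limitSet_top hX₂ ▸ mem_univ ξ
  refine ⟨((Equiv.subtypeUnivEquiv h₁).symm.trans f).trans (Equiv.subtypeUnivEquiv h₂),
    fun p₁ p₂ => ⟨?_, ?_⟩, fun g ξ => ?_⟩
  · exact continuous_coneTopology_of_coneTopologyOn_univ h₁ (hf p₁ p₂).1
  · exact continuous_coneTopology_of_coneTopologyOn_univ h₂ (hf p₁ p₂).2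
  · exact congrArg Subtype.val (hη ⟨g, trivial⟩ ⟨ξ, h₁ ξ⟩)

end LimitSets

end CAT0Boundary

theorem theorem1p2 {G₁ G₂ X₁ X₂ : Type*} [Group G₁] [Group G₂]
    [MetricSpace X₁] [MetricSpace X₂] [Nonempty X₁] [Nonempty X₂]
    [MulAction G₁ X₁] [MulAction G₂ X₂] [IsIsometricSMul G₁ X₁] [IsIsometricSMul G₂ X₂]
    (hρ₁ : IsGeometricAction G₁ X₁) (hρ₂ : IsGeometricAction G₂ X₂)
    (hX₁ : IsCAT0 X₁) (hX₂ : IsCAT0 X₂)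
    (hflat₁ : HasIsolatedFlats X₁) (hflat₂ : HasIsolatedFlats X₂)
    (hrftp₁ : HasRFTP X₁) (hrftp₂ : HasRFTP X₂) :
    (∀ (H₁ : Subgroup G₁) (H₂ : Subgroup G₂),
      IsQuasiconvexSubgroup X₁ H₁ → IsQuasiconvexSubgroup X₂ H₂ →
      ∀ η : H₁ ≃* H₂, ∃ f : limitSet X₁ H₁ ≃ limitSet X₂ H₂,
        (∀ (p₁ : X₁) (p₂ : X₂),
          Continuous[coneTopologyOn p₁ (limitSet X₁ H₁), coneTopologyOn p₂ (limitSet X₂ H₂)] f ∧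
          Continuous[coneTopologyOn p₂ (limitSet X₂ H₂), coneTopologyOn p₁ (limitSet X₁ H₁)]
            f.symm) ∧
        (∀ (h : H₁) (ξ : limitSet X₁ H₁), f (h • ξ) = η h • f ξ) ∧
        (∀ (x₁ : X₁) (x₂ : X₂) (h : ℕ → H₁) (ξ : limitSet X₁ H₁),
          ConvergesToBoundary (fun n => h n • x₁) (ξ : VisualBoundary X₁) →
          ConvergesToBoundary (fun n => η (h n) • x₂) (f ξ : VisualBoundary X₂))) ∧
    (∀ η : G₁ ≃* G₂, ∃ f : VisualBoundary X₁ ≃ VisualBoundary X₂,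
      (∀ (p₁ : X₁) (p₂ : X₂),
        Continuous[coneTopology p₁, coneTopology p₂] f ∧
        Continuous[coneTopology p₂, coneTopology p₁] f.symm) ∧
      (∀ (g : G₁) (ξ : VisualBoundary X₁), f (g • ξ) = η g • f ξ)) :=
  ⟨fun _ _ hq₁ hq₂ η =>
      exists_limitSet_equiv hX₁ hX₂ hρ₁ hρ₂ hflat₁ hflat₂ hrftp₁ hrftp₂ hq₁ hq₂ η,
    fun η => exists_visualBoundary_equiv hX₁ hX₂ hρ₁ hρ₂ hflat₁ hflat₂ hrftp₁ hrftp₂ η⟩
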